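/- Let $G$ be a torsion-free elementary amenable group of Hirsch length $h(G)=3$, and let $\sqrt{G}$ be its Hirsch--Plotkin radical, i.e. its largest locally nilpotent normal subgroup. (1) If $h(\sqrt{G})=1$, then $\sqrt{G}$ is abelian and $G/\sqrt{G}\cong\mathbb{Z}^2$. (2) If $h(\sqrt{G})=2$, then $\sqrt{G}$ is abelian and $G/\sqrt{G}$ is isomorphic to $\mathbb{Z}$, to the infinite dihedral group $D_\infty$, or to $\mathbb{Z}\oplus\mathbb{Z}/2\mathbb{Z}$. (3) If $h(\sqrt{G})=3$, then $G$ is virtually nilpotent. In all cases $G$ is solvable, of derived length at most $3$. Here the class of elementary amenable groups is the smallest class of groups containing all finite groups and all abelian groups and closed under subgroups, quotients, extensions and directed unions; the Hirsch length $h$ of elementary amenable groups, with values in $\mathbb{N}\cup\{\infty\}$, is the isomorphism invariant which is $0$ on finite groups and $1$ on $\mathbb{Z}$, is additive on extensions, and takes directed unions to suprema. -/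

import Mathlib

universe u

/-- The class of elementary amenable groups: the smallest class of groups which contains all finite
groups and all abelian groups and is closed under (isomorphism and) passage to subgroups,
quotients, extensions and directed unions. -/
inductive IsElementaryAmenable : (G : Type u) → [Group G] → Prop
  | of_finite (G : Type u) [Group G] (hG : Finite G) : IsElementaryAmenable G
  | of_comm (G : Type u) [Group G] (hG : ∀ a b : G, a * b = b * a) : IsElementaryAmenable G
  | of_injective (G H : Type u) [Group G] [Group H] (f : H →* G) (hf : Function.Injective f)
      (hG : IsElementaryAmenable G) : IsElementaryAmenable H
  | of_surjective (G H : Type u) [Group G] [Group H] (f : G →* H) (hf : Function.Surjective f)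
      (hG : IsElementaryAmenable G) : IsElementaryAmenable H
  | of_extension (G : Type u) [Group G] (N : Subgroup G) [N.Normal]
      (hN : IsElementaryAmenable N) (hQ : IsElementaryAmenable (G ⧸ N)) : IsElementaryAmenable G
  | of_directed (G : Type u) [Group G] (ι : Type u) [Nonempty ι] (S : ι → Subgroup G)
      (hdir : Directed (· ≤ ·) S) (htop : ∀ g : G, ∃ i, g ∈ S i)
      (hS : ∀ i, IsElementaryAmenable (S i)) : IsElementaryAmenable G

/-- `HasHirschLength G n` says that the Hirsch length `h(G)` of the elementary amenable group `G`
is `n`. The Hirsch length is the isomorphism invariant, with values in `ℕ ∪ {∞}`,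
which is `0` on finite groups and `1` on infinite cyclic groups, is additive on extensions,
and takes a directed union to the supremum of the values. These rules determine exactly one value
for every elementary amenable group. -/
inductive HasHirschLength : (G : Type u) → [Group G] → ℕ∞ → Prop
  | of_finite (G : Type u) [Group G] (hG : Finite G) : HasHirschLength G 0
  | of_infinite_cyclic (G : Type u) [Group G] (e : G ≃* Multiplicative ℤ) : HasHirschLength G 1
  | of_mulEquiv (G H : Type u) [Group G] [Group H] (e : G ≃* H) (n : ℕ∞)
      (hG : HasHirschLength G n) : HasHirschLength H n
  | of_extension (G : Type u) [Group G] (N : Subgroup G) [N.Normal] (m n : ℕ∞)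
      (hN : HasHirschLength N m) (hQ : HasHirschLength (G ⧸ N) n) : HasHirschLength G (m + n)
  | of_directed (G : Type u) [Group G] (ι : Type u) [Nonempty ι] (S : ι → Subgroup G)
      (hdir : Directed (· ≤ ·) S) (htop : ∀ g : G, ∃ i, g ∈ S i) (n : ι → ℕ∞)
      (hS : ∀ i, HasHirschLength (S i) (n i)) : HasHirschLength G (⨆ i, n i)

/-- A group is locally nilpotent if all its finitely generated subgroups are nilpotent. -/
def IsLocallyNilpotent (G : Type u) [Group G] : Prop :=
  ∀ H : Subgroup G, H.FG → Group.IsNilpotent H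

/-- The Hirsch–Plotkin radical `√G`, the largest locally nilpotent normal subgroup of `G`: the
subgroup generated by all locally nilpotent normal subgroups. -/
def hirschPlotkinRadical (G : Type u) [Group G] : Subgroup G :=
  sSup {N : Subgroup G | N.Normal ∧ IsLocallyNilpotent N}

instance hirschPlotkinRadical_normal (G : Type u) [Group G] :
    (hirschPlotkinRadical G).Normal :=
  Subgroup.sSup_normal _ fun _ hN => hN.1

open Subgroup
open scoped commutatorElement

universe v w

/-! The Hirsch length is first replaced by a rank `HasRank`, counted along finite towers of locally
finite and abelian groups. This rank is unique, additive on extensions and monotone, and a directed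
union of groups of bounded rank again has a rank (`directedUnionsHaveRank`). Induction over the
rules for the Hirsch length then gives `HasHirschLength.hasRank`.

Let `G` be torsion-free of rank 3 and let `R` be its Fitting subgroup. The class of a torsion-free
nilpotent group is at most its rank, so `R` is nilpotent and equals the Hirsch–Plotkin radical. It
contains its centralizer (`centralizer_fittingSubgroup_le`), and it is abelian if its rank is at
most 2. If `R` is abelian, `G/R` acts faithfully on `R ⊗ ℚ`. An element `g` with `g ^ k ∈ R` fixes
the vector of `g ^ k`, which is nonzero unless `g = 1`; in this way torsion-freeness of `G`
restricts the torsion of a rational linear group.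

Rank 1: `G/R` embeds in `ℚˣ` without meeting `-1`, so the `p`-adic valuations separate its elements
and it is free abelian.

Rank 2: the elements of `G/R` of positive determinant form a torsion-free group of rank one, which
is abelian. It is cyclic, since either the determinant is faithful on it, or all determinants are 1
and the height of the trace of a `k`-th power bounds `k`, so that roots are bounded. What remains is
the list of groups with an infinite cyclic subgroup of index at most two.

Rank 3: `G/R` is periodic, hence finite by Burnside's trace argument. If `R` is abelian, every
element of `G/R` has eigenvalue 1 and no element of order three is conjugate to its inverse; a
normal 3-complement shows that `G/R` is metabelian. If `R` is not abelian, it has class two and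
centre `Z` of rank one. Then `G/R` acts faithfully on the plane `R/Z ⊗ ℚ`, no reflection lifts to an
involution of `G/Z`, and therefore `G/R` is abelian and the second derived subgroup lies in `Z`. In
all cases the third derived subgroup is trivial. -/

/-! ### Locally finite groups -/

/-- A group is locally finite if all its finitely generated subgroups are finite. -/
def LocFinite (G : Type*) [Group G] : Prop :=
  ∀ H : Subgroup G, H.FG → Finite H

theorem fg_map {G : Type v} {H : Type w} [Group G] [Group H] (f : G →* H) {K : Subgroup G}
    (hK : K.FG) : (K.map f).FG := by
  classical
  obtain ⟨T, rfl⟩ := hK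
  exact ⟨T.image f, by rw [Finset.coe_image, MonoidHom.map_closure]⟩

namespace LocFinite

theorem of_injective {G : Type v} {H : Type w} [Group G] [Group H] (f : H →* G)
    (hf : Function.Injective f) (hG : LocFinite G) : LocFinite H := by
  intro K hK
  have : Finite (K.map f) := hG _ (fg_map f hK)
  exact Finite.of_equiv _ (K.equivMapOfInjective f hf).symm.toEquiv

theorem of_surjective {G : Type v} {H : Type w} [Group G] [Group H] (f : G →* H)
    (hf : Function.Surjective f) (hG : LocFinite G) : LocFinite H := by
  rintro K ⟨S, rfl⟩
  classical
  obtain ⟨T, rfl⟩ : ∃ T : Finset G, T.image f = S := by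
    refine ⟨S.image (Function.surjInv hf), ?_⟩
    ext x
    simp [Function.surjInv_eq]
  have : Finite (closure (T : Set G)) := hG _ ⟨T, rfl⟩
  rw [Finset.coe_image, ← MonoidHom.map_closure]
  exact Finite.of_surjective _ ((f.subgroupMap_surjective (closure (T : Set G))))

theorem subgroup {G : Type v} [Group G] (hG : LocFinite G) (H : Subgroup G) : LocFinite H :=
  hG.of_injective H.subtype H.subtype_injective

theorem mono {G : Type v} [Group G] {H K : Subgroup G} (hHK : H ≤ K) (hK : LocFinite K) :
    LocFinite H :=
  hK.of_injective (inclusion hHK) (inclusion_injective hHK)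

theorem map {G : Type v} {H : Type w} [Group G] [Group H] (f : G →* H) {K : Subgroup G}
    (hK : LocFinite K) : LocFinite (K.map f) :=
  hK.of_surjective (f.subgroupMap K) (f.subgroupMap_surjective K)

theorem of_finite {G : Type v} [Group G] [Finite G] : LocFinite G := fun _ _ => inferInstance

theorem isOfFinOrder {G : Type v} [Group G] (hG : LocFinite G) (g : G) : IsOfFinOrder g := by
  have : Finite (zpowers g) := hG _ ⟨{g}, by simp [zpowers_eq_closure]⟩
  exact finite_zpowers.mp (Set.toFinite _)

/-- Local finiteness is closed under extensions. -/
theorem of_ker {G : Type v} {Q : Type w} [Group G] [Group Q] (g : G →* Q) (hker : LocFinite g.ker)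
    (hQ : LocFinite Q) : LocFinite G := by
  intro H hH
  have : Group.FG H := (Group.fg_iff_subgroup_fg H).mpr hH
  have hr : Finite (g.domRestrict H).range := by
    rw [MonoidHom.domRestrict_range]
    exact hQ _ (fg_map g hH)
  have hfi : (g.domRestrict H).ker.FiniteIndex := inferInstance
  -- A subgroup of finite index in a finitely generated group is finitely generated, so local
  -- finiteness of `g.ker` applies to it.
  have hfg : Group.FG (g.domRestrict H).ker := inferInstance
  have hk : LocFinite (g.domRestrict H).ker := by
    refine hker.of_injective ((H.subtype.comp (g.domRestrict H).ker.subtype).codRestrict g.ker ?_) ?_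
    · rintro ⟨x, hx⟩
      exact hx
    · intro x y h
      exact Subtype.ext (Subtype.ext (Subtype.ext_iff.mp h :))
  have hkf : Finite (g.domRestrict H).ker := by
    have := hk ⊤ (Group.fg_def.mp hfg)
    exact Finite.of_equiv _ (Subgroup.topEquiv (G := (g.domRestrict H).ker)).toEquiv
  exact (g.domRestrict H).finite_iff_finite_ker_range.mpr ⟨hkf, hr⟩

theorem of_comm {G : Type v} [CommGroup G] (h : ∀ g : G, IsOfFinOrder g) : LocFinite G := by
  intro H hH
  have : Group.FG H := (Group.fg_iff_subgroup_fg H).mpr hH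
  exact CommGroup.finite_of_fg_isMulTorsion (G := H) fun x => by
    exact Submonoid.isOfFinOrder_coe.mp (h x)

end LocFinite

/-- A finite subset of a directed union of subgroups lies in one of them. -/
theorem exists_le_of_fg_of_directed {G : Type v} [Group G] {ι : Type w} [Nonempty ι]
    {S : ι → Subgroup G} (hdir : Directed (· ≤ ·) S) {H : Subgroup G} (hH : H.FG)
    (hle : ∀ x ∈ H, ∃ i, x ∈ S i) : ∃ i, H ≤ S i := by
  obtain ⟨T, rfl⟩ := hH
  classical
  have key : ∀ U : Finset G, U ⊆ T → ∃ i, (U : Set G) ⊆ S i := by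
    intro U
    induction U using Finset.induction_on with
    | empty => exact fun _ => ⟨Classical.arbitrary ι, by simp⟩
    | insert a U _ ih =>
      intro hU
      obtain ⟨i, hi⟩ := ih fun x hx => hU (Finset.mem_insert_of_mem hx)
      obtain ⟨j, hj⟩ := hle a (subset_closure (by exact_mod_cast hU (Finset.mem_insert_self a U)))
      obtain ⟨k, hik, hjk⟩ := hdir i j
      refine ⟨k, ?_⟩
      rw [Finset.coe_insert, Set.insert_subset_iff]
      exact ⟨hjk hj, fun x hx => hik (hi hx)⟩
  obtain ⟨i, hi⟩ := key T subset_rfl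
  exact ⟨i, (closure_le _).mpr hi⟩

theorem LocFinite.of_directed {G : Type v} [Group G] {ι : Type w} [Nonempty ι]
    {S : ι → Subgroup G} (hdir : Directed (· ≤ ·) S) (htop : ∀ g, ∃ i, g ∈ S i)
    (h : ∀ i, LocFinite (S i)) : LocFinite G := by
  intro H hH
  obtain ⟨i, hi⟩ := exists_le_of_fg_of_directed hdir hH fun x _ => htop x
  have hf : Finite (H.subgroupOf (S i)) := by
    refine h i _ ?_
    have : Group.FG H := (Group.fg_iff_subgroup_fg H).mpr hH
    exact (Group.fg_iff_subgroup_fg _).mp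
      (Group.fg_of_surjective (f := (subgroupOfEquivOfLe hi).symm.toMonoidHom)
        (subgroupOfEquivOfLe hi).symm.surjective)
  exact Finite.of_equiv _ (subgroupOfEquivOfLe hi).toEquiv

/-! ### The rank: additivity, uniqueness, monotonicity -/

/-- The torsion-free rank of an abelian group. -/
noncomputable def commRank (G : Type v) [CommGroup G] : ℕ∞ :=
  Cardinal.toENat (Module.rank ℤ (Additive G))

/-- `HasRank G n` says that `G` is built by finitely many extensions from locally finite groups and
abelian groups, and that the torsion-free ranks of the abelian groups used add up to `n`. -/
inductive HasRank : (G : Type u) → [Group G] → ℕ∞ → Prop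
  | locFinite (G : Type u) [Group G] (h : LocFinite G) : HasRank G 0
  | comm (G : Type u) [CommGroup G] : HasRank G (commRank G)
  | ext (N G Q : Type u) [Group N] [Group G] [Group Q] (i : N →* G) (p : G →* Q)
      (hi : Function.Injective i) (hp : Function.Surjective p) (hip : i.range = p.ker)
      (m n : ℕ∞) (hN : HasRank N m) (hQ : HasRank Q n) : HasRank G (m + n)

theorem commRank_eq_add {G Q : Type u} [CommGroup G] [CommGroup Q] (g : G →* Q)
    (hg : Function.Surjective g) : commRank g.ker + commRank Q = commRank G := by
  let f : Additive G →ₗ[ℤ] Additive Q := g.toAdditive.toIntLinearMap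
  have hf : Function.Surjective f := hg
  have e1 : Module.rank ℤ (Additive G ⧸ LinearMap.ker f) = Module.rank ℤ (Additive Q) :=
    (f.quotKerEquivOfSurjective hf).rank_eq
  have e2 : Module.rank ℤ (LinearMap.ker f) = Module.rank ℤ (Additive g.ker) :=
    LinearEquiv.rank_eq
      { toFun := fun x => Additive.ofMul ⟨x.1.toMul, x.2⟩
        invFun := fun x => ⟨Additive.ofMul x.toMul.1, x.toMul.2⟩
        map_add' := fun _ _ => rfl
        map_smul' := fun _ _ => rfl
        left_inv := fun _ => rfl
        right_inv := fun _ => rfl }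
  have := rank_quotient_add_rank_of_isDomain (LinearMap.ker f)
  rw [commRank, commRank, commRank, ← this, e1, e2, map_add, add_comm]

theorem commRank_eq_zero_iff {G : Type u} [CommGroup G] :
    commRank G = 0 ↔ ∀ g : G, IsOfFinOrder g := by
  rw [commRank, Cardinal.toENat_eq_zero, rank_eq_zero_iff]
  constructor
  · intro h g
    obtain ⟨a, ha, hag⟩ := h (Additive.ofMul g)
    exact isOfFinOrder_iff_zpow_eq_one.mpr ⟨a, ha, hag⟩
  · intro h g
    obtain ⟨a, ha, hag⟩ := isOfFinOrder_iff_zpow_eq_one.mp (h g.toMul)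
    exact ⟨a, ha, hag⟩

theorem ENat.exists_nat_of_add_eq {a b : ℕ∞} {n : ℕ} (h : a + b = n) :
    ∃ k l : ℕ, a = k ∧ b = l ∧ k + l = n := by
  have ha : a ≠ ⊤ := by
    rintro rfl
    exact ENat.natCast_ne_top n (by simpa using h.symm)
  have hb : b ≠ ⊤ := by
    rintro rfl
    exact ENat.natCast_ne_top n (by simpa using h.symm)
  lift a to ℕ using ha
  lift b to ℕ using hb
  exact ⟨a, b, rfl, rfl, by exact_mod_cast h⟩

namespace HasRank

theorem of_comm (G : Type u) [Group G] (h : ∀ a b : G, a * b = b * a) : ∃ n, HasRank G n :=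
  let _ : CommGroup G := { ‹Group G› with mul_comm := h }
  ⟨_, HasRank.comm G⟩

/-- An isomorphism is an extension with trivial quotient. This is why the constructor `ext` takes an
arbitrary short exact sequence. -/
theorem of_equiv {G H : Type u} [Group G] [Group H] (e : G ≃* H) {n : ℕ∞} (h : HasRank G n) :
    HasRank H n := by
  rw [← add_zero n]
  refine HasRank.ext G H PUnit e.toMonoidHom 1 e.injective
    (fun _ => ⟨1, rfl⟩) ?_ n 0 h (.locFinite _ .of_finite)
  ext x
  simp

theorem of_ker {G Q : Type u} [Group G] [Group Q] (p : G →* Q) (hp : Function.Surjective p)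
    {m n : ℕ∞} (hN : HasRank p.ker m) (hQ : HasRank Q n) : HasRank G (m + n) :=
  .ext _ G Q p.ker.subtype p p.ker.subtype_injective hp (by simp) m n hN hQ

theorem of_normal {G : Type u} [Group G] (N : Subgroup G) [N.Normal]
    {m n : ℕ∞} (hN : HasRank N m) (hQ : HasRank (G ⧸ N) n) : HasRank G (m + n) :=
  .ext _ G _ N.subtype (QuotientGroup.mk' N) N.subtype_injective (QuotientGroup.mk'_surjective N)
    (by simp) m n hN hQ

/-- For an extension `N → G → M`, the surjection `g` induces a surjection of `N` onto its image in
`Q`, and one of `M` onto the quotient of `Q` by that image. The two kernels assemble to `g.ker` and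
the two targets to `Q`, so the ranks only get rearranged. -/
theorem split {G : Type u} [Group G] {n : ℕ∞} (h : HasRank G n) {Q : Type u} [Group Q] (g : G →* Q)
    (hg : Function.Surjective g) : ∃ a b, HasRank g.ker a ∧ HasRank Q b ∧ a + b = n := by
  induction h generalizing Q with
  | locFinite G h => exact ⟨0, 0, .locFinite _ (h.subgroup _), .locFinite _ (h.of_surjective g hg), by simp⟩
  | @comm G _ =>
    have hQ : ∀ a b : Q, a * b = b * a := fun a b => by
      obtain ⟨x, rfl⟩ := hg a
      obtain ⟨y, rfl⟩ := hg b
      rw [← map_mul, mul_comm, map_mul]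
    let hcQ : CommGroup Q := { ‹Group Q› with mul_comm := hQ }
    exact ⟨_, _, HasRank.comm g.ker, HasRank.comm Q, commRank_eq_add g hg⟩
  | @ext N G M _ _ _ i p hi hp hip m n _ _ ihN ihM =>
    obtain ⟨a, b, ha, hb, rfl⟩ := ihN (g.comp i).rangeRestrict (g.comp i).rangeRestrict_surjective
    have hnorm : (g.comp i).range.Normal := by
      rw [MonoidHom.range_comp, hip]
      exact Subgroup.Normal.map inferInstance g hg
    let q := QuotientGroup.mk' (g.comp i).range
    have hlift : p.ker ≤ (q.comp g).ker := by
      rw [← hip]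
      rintro _ ⟨x, rfl⟩
      rw [MonoidHom.mem_ker]
      exact (QuotientGroup.eq_one_iff _).mpr ⟨x, rfl⟩
    let ψ : M →* Q ⧸ (g.comp i).range := p.liftOfSurjective hp ⟨q.comp g, hlift⟩
    have hψ : ∀ x, ψ (p x) = q (g x) :=
      fun x => p.liftOfRightInverse_comp_apply _ (Function.rightInverse_surjInv hp) ⟨q.comp g, hlift⟩ x
    have hψs : Function.Surjective ψ := by
      intro y
      obtain ⟨y, rfl⟩ := QuotientGroup.mk'_surjective _ y
      obtain ⟨x, rfl⟩ := hg y
      exact ⟨p x, hψ x⟩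
    obtain ⟨c, d, hc, hd, rfl⟩ := ihM ψ hψs
    refine ⟨a + c, b + d, ?_, ?_, by ac_rfl⟩
    · refine .ext (g.comp i).rangeRestrict.ker g.ker ψ.ker
        ((i.comp (Subgroup.subtype _)).codRestrict _ ?_)
        ((p.comp g.ker.subtype).codRestrict _ ?_) ?_ ?_ ?_ a c ha hc
      · rintro ⟨x, hx⟩
        rwa [MonoidHom.ker_rangeRestrict] at hx
      · rintro ⟨x, hx⟩
        rw [MonoidHom.mem_ker] at hx ⊢
        simp [hψ, hx]
      · intro x y hxy
        exact Subtype.ext (hi (Subtype.ext_iff.mp hxy))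
      · rintro ⟨y, hy⟩
        obtain ⟨x, rfl⟩ := hp y
        rw [MonoidHom.mem_ker, hψ] at hy
        obtain ⟨z, hz⟩ := (QuotientGroup.eq_one_iff _).mp hy
        refine ⟨⟨x * (i z)⁻¹, ?_⟩, Subtype.ext ?_⟩
        · rw [MonoidHom.mem_ker, map_mul, map_inv, ← hz]
          simp
        · have : p (i z) = 1 := by
            rw [← MonoidHom.mem_ker, ← hip]
            exact ⟨z, rfl⟩
          simp [this]
      · ext ⟨x, hx⟩
        have hx' := hx
        rw [MonoidHom.mem_ker] at hx'
        constructor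
        · rintro ⟨y, hy⟩
          rw [MonoidHom.mem_ker]
          refine Subtype.ext ?_
          have : i y.1 = x := Subtype.ext_iff.mp hy
          change p x = 1
          rw [← MonoidHom.mem_ker, ← hip, ← this]
          exact ⟨_, rfl⟩
        · intro hy
          have : p x = 1 := Subtype.ext_iff.mp hy
          rw [← MonoidHom.mem_ker, ← hip] at this
          obtain ⟨z, rfl⟩ := this
          exact ⟨⟨z, Subtype.ext hx'⟩, rfl⟩
    · refine .ext (g.comp i).range Q _ (Subgroup.subtype _) q (Subgroup.subtype_injective _)
        (QuotientGroup.mk'_surjective _) (by simp [q]) b d hb hd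

theorem split_normal {G : Type u} [Group G] {n : ℕ∞} (h : HasRank G n) (N : Subgroup G) [N.Normal] :
    ∃ a b, HasRank N a ∧ HasRank (G ⧸ N) b ∧ a + b = n := by
  have := h.split (QuotientGroup.mk' N) (QuotientGroup.mk'_surjective N)
  rwa [QuotientGroup.ker_mk'] at this

theorem of_injective {G : Type u} [Group G] {n : ℕ∞} (h : HasRank G n) {H : Type u} [Group H]
    (j : H →* G) (hj : Function.Injective j) : ∃ m ≤ n, HasRank H m := by
  induction h generalizing H with
  | locFinite G h => exact ⟨0, le_rfl, .locFinite _ (h.of_injective j hj)⟩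
  | @comm G _ =>
    let hcH : CommGroup H := { ‹Group H› with mul_comm := fun a b => hj (by
      rw [map_mul, map_mul, mul_comm]) }
    exact ⟨_, Cardinal.toENat.monotone' (LinearMap.rank_le_of_injective
      (j.toAdditive.toIntLinearMap) hj), HasRank.comm H⟩
  | @ext N G M _ _ _ i p hi hp hip m n _ _ ihN ihM =>
    have key : ∀ x : (p.comp j).ker, ∃ y, i y = j x := fun x => by
      have : j x ∈ p.ker := x.2
      rwa [← hip] at this
    let k : (p.comp j).ker →* N := (MonoidHom.ofInjective hi).symm.toMonoidHom.comp
      ((j.comp (Subgroup.subtype _)).codRestrict i.range key)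
    have hk : Function.Injective k := by
      refine (MonoidHom.ofInjective hi).symm.injective.comp fun x y hxy => ?_
      exact Subtype.ext (hj (Subtype.ext_iff.mp hxy))
    obtain ⟨a, ha, hNa⟩ := ihN k hk
    obtain ⟨b, hb, hMb⟩ := ihM (p.comp j).range.subtype (Subgroup.subtype_injective _)
    refine ⟨a + b, add_le_add ha hb, .of_ker (p.comp j).rangeRestrict
      (p.comp j).rangeRestrict_surjective ?_ hMb⟩
    rwa [MonoidHom.ker_rangeRestrict]

theorem subgroup {G : Type u} [Group G] {n : ℕ∞} (h : HasRank G n) (H : Subgroup G) :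
    ∃ m ≤ n, HasRank H m :=
  h.of_injective H.subtype H.subtype_injective

theorem eq_zero {G : Type u} [Group G] {n : ℕ∞} (h : HasRank G n) (hG : LocFinite G) : n = 0 := by
  induction h with
  | locFinite G h => rfl
  | @comm G _ => exact commRank_eq_zero_iff.mpr hG.isOfFinOrder
  | @ext N G M _ _ _ i p hi hp hip m n _ _ ihN ihM =>
    rw [ihN (hG.of_injective i hi), ihM (hG.of_surjective p hp), add_zero]

theorem locFinite_of_zero {G : Type u} [Group G] {n : ℕ∞} (h : HasRank G n) (hn : n = 0) :
    LocFinite G := by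
  induction h with
  | locFinite G h => exact h
  | @comm G _ => exact .of_comm (commRank_eq_zero_iff.mp hn)
  | @ext N G M _ _ _ i p hi hp hip m n _ _ ihN ihM =>
    rw [add_eq_zero] at hn
    refine .of_ker p ?_ (ihM hn.2)
    rw [← hip]
    exact (ihN hn.1).of_surjective i.rangeRestrict i.rangeRestrict_surjective

theorem eq_commRank {G : Type u} [Group G] {n : ℕ∞} (h : HasRank G n)
    (hG : ∀ a b : G, a * b = b * a) :
    n = @commRank G { ‹Group G› with mul_comm := hG } := by
  induction h with
  | locFinite G h =>
    let _ : CommGroup G := { ‹Group G› with mul_comm := hG }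
    exact (commRank_eq_zero_iff.mpr h.isOfFinOrder).symm
  | @comm G _ => rfl
  | @ext N G M _ _ _ i p hi hp hip m n hN hM ihN ihM =>
    let iG : CommGroup G := { ‹Group G› with mul_comm := hG }
    have hM' : ∀ a b : M, a * b = b * a := fun a b => by
      obtain ⟨x, rfl⟩ := hp a
      obtain ⟨y, rfl⟩ := hp b
      rw [← map_mul, hG, map_mul]
    have hN' : ∀ a b : N, a * b = b * a := fun a b => hi (by rw [map_mul, map_mul, hG])
    let iN : CommGroup N := { ‹Group N› with mul_comm := hN' }
    let iM : CommGroup M := { ‹Group M› with mul_comm := hM' }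
    rw [ihN hN', ihM hM']
    refine Eq.trans ?_ (commRank_eq_add p hp)
    congr 1
    refine congrArg Cardinal.toENat ?_
    let e : N ≃* p.ker := (MonoidHom.ofInjective hi).trans (MulEquiv.subgroupCongr hip)
    exact LinearEquiv.rank_eq (MulEquiv.toAdditive e).toIntLinearEquiv

/-- Splitting the second derivation along the last extension of the first reduces the claim to the
kernel and the quotient of that extension. -/
theorem unique {G : Type u} [Group G] {m n : ℕ∞} (hm : HasRank G m) (hn : HasRank G n) :
    m = n := by
  induction hm generalizing n with
  | locFinite G h => exact (hn.eq_zero h).symm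
  | @comm G _ => exact (hn.eq_commRank mul_comm).symm
  | @ext N G M _ _ _ i p hi hp hip a b hN hM ihN ihM =>
    obtain ⟨c, d, hc, hd, rfl⟩ := hn.split p hp
    rw [ihM hd, ihN (hc.of_equiv
      ((MonoidHom.ofInjective hi).trans (MulEquiv.subgroupCongr hip)).symm)]

theorem le_of_injective {G H : Type u} [Group G] [Group H] {m n : ℕ∞} (hH : HasRank H m)
    (hG : HasRank G n) (j : H →* G) (hj : Function.Injective j) : m ≤ n := by
  obtain ⟨a, ha, ha'⟩ := hG.of_injective j hj
  rwa [hH.unique ha']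

theorem mono {G : Type u} [Group G] {H K : Subgroup G} (hHK : H ≤ K) {m n : ℕ∞} (hH : HasRank H m)
    (hK : HasRank K n) : m ≤ n :=
  hH.le_of_injective hK (inclusion hHK) (inclusion_injective hHK)

/-- In an abelian group a finite independent set already lies in one member of the system. For an
extension, the preimages in `N` and the images in `M` are again directed systems, and directedness
lets the two suprema be added. -/
theorem le_iSup_of_directed {G : Type u} [Group G] {N : ℕ∞} (h : HasRank G N) {ι : Type w}
    [Nonempty ι] {S : ι → Subgroup G} (hdir : Directed (· ≤ ·) S) (htop : ∀ g, ∃ i, g ∈ S i)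
    {n : ι → ℕ∞} (hS : ∀ i, HasRank (S i) (n i)) : N ≤ ⨆ i, n i := by
  induction h generalizing n with
  | locFinite G h => exact zero_le
  | @comm G _ =>
    refine ENat.forall_natCast_le_iff_le.mp fun k hk => ?_
    have hk' : (k : Cardinal) ≤ Module.rank ℤ (Additive G) := by
      have := Cardinal.enat_gc.le_iff_le.mpr hk
      simpa using this
    obtain ⟨s, hsk, hs⟩ := exists_finset_linearIndependent_of_le_rank hk'
    obtain ⟨i, hi⟩ := exists_le_of_fg_of_directed hdir
      (H := closure (Additive.toMul '' (s : Set (Additive G))))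
      ⟨s.map ⟨Additive.toMul, Additive.toMul.injective⟩, by simp⟩ fun x _ => htop x
    refine le_trans ?_ (le_iSup n i)
    rw [(hS i).unique (HasRank.comm (S i)), commRank]
    refine Cardinal.enat_gc.le_iff_le.mp ?_
    have hmem : ∀ x : s, Additive.toMul x.1 ∈ S i :=
      fun x => hi (subset_closure ⟨x, x.2, rfl⟩)
    have hli : LinearIndependent ℤ (fun x : s => (Additive.ofMul ⟨Additive.toMul x.1, hmem x⟩ :
        Additive (S i))) :=
      LinearIndependent.of_comp (S i).subtype.toAdditive.toIntLinearMap hs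
    have := hli.cardinal_le_rank
    simpa [hsk] using this
  | @ext N G M _ _ _ i p hi hp hip a b hN hM ihN ihM =>
    have h1 : ∀ k, ∃ c d, HasRank ((S k).comap i) c ∧ HasRank ((S k).map p) d ∧ c + d = n k := by
      intro k
      obtain ⟨c, d, hc, hd, hcd⟩ := (hS k).split (p.subgroupMap (S k)) (p.subgroupMap_surjective _)
      refine ⟨c, d, ?_, hd, hcd⟩
      have key : ∀ x : (p.subgroupMap (S k)).ker, ((x : S k) : G) ∈ i.range := fun x => by
        rw [hip]
        exact Subtype.ext_iff.mp x.2
      let f : (S k).comap i →* (p.subgroupMap (S k)).ker :=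
        ((i.subgroupComap (S k))).codRestrict _ fun x => Subtype.ext <| by
          have : i x.1 ∈ p.ker := hip ▸ ⟨x.1, rfl⟩
          exact this
      have hf : Function.Bijective f := by
        constructor
        · intro x y hxy
          exact Subtype.ext (hi (Subtype.ext_iff.mp (Subtype.ext_iff.mp hxy)))
        · intro x
          obtain ⟨y, hy⟩ := key x
          exact ⟨⟨y, by rw [mem_comap, hy]; exact x.1.2⟩, Subtype.ext (Subtype.ext hy)⟩
      exact hc.of_equiv (MulEquiv.ofBijective f hf).symm
    choose c d hc hd hcd using h1
    have hN' := ihN (S := fun k => (S k).comap i) (fun k l => by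
      obtain ⟨m, hkm, hlm⟩ := hdir k l
      exact ⟨m, comap_mono hkm, comap_mono hlm⟩) (fun g => htop (i g)) hc
    have hM' := ihM (S := fun k => (S k).map p) (fun k l => by
      obtain ⟨m, hkm, hlm⟩ := hdir k l
      exact ⟨m, map_mono hkm, map_mono hlm⟩) (fun g => by
        obtain ⟨x, rfl⟩ := hp g
        obtain ⟨k, hk⟩ := htop x
        exact ⟨k, mem_map_of_mem p hk⟩) hd
    refine (add_le_add hN' hM').trans ?_
    simp_rw [← hcd]
    refine ENat.iSup_add_iSup_le fun k l => ?_
    obtain ⟨m, hkm, hlm⟩ := hdir k l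
    exact (add_le_add ((hc k).mono (comap_mono hkm) (hc m))
      ((hd l).mono (map_mono hlm) (hd m))).trans (le_iSup (fun k => c k + d k) m)

end HasRank

/-! ### The locally finite radical -/

/-- The locally finite radical: the largest locally finite normal subgroup. -/
def locFiniteRadical (G : Type*) [Group G] : Subgroup G :=
  sSup {N : Subgroup G | N.Normal ∧ LocFinite N}

theorem LocFinite.sup {G : Type v} [Group G] {M N : Subgroup G} [N.Normal] (hM : LocFinite M)
    (hN : LocFinite N) : LocFinite (M ⊔ N : Subgroup G) := by
  let f := (QuotientGroup.mk' N).subgroupMap (M ⊔ N)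
  refine .of_ker f (hN.of_injective (((M ⊔ N).subtype.comp f.ker.subtype).codRestrict N ?_) ?_) ?_
  · intro x
    exact (QuotientGroup.eq_one_iff _).mp (Subtype.ext_iff.mp x.2 :)
  · intro x y h
    exact Subtype.ext (Subtype.ext (Subtype.ext_iff.mp h :))
  · rw [Subgroup.map_sup, QuotientGroup.map_mk'_self, sup_bot_eq]
    exact hM.map _

theorem le_locFiniteRadical {G : Type v} [Group G] {N : Subgroup G} (hN : N.Normal)
    (h : LocFinite N) : N ≤ locFiniteRadical G :=
  le_sSup ⟨hN, h⟩

theorem locFinite_locFiniteRadical (G : Type v) [Group G] : LocFinite (locFiniteRadical G) := by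
  intro H hH
  let 𝒩 : Set (Subgroup G) := {N : Subgroup G | N.Normal ∧ LocFinite N}
  have hne : 𝒩.Nonempty := ⟨⊥, inferInstance, .of_finite⟩
  have hdir : DirectedOn (· ≤ ·) 𝒩 := fun M hM N hN =>
    ⟨M ⊔ N, ⟨haveI := hM.1; haveI := hN.1; inferInstance, haveI := hN.1; hM.2.sup hN.2⟩,
      le_sup_left, le_sup_right⟩
  have : Nonempty 𝒩 := hne.to_subtype
  obtain ⟨N, hN⟩ := exists_le_of_fg_of_directed (S := fun N : 𝒩 => N.1) hdir.directed_val
    (fg_map (locFiniteRadical G).subtype hH) fun x hx => by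
      obtain ⟨y, _, rfl⟩ := hx
      obtain ⟨N, hN, hyN⟩ := (mem_sSup_of_directedOn hne hdir).mp y.2
      exact ⟨⟨N, hN⟩, hyN⟩
  have hfg := (Group.fg_iff_subgroup_fg _).mpr (fg_map (locFiniteRadical G).subtype hH)
  have htop := (N.2.2.mono hN) ⊤ (Group.fg_def.mp hfg)
  have hf : Finite (H.map (locFiniteRadical G).subtype) :=
    Finite.of_equiv _ (Subgroup.topEquiv).toEquiv
  exact Finite.of_equiv _ (H.equivMapOfInjective _ (subtype_injective _)).symm.toEquiv

instance locFiniteRadical_characteristic (G : Type v) [Group G] :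
    (locFiniteRadical G).Characteristic := by
  refine characteristic_iff_map_le.mpr fun φ => le_locFiniteRadical ?_ ?_
  · have : (locFiniteRadical G).Normal := sSup_normal _ fun _ hN => hN.1
    exact this.map _ φ.surjective
  · exact (locFinite_locFiniteRadical G).map _

/-- A group has no nontrivial locally finite normal subgroup. -/
def NoLocFinite (G : Type*) [Group G] : Prop :=
  ∀ N : Subgroup G, N.Normal → LocFinite N → N = ⊥

theorem noLocFinite_quotient (G : Type v) [Group G] : NoLocFinite (G ⧸ locFiniteRadical G) := by
  intro N hN hNf
  let q := QuotientGroup.mk' (locFiniteRadical G)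
  have h : N.comap q ≤ locFiniteRadical G := by
    refine le_locFiniteRadical (hN.comap q) ?_
    refine .of_ker (q.subgroupComap N) ((locFinite_locFiniteRadical G).of_injective
      (((N.comap q).subtype.comp (Subgroup.subtype _)).codRestrict _ fun x => ?_) fun x y h => ?_) hNf
    · exact (QuotientGroup.eq_one_iff _).mp (Subtype.ext_iff.mp x.2 :)
    · exact Subtype.ext (Subtype.ext (Subtype.ext_iff.mp h :))
  rw [eq_bot_iff, ← map_comap_eq_self_of_surjective (QuotientGroup.mk'_surjective _) N]
  rintro _ ⟨x, hx, rfl⟩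
  exact (QuotientGroup.eq_one_iff _).mpr (h hx)

theorem noLocFinite_iff {G : Type v} [Group G] : NoLocFinite G ↔ locFiniteRadical G = ⊥ :=
  ⟨fun h => h _ inferInstance (locFinite_locFiniteRadical G),
    fun h _ hN hf => le_bot_iff.mp (h ▸ le_locFiniteRadical hN hf)⟩

theorem noLocFinite_of_torsionFree {G : Type v} [Group G]
    (h : ∀ g : G, g ≠ 1 → ¬ IsOfFinOrder g) : NoLocFinite G := fun _ _ hf => by
  refine (Subgroup.eq_bot_iff_forall _).mpr fun x hx => ?_
  by_contra hne
  exact h x hne (Submonoid.isOfFinOrder_coe.mpr (hf.isOfFinOrder ⟨x, hx⟩))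

theorem locFinite_of_comm {G : Type v} [Group G] {N : Subgroup G}
    (hc : ∀ a ∈ N, ∀ b ∈ N, a * b = b * a) (h : ∀ a ∈ N, IsOfFinOrder a) : LocFinite N := by
  let _ : CommGroup N :=
    { (inferInstance : Group N) with mul_comm := fun a b => Subtype.ext (hc a a.2 b b.2) }
  exact .of_comm fun a => Submonoid.isOfFinOrder_coe.mp (h a a.2)

theorem isOfFinOrder_conj {G : Type v} [Group G] {g x : G} (h : IsOfFinOrder x) :
    IsOfFinOrder (g * x * g⁻¹) :=
  (MulAut.conj g).toMonoidHom.isOfFinOrder h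

/-- An abelian normal subgroup is torsion-free if there are no locally finite normal subgroups. -/
theorem NoLocFinite.torsionFree {G : Type v} [Group G] (hG : NoLocFinite G) {B : Subgroup G}
    (hB : B.Normal) (hc : ∀ a ∈ B, ∀ b ∈ B, a * b = b * a) {b : G} (hb : b ∈ B)
    (hf : IsOfFinOrder b) : b = 1 := by
  let N : Subgroup G :=
    { carrier := {b | b ∈ B ∧ IsOfFinOrder b}
      one_mem' := ⟨one_mem _, IsOfFinOrder.one⟩
      mul_mem' := fun {a b} ha hb =>
        ⟨mul_mem ha.1 hb.1, Commute.isOfFinOrder_mul (hc a ha.1 b hb.1) ha.2 hb.2⟩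
      inv_mem' := fun h => ⟨inv_mem h.1, h.2.inv⟩ }
  have hN : N = ⊥ := hG N ⟨fun n hn g => ⟨hB.conj_mem n hn.1 g, isOfFinOrder_conj hn.2⟩⟩
    (locFinite_of_comm (fun a ha b hb => hc a ha.1 b hb.1) fun a ha => ha.2)
  exact (Subgroup.mem_bot.mp (hN ▸ (⟨hb, hf⟩ : b ∈ N)))

/-! ### Characteristic abelian subgroups -/

/-- A normal subgroup of full rank contains a power of every element. -/
theorem HasRank.exists_pow_mem {G : Type u} [Group G] {n : ℕ} (hG : HasRank G n) {K : Subgroup G}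
    [K.Normal] (hK : HasRank K n) (g : G) : ∃ k, 0 < k ∧ g ^ k ∈ K := by
  obtain ⟨a, b, ha, hb, hab⟩ := hG.split_normal K
  rw [ha.unique hK] at hab
  -- Cancelling the finite rank `n` leaves rank zero for the quotient, which is therefore locally
  -- finite and hence periodic.
  have hb0 : b = 0 := by
    have : b ≠ ⊤ := by
      rintro rfl
      simp at hab
    lift b to ℕ using this
    norm_cast at hab ⊢
    omega
  obtain ⟨k, hk, hgk⟩ := isOfFinOrder_iff_pow_eq_one.mp
    ((hb.locFinite_of_zero hb0).isOfFinOrder (QuotientGroup.mk' K g))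
  exact ⟨k, hk, (QuotientGroup.eq_one_iff _).mp (by rw [← hgk]; rfl)⟩

theorem HasRank.exists_nat {G : Type u} [Group G] {n : ℕ} (hG : HasRank G n) (K : Subgroup G) :
    ∃ m : ℕ, m ≤ n ∧ HasRank K m := by
  obtain ⟨m, hm, hK⟩ := hG.subgroup K
  lift m to ℕ using ne_top_of_le_ne_top (ENat.natCast_ne_top n) hm
  exact ⟨m, by exact_mod_cast hm, hK⟩

theorem pow_left_injective_of_comm {G : Type v} [Group G] {B : Subgroup G}
    (hc : ∀ a ∈ B, ∀ b ∈ B, a * b = b * a) (ht : ∀ b ∈ B, IsOfFinOrder b → b = 1) {a b : G}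
    (ha : a ∈ B) (hb : b ∈ B) {k : ℕ} (hk : 0 < k) (h : a ^ k = b ^ k) : a = b := by
  have hab : Commute a b⁻¹ := (Commute.inv_right (hc a ha b hb))
  refine mul_inv_eq_one.mp (ht _ (mul_mem ha (inv_mem hb)) (isOfFinOrder_iff_pow_eq_one.mpr
    ⟨k, hk, ?_⟩))
  rw [hab.mul_pow, h, inv_pow, mul_inv_cancel]

theorem characteristic_map_equiv {G : Type v} {H : Type w} [Group G] [Group H] (e : G ≃* H)
    {K : Subgroup G} (hK : K.Characteristic) : (K.map e.toMonoidHom).Characteristic := by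
  refine characteristic_iff_map_le.mpr fun φ => ?_
  have := characteristic_iff_map_le.mp hK ((e.trans φ).trans e.symm)
  rintro _ ⟨_, ⟨x, hx, rfl⟩, rfl⟩
  exact ⟨_, this ⟨x, hx, rfl⟩, by simp⟩

/-- Among the nontrivial abelian normal subgroups, one of minimal rank commutes with all its images
under automorphisms; these generate the required subgroup. -/
theorem exists_characteristic_comm {G : Type u} [Group G] {n : ℕ} (hG : HasRank G n)
    (hΛ : NoLocFinite G) {B : Subgroup G} (hB : B.Normal) (hB1 : B ≠ ⊥)
    (hc : ∀ a ∈ B, ∀ b ∈ B, a * b = b * a) :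
    ∃ C : Subgroup G, C.Characteristic ∧ C ≠ ⊥ ∧ ∀ a ∈ C, ∀ b ∈ C, a * b = b * a := by
  classical
  let P : ℕ → Prop := fun r => ∃ B : Subgroup G, B.Normal ∧ B ≠ ⊥ ∧
    (∀ a ∈ B, ∀ b ∈ B, a * b = b * a) ∧ HasRank B r
  have hP : ∃ r, P r := by
    obtain ⟨r, _, hr⟩ := hG.exists_nat B
    exact ⟨r, B, hB, hB1, hc, hr⟩
  obtain ⟨B, hB, hB1, hc, hr⟩ := Nat.find_spec hP
  have hmin : ∀ (C : Subgroup G) (m : ℕ), C.Normal → C ≠ ⊥ → (∀ a ∈ C, ∀ b ∈ C, a * b = b * a) →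
      HasRank C m → Nat.find hP ≤ m := fun C m h1 h2 h3 h4 => Nat.find_min' hP ⟨C, h1, h2, h3, h4⟩
  generalize Nat.find hP = r at hr hmin
  -- Normal subgroups with trivial intersection commute. Otherwise minimality gives `B ⊓ B'` full
  -- rank, so a power of each `c ∈ B'` lies in `B`; conjugation by `b` fixes that power, and roots
  -- in the torsion-free abelian group `B'` are unique.
  have key : ∀ B' : Subgroup G, B'.Normal → (∀ a ∈ B', ∀ b ∈ B', a * b = b * a) → HasRank B' r →
      ∀ b ∈ B, ∀ c ∈ B', b * c = c * b := by
    intro B' hB' hc' hr' b hb c hcB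
    by_cases hint : B ⊓ B' = ⊥
    · exact commute_of_normal_of_disjoint B B' hB hB' (disjoint_iff.mpr hint) b c hb hcB
    · obtain ⟨s, hs, hrs⟩ := hr.exists_nat ((B ⊓ B').subgroupOf B)
      have hrs1 : HasRank (B ⊓ B' : Subgroup G) s := hrs.of_equiv (subgroupOfEquivOfLe inf_le_left)
      have hsr : s = r := le_antisymm hs (hmin _ s inferInstance hint
        (fun a ha b hb => hc a ha.1 b hb.1) hrs1)
      subst hsr
      have := hr'.exists_pow_mem (K := (B ⊓ B').subgroupOf B')
        (hrs1.of_equiv (subgroupOfEquivOfLe inf_le_right).symm) ⟨c, hcB⟩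
      obtain ⟨k, hk, hck⟩ := this
      have hckB : c ^ k ∈ B := (mem_subgroupOf.mp hck).1
      have : b * c * b⁻¹ = c := by
        refine pow_left_injective_of_comm hc' (fun x hx => hΛ.torsionFree hB' hc' hx)
          (hB'.conj_mem c hcB b) hcB hk ?_
        rw [conj_pow, hc b hb _ hckB, mul_inv_cancel_right]
      exact mul_inv_eq_iff_eq_mul.mp this
  let C : Subgroup G := ⨆ φ : G ≃* G, B.map φ.toMonoidHom
  have hCc : ∀ a ∈ C, ∀ b ∈ C, a * b = b * a := by
    have h1 : ∀ φ : G ≃* G, ∀ a ∈ B.map φ.toMonoidHom, ∀ b ∈ C, a * b = b * a := by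
      intro φ a ha b hb
      have : C ≤ centralizer (B.map φ.toMonoidHom) := by
        refine iSup_le fun ψ => ?_
        rintro _ ⟨y, hy, rfl⟩
        refine mem_centralizer_iff.mpr ?_
        rintro _ ⟨x, hx, rfl⟩
        let B' := B.map (ψ.trans φ.symm).toMonoidHom
        have h := key B' (hB.map _ (ψ.trans φ.symm).surjective) ?_
          (hr.of_equiv (B.equivMapOfInjective _ (ψ.trans φ.symm).injective)) x hx
          (φ.symm (ψ y)) ⟨y, hy, rfl⟩
        · have := congrArg φ h
          simpa using this
        · rintro _ ⟨u, hu, rfl⟩ _ ⟨v, hv, rfl⟩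
          rw [← map_mul, hc u hu v hv, map_mul]
      exact mem_centralizer_iff.mp (this hb) a ha
    have h2 : C ≤ centralizer C := by
      refine iSup_le fun φ a ha => mem_centralizer_iff.mpr fun b hb => (h1 φ a ha b hb).symm
    exact fun a ha b hb => (mem_centralizer_iff.mp (h2 ha) b hb).symm
  refine ⟨C, characteristic_iff_map_le.mpr fun φ => ?_, ?_, hCc⟩
  · rw [Subgroup.map_iSup]
    refine iSup_le fun ψ => ?_
    rw [map_map]
    exact le_iSup (fun φ : G ≃* G => B.map φ.toMonoidHom) (ψ.trans φ)
  · intro h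
    refine hB1 (le_bot_iff.mp (h ▸ ?_))
    have := le_iSup (fun φ : G ≃* G => B.map φ.toMonoidHom) (MulEquiv.refl G)
    exact fun x hx => this ⟨x, hx, rfl⟩

/-- A nontrivial group of finite rank has a nontrivial characteristic subgroup which is locally
finite or abelian. -/
theorem HasRank.exists_characteristic {G : Type u} [Group G] {r : ℕ∞} (hG : HasRank G r) {n : ℕ}
    (hn : r = n) : Nontrivial G →
    ∃ C : Subgroup G, C.Characteristic ∧ C ≠ ⊥ ∧ (LocFinite C ∨ ∀ a ∈ C, ∀ b ∈ C, a * b = b * a) := by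
  induction hG generalizing n with
  | locFinite G h => exact fun _ => ⟨⊤, inferInstance, top_ne_bot, .inl (h.subgroup _)⟩
  | @comm G _ => exact fun _ => ⟨⊤, inferInstance, top_ne_bot, .inr fun a _ b _ => mul_comm a b⟩
  | @ext N G Q _ _ _ i p hi hp hip a b hN hQ ihN ihQ =>
    intro hnt
    have ha : a ≠ ⊤ := by
      rintro rfl
      simp at hn
    have hb : b ≠ ⊤ := by
      rintro rfl
      simp at hn
    lift a to ℕ using ha
    lift b to ℕ using hb
    rcases subsingleton_or_nontrivial N with hs | hs
    · have hinj : Function.Injective p := by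
        rw [← MonoidHom.ker_eq_bot_iff, ← hip, eq_bot_iff]
        rintro _ ⟨x, rfl⟩
        simp [Subsingleton.elim x 1]
      let e : G ≃* Q := MulEquiv.ofBijective p ⟨hinj, hp⟩
      have : Nontrivial Q := e.toEquiv.nontrivial_congr.mp hnt
      obtain ⟨C, hC, hC1, hC2⟩ := ihQ rfl this
      refine ⟨C.map e.symm.toMonoidHom, characteristic_map_equiv e.symm hC, ?_, ?_⟩
      · rwa [Ne, map_eq_bot_iff_of_injective _ e.symm.injective]
      · refine hC2.imp (fun h => h.map _) ?_
        rintro h _ ⟨x, hx, rfl⟩ _ ⟨y, hy, rfl⟩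
        rw [← map_mul, h x hx y hy, map_mul]
    · obtain ⟨C, hC, hC1, hC2⟩ := ihN rfl hs
      let e : N ≃* i.range := MonoidHom.ofInjective hi
      have hnorm : i.range.Normal := hip ▸ inferInstance
      have := characteristic_map_equiv e hC
      let D : Subgroup G := (C.map e.toMonoidHom).map i.range.subtype
      have hD : D.Normal := ConjAct.normal_of_characteristic_of_normal
      have hDi : D = C.map i := by
        change (C.map e.toMonoidHom).map i.range.subtype = _
        rw [map_map]
        rfl
      have hD1 : D ≠ ⊥ := by
        rwa [hDi, Ne, map_eq_bot_iff_of_injective _ hi]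
      -- So far `D` is only normal, and the next extension up needs a characteristic subgroup. If
      -- the locally finite radical is nontrivial it serves; if not, `D` is abelian and
      -- `exists_characteristic_comm` applies.
      by_cases hΛ : NoLocFinite G
      · rcases hC2 with h | h
        · exact absurd (hΛ D hD (hDi ▸ h.map i)) hD1
        · obtain ⟨C, h1, h2, h3⟩ := exists_characteristic_comm (hn ▸ HasRank.ext N G Q i p hi hp hip _ _ hN hQ)
            hΛ hD hD1 (by
              rw [hDi]
              rintro _ ⟨x, hx, rfl⟩ _ ⟨y, hy, rfl⟩
              rw [← map_mul, h x hx y hy, map_mul])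
          exact ⟨C, h1, h2, .inr h3⟩
      · exact ⟨locFiniteRadical G, inferInstance, fun h => hΛ (noLocFinite_iff.mpr h),
          .inl (locFinite_locFiniteRadical G)⟩

/-! ### Torsion-free nilpotent groups -/

/-- Every element of finite order is trivial. -/
def TorsionFree (G : Type*) [Group G] : Prop := ∀ g : G, IsOfFinOrder g → g = 1

theorem TorsionFree.of_injective {G : Type v} {H : Type w} [Group G] [Group H] (hG : TorsionFree G)
    (f : H →* G) (hf : Function.Injective f) : TorsionFree H := fun h hh =>
  hf (by rw [hG _ (f.isOfFinOrder hh), map_one])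

theorem TorsionFree.subgroup {G : Type v} [Group G] (hG : TorsionFree G) (H : Subgroup G) :
    TorsionFree H :=
  hG.of_injective H.subtype H.subtype_injective

theorem TorsionFree.eq_one_of_pow {G : Type v} [Group G] (hG : TorsionFree G) {g : G} {k : ℕ}
    (hk : 0 < k) (h : g ^ k = 1) : g = 1 :=
  hG g (isOfFinOrder_iff_pow_eq_one.mpr ⟨k, hk, h⟩)

theorem TorsionFree.noLocFinite {G : Type v} [Group G] (hG : TorsionFree G) : NoLocFinite G :=
  noLocFinite_of_torsionFree fun g hg hf => hg (hG g hf)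

theorem TorsionFree.not_locFinite {G : Type v} [Group G] [Nontrivial G] (hG : TorsionFree G) :
    ¬ LocFinite G := fun h => by
  obtain ⟨g, hg⟩ := exists_ne (1 : G)
  exact hg (hG g (h.isOfFinOrder g))

/-- If `x` is central modulo the centre, then `y x y⁻¹ = x c` with `c` central. If moreover `x ^ k`
is central, comparing `k`-th powers gives `c ^ k = 1`, hence `c = 1`. -/
theorem TorsionFree.center_quotient {G : Type v} [Group G] (hG : TorsionFree (center G)) :
    TorsionFree (center (G ⧸ center G)) := by
  rintro ⟨z, hz⟩ hf
  obtain ⟨x, rfl⟩ := QuotientGroup.mk_surjective z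
  obtain ⟨k, hk, hkx⟩ := isOfFinOrder_iff_pow_eq_one.mp hf
  have hxk : x ^ k ∈ center G := (QuotientGroup.eq_one_iff _).mp (Subtype.ext_iff.mp hkx :)
  refine Subtype.ext ((QuotientGroup.eq_one_iff _).mpr (mem_center_iff.mpr fun y => ?_))
  have hc : x⁻¹ * (y * x * y⁻¹) ∈ center G := by
    rw [← QuotientGroup.eq_one_iff]
    have := mem_center_iff.mp hz (y : G ⧸ center G)
    rw [QuotientGroup.mk_mul, QuotientGroup.mk_mul, QuotientGroup.mk_mul]
    change (x : G ⧸ center G)⁻¹ * (y * x * (y : G ⧸ center G)⁻¹) = 1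
    rw [this]
    group
  set c := x⁻¹ * (y * x * y⁻¹) with hcdef
  have h1 : y * x * y⁻¹ = x * c := by rw [hcdef]; group
  have hxc : Commute x c := mem_center_iff.mp hc x
  have h2 : c ^ k = 1 := by
    have h3 : (y * x * y⁻¹) ^ k = x ^ k := by
      rw [conj_pow, mem_center_iff.mp hxk, mul_inv_cancel_right]
    rw [h1, hxc.mul_pow] at h3
    exact mul_eq_left.mp h3
  have h4 : (⟨c, hc⟩ : center G) = 1 := hG.eq_one_of_pow hk (Subtype.ext h2)
  have h5 : c = 1 := Subtype.ext_iff.mp h4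
  rw [h5, mul_one] at h1
  exact mul_inv_eq_iff_eq_mul.mp h1

/-- A nilpotent group with torsion-free center is torsion-free. -/
theorem torsionFree_of_center {G : Type v} [Group G] [Group.IsNilpotent G] :
    TorsionFree (center G) → TorsionFree G := by
  refine Group.nilpotent_center_quotient_ind (P := fun G _ _ =>
    TorsionFree (center G) → TorsionFree G) G ?_ ?_
  · exact fun G _ _ _ g _ => Subsingleton.elim _ _
  · intro G _ _ ih hc g hg
    have h := ih hc.center_quotient (g : G ⧸ center G) ((QuotientGroup.mk' (center G)).isOfFinOrder hg)
    have hgc := (QuotientGroup.eq_one_iff _).mp h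
    exact Subtype.ext_iff.mp (hc ⟨g, hgc⟩ (Submonoid.isOfFinOrder_coe.mp hg))

theorem TorsionFree.quotient_center {G : Type v} [Group G] [Group.IsNilpotent G]
    (hG : TorsionFree G) : TorsionFree (G ⧸ center G) :=
  torsionFree_of_center (hG.subgroup _).center_quotient

theorem HasRank.one_le {G : Type u} [Group G] {n : ℕ∞} (h : HasRank G n) (hG : ¬ LocFinite G) :
    1 ≤ n :=
  Order.one_le_iff_ne_zero.mpr fun hn => hG (h.locFinite_of_zero hn)

/-- The nilpotency class of a torsion-free nilpotent group is at most its rank. -/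
theorem HasRank.nilpotencyClass_le {G : Type u} [Group G] [Group.IsNilpotent G] {n : ℕ} :
    HasRank G n → TorsionFree G → Group.nilpotencyClass G ≤ n := by
  refine Group.nilpotent_center_quotient_ind (P := fun G _ _ => ∀ n : ℕ,
    HasRank G n → TorsionFree G → Group.nilpotencyClass G ≤ n) G ?_ ?_ n
  · intro G _ _ n _ _
    rw [Group.nilpotencyClass_zero_iff_subsingleton.mpr ‹_›]
    exact Nat.zero_le _
  · intro G _ _ ih n hn hG
    rcases subsingleton_or_nontrivial G with hs | hs
    · rw [Group.nilpotencyClass_zero_iff_subsingleton.mpr ‹_›]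
      exact Nat.zero_le _
    obtain ⟨a, b, ha, hb, hab⟩ := hn.split_normal (center G)
    have : Nontrivial (center G) := (nontrivial_iff_ne_bot _).mpr (Group.IsNilpotent.center_ne_bot G)
    have ha1 := ha.one_le (hG.subgroup _).not_locFinite
    obtain ⟨a, b, rfl, rfl, hab⟩ := ENat.exists_nat_of_add_eq hab
    have := ih b hb hG.quotient_center
    rw [Group.nilpotencyClass_eq_quotient_center_plus_one]
    norm_cast at hab ha1
    omega

/-- Roots are unique in torsion-free nilpotent groups. -/
theorem TorsionFree.pow_left_injective {G : Type v} [Group G] [Group.IsNilpotent G] :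
    TorsionFree G → ∀ (k : ℕ), 0 < k → ∀ a b : G, a ^ k = b ^ k → a = b := by
  refine Group.nilpotent_center_quotient_ind (P := fun G _ _ =>
    TorsionFree G → ∀ (k : ℕ), 0 < k → ∀ a b : G, a ^ k = b ^ k → a = b) G ?_ ?_
  · exact fun G _ _ _ _ _ _ _ _ => Subsingleton.elim _ _
  · intro G _ _ ih hG k hk a b hab
    have h := ih hG.quotient_center k hk (a : G ⧸ center G) b (by exact_mod_cast congrArg _ hab)
    have hc : b⁻¹ * a ∈ center G := QuotientGroup.eq.mp h.symm
    have hbc : Commute b (b⁻¹ * a) := mem_center_iff.mp hc b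
    have h2 : a ^ k = b ^ k * (b⁻¹ * a) ^ k := by
      rw [← hbc.mul_pow, mul_inv_cancel_left]
    rw [hab] at h2
    have := hG.eq_one_of_pow hk (left_eq_mul.mp h2)
    exact (inv_mul_eq_one.mp this).symm

/-- A subgroup of full rank of a nilpotent group contains a power of every element. -/
theorem HasRank.exists_pow_mem_of_nilpotent {G : Type u} [Group G] [Group.IsNilpotent G] {n : ℕ} :
    HasRank G n → ∀ K : Subgroup G, HasRank K n → ∀ g : G, ∃ k, 0 < k ∧ g ^ k ∈ K := by
  refine Group.nilpotent_center_quotient_ind (P := fun G _ _ => ∀ n : ℕ,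
    HasRank G n → ∀ K : Subgroup G, HasRank K n → ∀ g : G, ∃ k, 0 < k ∧ g ^ k ∈ K) G ?_ ?_ n
  · exact fun G _ _ _ _ K _ g => ⟨1, one_pos, Subsingleton.elim 1 (g ^ 1) ▸ one_mem K⟩
  · intro G _ _ ih n hG K hK g
    let q := QuotientGroup.mk' (center G)
    obtain ⟨a, b, ha, hb, hab⟩ := hG.split_normal (center G)
    obtain ⟨c, d, hc, hd, hcd⟩ := hK.split (q.subgroupMap K) (q.subgroupMap_surjective K)
    have hc' : HasRank ((center G ⊓ K).subgroupOf (center G)) c := by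
      refine HasRank.of_equiv (subgroupOfEquivOfLe inf_le_left).symm (hc.of_equiv ?_)
      refine
        { toFun := fun x => ⟨x.1.1, (QuotientGroup.eq_one_iff _).mp (Subtype.ext_iff.mp x.2 :), x.1.2⟩
          invFun := fun x => ⟨⟨x.1, x.2.2⟩, Subtype.ext ((QuotientGroup.eq_one_iff _).mpr x.2.1)⟩
          left_inv := fun _ => rfl
          right_inv := fun _ => rfl
          map_mul' := fun _ _ => rfl }
    have hca : c ≤ a := hc'.le_of_injective ha (Subgroup.subtype _) (subtype_injective _)
    have hdb : d ≤ b := hd.le_of_injective hb (Subgroup.subtype _) (subtype_injective _)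
    obtain ⟨a, b, rfl, rfl, hab⟩ := ENat.exists_nat_of_add_eq hab
    lift c to ℕ using ne_top_of_le_ne_top (ENat.natCast_ne_top a) hca
    lift d to ℕ using ne_top_of_le_ne_top (ENat.natCast_ne_top b) hdb
    norm_cast at hab hcd hca hdb
    -- Neither part of the rank of `K` exceeds the corresponding part of the rank of `G`, and the
    -- totals agree.
    obtain rfl : c = a := by omega
    obtain rfl : d = b := by omega
    obtain ⟨k, hk, x, hx, hxk⟩ := ih d hb (K.map q) hd (g : G ⧸ center G)
    -- The power `g ^ k` agrees with `x ∈ K` up to a central factor, and a power of that factor lies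
    -- in `K` because `K` meets the centre in full rank.
    have hz : x⁻¹ * g ^ k ∈ center G := QuotientGroup.eq.mp (by
      rw [QuotientGroup.mk_pow]
      exact hxk)
    obtain ⟨l, hl, hlz⟩ := ha.exists_pow_mem hc' ⟨_, hz⟩
    have hlz' : (x⁻¹ * g ^ k) ^ l ∈ K := (mem_subgroupOf.mp hlz).2
    refine ⟨k * l, Nat.mul_pos hk hl, ?_⟩
    have hcomm : Commute x (x⁻¹ * g ^ k) := mem_center_iff.mp hz x
    rw [pow_mul, ← mul_inv_cancel_left x (g ^ k), hcomm.mul_pow]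
    exact mul_mem (pow_mem hx l) hlz'

/-! ### Fitting's theorem and the Fitting subgroup -/

theorem commutator_le_iff_map_le_centralizer {G : Type v} [Group G] {A B N : Subgroup G} [N.Normal] :
    ⁅A, B⁆ ≤ N ↔ A.map (QuotientGroup.mk' N) ≤ centralizer (B.map (QuotientGroup.mk' N)) := by
  rw [← commutator_eq_bot_iff_le_centralizer, ← map_commutator, Subgroup.map_eq_bot_iff, QuotientGroup.ker_mk']

theorem commutator_sup_le {G : Type v} [Group G] {A B C N : Subgroup G} [N.Normal]
    (hB : ⁅A, B⁆ ≤ N) (hC : ⁅A, C⁆ ≤ N) : ⁅A, B ⊔ C⁆ ≤ N := by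
  rw [commutator_comm, commutator_le_iff_map_le_centralizer] at *
  rw [Subgroup.map_sup]
  exact sup_le hB hC

theorem iSup_commutator_le {G : Type v} [Group G] {ι : Sort*} {A : ι → Subgroup G}
    {B N : Subgroup G} [N.Normal] (h : ∀ i, ⁅A i, B⁆ ≤ N) : ⁅⨆ i, A i, B⁆ ≤ N := by
  simp_rw [commutator_le_iff_map_le_centralizer] at *
  rw [Subgroup.map_iSup]
  exact iSup_le h

/-- The lower central series of a subgroup, shifted by one and starting at the whole group. -/
def shiftedLCS {G : Type*} [Group G] (H : Subgroup G) : ℕ → Subgroup G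
  | 0 => ⊤
  | n + 1 => H.lowerCentralSeries n

instance shiftedLCS_normal {G : Type*} [Group G] (H : Subgroup G) [H.Normal] (n : ℕ) :
    (shiftedLCS H n).Normal := by
  cases n <;> simp only [shiftedLCS] <;> infer_instance

theorem commutator_shiftedLCS {G : Type*} [Group G] (H : Subgroup G) [H.Normal] (n : ℕ) :
    ⁅shiftedLCS H n, H⁆ ≤ shiftedLCS H (n + 1) := by
  cases n with
  | zero => exact commutator_le_right _ _
  | succ n => exact le_rfl

/-- **Fitting's theorem** -/
theorem isNilpotent_sup {G : Type v} [Group G] {H K : Subgroup G} [H.Normal] [K.Normal]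
    (hH : Group.IsNilpotent H) (hK : Group.IsNilpotent K) :
    Group.IsNilpotent (H ⊔ K : Subgroup G) := by
  obtain ⟨c, hc⟩ := (isNilpotent_iff_lowerCentralSeries H).mp hH
  obtain ⟨d, hd⟩ := (isNilpotent_iff_lowerCentralSeries K).mp hK
  -- A commutator with `H` raises the first index and one with `K` raises the second, so `N`
  -- descends at least as fast as the lower central series of `H ⊔ K`. The shift is needed so that
  -- index 0 stands for no condition at all.
  let N : ℕ → Subgroup G := fun n => ⨆ p : {p : ℕ × ℕ // n ≤ p.1 + p.2},
    shiftedLCS H p.1.1 ⊓ shiftedLCS K p.1.2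
  have hN : ∀ n, (N n).Normal := fun n => by infer_instance
  have hle : ∀ n, (H ⊔ K).lowerCentralSeries n ≤ N n := by
    intro n
    induction n with
    | zero =>
      refine le_trans le_top (le_trans ?_ (le_iSup (fun p : {p : ℕ × ℕ // 0 ≤ p.1 + p.2} =>
        shiftedLCS H p.1.1 ⊓ shiftedLCS K p.1.2) ⟨(0, 0), le_rfl⟩))
      simp [shiftedLCS]
    | succ n ih =>
      rw [Subgroup.lowerCentralSeries_succ]
      refine (commutator_mono ih le_rfl).trans (iSup_commutator_le ?_)
      rintro ⟨⟨i, j⟩, hij⟩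
      refine commutator_sup_le ?_ ?_
      · refine le_trans ?_ (le_iSup (fun p : {p : ℕ × ℕ // n + 1 ≤ p.1 + p.2} =>
          shiftedLCS H p.1.1 ⊓ shiftedLCS K p.1.2) ⟨(i + 1, j), by grind⟩)
        exact le_inf ((commutator_mono inf_le_left le_rfl).trans (commutator_shiftedLCS H i))
          ((commutator_le_left _ _).trans inf_le_right)
      · refine le_trans ?_ (le_iSup (fun p : {p : ℕ × ℕ // n + 1 ≤ p.1 + p.2} =>
          shiftedLCS H p.1.1 ⊓ shiftedLCS K p.1.2) ⟨(i, j + 1), by grind⟩)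
        exact le_inf ((commutator_le_left _ _).trans inf_le_left)
          ((commutator_mono inf_le_right le_rfl).trans (commutator_shiftedLCS K j))
  -- Because of the shift, vanishing is guaranteed only from the indices `c + 1` and `d + 1` on; `i
  -- + j ≥ c + d + 1` forces `i > c` or `j > d`.
  refine isNilpotent_of_lowerCentralSeries_eq_bot (n := c + d + 1) (le_bot_iff.mp ((hle _).trans ?_))
  refine iSup_le ?_
  rintro ⟨⟨i, j⟩, hij⟩
  have hij : c + d + 1 ≤ i + j := hij
  rcases lt_or_ge c i with h | h
  · obtain ⟨i, rfl⟩ := Nat.exists_eq_add_of_lt h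
    refine inf_le_left.trans ?_
    rw [← hc]
    exact H.lowerCentralSeries_antitone (by omega)
  · obtain ⟨j, rfl⟩ := Nat.exists_eq_add_of_lt (show d < j by omega)
    refine inf_le_right.trans ?_
    rw [← hd]
    exact K.lowerCentralSeries_antitone (by omega)

/-- Membership in a term of the lower central series is witnessed in a finitely generated
subgroup. -/
theorem exists_fg_mem_lowerCentralSeries {G : Type v} [Group G] {S : Subgroup G} {n : ℕ} {g : G}
    (hg : g ∈ S.lowerCentralSeries n) : ∃ H : Subgroup G, H.FG ∧ H ≤ S ∧ g ∈ H.lowerCentralSeries n := by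
  induction n generalizing g with
  | zero =>
    refine ⟨zpowers g, ⟨{g}, by simp [zpowers_eq_closure]⟩, ?_, mem_zpowers g⟩
    rwa [zpowers_le]
  | succ n ih =>
    have hg' : g ∈ closure {x | ∃ p ∈ S.lowerCentralSeries n, ∃ q ∈ S, ⁅p, q⁆ = x} := hg
    induction hg' using closure_induction with
    | mem x hx =>
      obtain ⟨p, hp, q, hq, rfl⟩ := hx
      obtain ⟨H, hH, hHS, hpH⟩ := ih hp
      refine ⟨H ⊔ zpowers q, hH.sup ⟨{q}, by simp [zpowers_eq_closure]⟩, sup_le hHS (by rwa [zpowers_le]),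
        commutator_mem_commutator (lowerCentralSeries_mono n le_sup_left hpH)
          (le_sup_right (a := H) (mem_zpowers q))⟩
    | one => exact ⟨⊥, ⟨∅, by simp⟩, bot_le, one_mem _⟩
    | mul x y hx hy h1 h2 =>
      obtain ⟨H, hH, hHS, hxH⟩ := h1 hx
      obtain ⟨K, hK, hKS, hyK⟩ := h2 hy
      exact ⟨H ⊔ K, hH.sup hK, sup_le hHS hKS, mul_mem (lowerCentralSeries_mono _ le_sup_left hxH)
        (lowerCentralSeries_mono _ le_sup_right hyK)⟩
    | inv x hx h1 =>
      obtain ⟨H, hH, hHS, hxH⟩ := h1 hx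
      exact ⟨H, hH, hHS, inv_mem hxH⟩

/-- The subgroup generated by all nilpotent normal subgroups. -/
def fittingSubgroup (G : Type*) [Group G] : Subgroup G :=
  sSup {N : Subgroup G | N.Normal ∧ Group.IsNilpotent N}

instance fittingSubgroup_normal (G : Type*) [Group G] : (fittingSubgroup G).Normal :=
  sSup_normal _ fun _ hN => hN.1

theorem le_fittingSubgroup {G : Type*} [Group G] {N : Subgroup G} (hN : N.Normal)
    (h : Group.IsNilpotent N) : N ≤ fittingSubgroup G :=
  le_sSup ⟨hN, h⟩

theorem exists_nilpotent_of_fg_le_fittingSubgroup {G : Type v} [Group G] {H : Subgroup G}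
    (hH : H.FG) (hle : H ≤ fittingSubgroup G) :
    ∃ N : Subgroup G, N.Normal ∧ Group.IsNilpotent N ∧ H ≤ N := by
  let 𝒩 : Set (Subgroup G) := {N : Subgroup G | N.Normal ∧ Group.IsNilpotent N}
  have hne : 𝒩.Nonempty := ⟨⊥, inferInstance, inferInstance⟩
  have hdir : DirectedOn (· ≤ ·) 𝒩 := fun M hM N hN =>
    haveI := hM.1
    haveI := hN.1
    ⟨M ⊔ N, ⟨inferInstance, isNilpotent_sup hM.2 hN.2⟩, le_sup_left, le_sup_right⟩
  have : Nonempty 𝒩 := hne.to_subtype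
  obtain ⟨N, hN⟩ := exists_le_of_fg_of_directed (S := fun N : 𝒩 => N.1) hdir.directed_val hH
    fun x hx => by
      obtain ⟨N, hN, hyN⟩ := (mem_sSup_of_directedOn hne hdir).mp (hle hx)
      exact ⟨⟨N, hN⟩, hyN⟩
  exact ⟨N, N.2.1, N.2.2, hN⟩

/-- The centre of `N` is characteristic in `N`, hence an abelian normal subgroup of `G` and
torsion-free; a nilpotent group inherits this from its centre. -/
theorem NoLocFinite.torsionFree_of_nilpotent {G : Type v} [Group G] (hG : NoLocFinite G)
    {N : Subgroup G} (hN : N.Normal) (h : Group.IsNilpotent N) : TorsionFree N := by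
  refine torsionFree_of_center fun z hz => ?_
  have hc : ((center N).map N.subtype).Normal := ConjAct.normal_of_characteristic_of_normal
  have := hG.torsionFree hc ?_ (b := ((z : N) : G)) ⟨z, z.2, rfl⟩
    (Submonoid.isOfFinOrder_coe.mpr (Submonoid.isOfFinOrder_coe.mpr hz))
  · exact Subtype.ext (Subtype.ext this)
  · rintro _ ⟨a, ha, rfl⟩ _ ⟨b, hb, rfl⟩
    rw [← map_mul, ← map_mul, mem_center_iff.mp ha b]

/-- The point is uniformity: the index `n` depends on the ambient group only, so the vanishing
passes to directed unions of such subgroups. -/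
theorem HasRank.lowerCentralSeries_eq_bot {G : Type u} [Group G] {n : ℕ} (hG : HasRank G n)
    {N : Subgroup G} (hN : Group.IsNilpotent N) (ht : TorsionFree N) :
    N.lowerCentralSeries n = ⊥ := by
  obtain ⟨m, hm, hr⟩ := hG.exists_nat N
  exact lowerCentralSeries_eq_bot_of_nilpotencyClass_le ((hr.nilpotencyClass_le ht).trans hm)

theorem isNilpotent_fittingSubgroup {G : Type u} [Group G] {n : ℕ} (hG : HasRank G n)
    (hΛ : NoLocFinite G) : Group.IsNilpotent (fittingSubgroup G) := by
  refine isNilpotent_of_lowerCentralSeries_eq_bot (n := n) ((eq_bot_iff_forall _).mpr fun g hg => ?_)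
  obtain ⟨H, hH, hHS, hgH⟩ := exists_fg_mem_lowerCentralSeries hg
  obtain ⟨N, hN, hN', hHN⟩ := exists_nilpotent_of_fg_le_fittingSubgroup hH hHS
  have := hG.lowerCentralSeries_eq_bot hN' (hΛ.torsionFree_of_nilpotent hN hN')
  exact mem_bot.mp (this ▸ lowerCentralSeries_mono n hHN hgH)

/-- In a torsion-free group of finite rank, the Hirsch–Plotkin radical is nilpotent. -/
theorem hirschPlotkinRadical_eq_fittingSubgroup {G : Type u} [Group G] {n : ℕ} (hG : HasRank G n)
    (ht : TorsionFree G) : hirschPlotkinRadical G = fittingSubgroup G := by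
  refine le_antisymm (sSup_le fun N hN => le_fittingSubgroup hN.1 ?_)
    (sSup_le fun N hN => le_sSup ⟨hN.1, fun H _ => ?_⟩)
  -- All finitely generated subgroups of the locally nilpotent `N` are nilpotent of class at most
  -- `n`, and an element of a lower central term is already seen in one of them.
  · refine isNilpotent_of_lowerCentralSeries_eq_bot (n := n)
      ((eq_bot_iff_forall _).mpr fun g hg => ?_)
    obtain ⟨H, hH, hHS, hgH⟩ := exists_fg_mem_lowerCentralSeries hg
    have hfg : (H.subgroupOf N).FG := by
      have : Group.FG H := (Group.fg_iff_subgroup_fg H).mpr hH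
      exact (Group.fg_iff_subgroup_fg _).mp
        (Group.fg_of_surjective (f := (subgroupOfEquivOfLe hHS).symm.toMonoidHom)
          (subgroupOfEquivOfLe hHS).symm.surjective)
    have hnil : Group.IsNilpotent H :=
      (Group.isNilpotent_congr (subgroupOfEquivOfLe hHS)).mp (hN.2 _ hfg)
    exact mem_bot.mp (hG.lowerCentralSeries_eq_bot hnil (ht.subgroup H) ▸ hgH)
  · have := hN.2
    infer_instance

/-! ### Schur's theorem and the centralizer of the Fitting subgroup -/

/-- A commutator depends only on the cosets of its entries modulo the centre. -/
theorem finite_commutatorSet {G : Type v} [Group G] [(center G).FiniteIndex] :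
    Finite (commutatorSet G) := by
  refine Set.Finite.subset (Set.finite_range fun p : (G ⧸ center G) × (G ⧸ center G) =>
    ⁅p.1.out, p.2.out⁆) ?_
  rintro _ ⟨a, b, rfl⟩
  refine ⟨(a, b), ?_⟩
  obtain ⟨z, hz⟩ := QuotientGroup.mk_out_eq_mul (center G) a
  obtain ⟨w, hw⟩ := QuotientGroup.mk_out_eq_mul (center G) b
  have key : ∀ u v z : G, z ∈ center G → ⁅u * z, v⁆ = ⁅u, v⁆ := fun u v z hz => by
    rw [commutatorElement_def, mul_inv_rev, mul_assoc u z v, ← mem_center_iff.mp hz v,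
      commutatorElement_def]
    group
  simp only [hz, hw]
  rw [key _ _ _ z.2, ← commutatorElement_inv, key _ _ _ w.2, commutatorElement_inv]

/-- **Schur's theorem** for groups that are central by locally finite. -/
theorem locFinite_commutator {G : Type v} {Q : Type w} [Group G] [Group Q] (p : G →* Q)
    (hp : p.ker ≤ center G) (hQ : LocFinite Q) : LocFinite (commutator G) := by
  -- A finitely generated `H` has finite image in `Q`, so its centre has finite index and the
  -- classical theorem applies. A finitely generated subgroup of the derived group lies in the
  -- derived group of some such `H`.
  have key : ∀ H : Subgroup G, H.FG → Finite (H.lowerCentralSeries 1) := by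
    intro H hH
    have hr : Finite (p.domRestrict H).range := by
      rw [MonoidHom.domRestrict_range]
      exact hQ _ (fg_map p hH)
    have hfi : (p.domRestrict H).ker.FiniteIndex := inferInstance
    have hle : (p.domRestrict H).ker ≤ center H := fun x hx =>
      mem_center_iff.mpr fun y => Subtype.ext (mem_center_iff.mp (hp hx) y)
    have : (center H).FiniteIndex := finiteIndex_of_le hle
    have := finite_commutatorSet (G := H)
    have h1 : Finite (commutator H) := inferInstance
    have h2 : H.lowerCentralSeries 1 = (commutator H).map H.subtype := (map_subtype_commutator H).symm
    rw [h2]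
    exact Finite.of_equiv _ ((commutator H).equivMapOfInjective _ H.subtype_injective).toEquiv
  intro K hK
  let ι := {H : Subgroup G // H.FG}
  have : Nonempty ι := ⟨⊥, ⟨∅, by simp⟩⟩
  obtain ⟨i, hi⟩ := exists_le_of_fg_of_directed (S := fun H : ι => H.1.lowerCentralSeries 1)
    (fun H K => ⟨⟨H.1 ⊔ K.1, H.2.sup K.2⟩, lowerCentralSeries_mono 1 le_sup_left,
      lowerCentralSeries_mono 1 le_sup_right⟩) (fg_map (commutator G).subtype hK) (by
      rintro _ ⟨x, _, rfl⟩
      obtain ⟨H, hH, _, hx⟩ := exists_fg_mem_lowerCentralSeries (S := ⊤) (n := 1) x.2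
      exact ⟨⟨H, hH⟩, hx⟩)
  have := key i.1 i.2
  have hf : Finite (K.map (commutator G).subtype) := Finite.of_injective _ (inclusion_injective hi)
  exact Finite.of_equiv _ (K.equivMapOfInjective _ (subtype_injective _)).symm.toEquiv

/-- A nontrivial normal subgroup of a group of finite rank contains a nontrivial normal subgroup
which is locally finite or abelian. -/
theorem HasRank.exists_normal {G : Type u} [Group G] {n : ℕ} (hG : HasRank G n) {K : Subgroup G}
    (hK : K.Normal) (hK1 : K ≠ ⊥) : ∃ B : Subgroup G, B.Normal ∧ B ≤ K ∧ B ≠ ⊥ ∧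
      (LocFinite B ∨ ∀ a ∈ B, ∀ b ∈ B, a * b = b * a) := by
  obtain ⟨m, _, hm⟩ := hG.exists_nat K
  obtain ⟨C, hC, hC1, hC2⟩ := hm.exists_characteristic rfl ((nontrivial_iff_ne_bot K).mpr hK1)
  refine ⟨C.map K.subtype, ConjAct.normal_of_characteristic_of_normal, map_subtype_le C, ?_, ?_⟩
  · rwa [Ne, map_eq_bot_iff_of_injective _ K.subtype_injective]
  · refine hC2.imp (fun h => h.map _) ?_
    rintro h _ ⟨x, hx, rfl⟩ _ ⟨y, hy, rfl⟩
    rw [← map_mul, h x hx y hy, map_mul]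

/-- The Fitting subgroup contains its centralizer. -/
theorem centralizer_fittingSubgroup_le {G : Type u} [Group G] {n : ℕ} (hG : HasRank G n)
    (hΛ : NoLocFinite G) : centralizer (fittingSubgroup G : Set G) ≤ fittingSubgroup G := by
  set R := fittingSubgroup G
  set C := centralizer (R : Set G) with hC
  by_contra hCR
  let Z := C ⊓ R
  let q := QuotientGroup.mk' Z
  have hCn : C.Normal := inferInstance
  have hCq : C.map q ≠ ⊥ := by
    rw [Ne, Subgroup.map_eq_bot_iff, QuotientGroup.ker_mk']
    exact fun h => hCR (h.trans inf_le_right)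
  obtain ⟨a, b, _, hb, hab⟩ := hG.split_normal Z
  have hbt : b ≠ ⊤ := by
    rintro rfl
    simp at hab
  lift b to ℕ using hbt
  -- If `C` were not contained in `R`, then `C/Z` would be a nontrivial normal subgroup of `G/Z`.
  -- The preimage `B` of a locally finite or abelian normal subgroup inside it lies in `C` but not
  -- in `R`; it is nilpotent, which is the contradiction.
  obtain ⟨D, hD, hDC, hD1, hD2⟩ := hb.exists_normal (hCn.map q (QuotientGroup.mk'_surjective Z)) hCq
  set B := D.comap q with hB
  have hBn : B.Normal := hD.comap q
  have hBC : B ≤ C := by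
    refine (comap_mono hDC).trans ?_
    rw [comap_map_eq, QuotientGroup.ker_mk']
    exact sup_le le_rfl inf_le_left
  have hZB : ⁅Z, B⁆ = ⊥ := by
    rw [commutator_comm, commutator_eq_bot_iff_le_centralizer]
    exact hBC.trans (centralizer_le inf_le_right)
  have hBR : ¬ B ≤ R := by
    intro h
    apply hD1
    rw [← map_comap_eq_self_of_surjective (QuotientGroup.mk'_surjective Z) D, Subgroup.map_eq_bot_iff,
      QuotientGroup.ker_mk']
    exact le_inf hBC h
  apply hBR
  refine le_fittingSubgroup hBn ?_
  -- `Z` is central in `B`. If `B/Z` is locally finite, Schur's theorem makes `⁅B, B⁆` locally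
  -- finite and normal, hence trivial; if `B/Z` is abelian, `B` has class at most two.
  rcases hD2 with h | h
  · have h1 : LocFinite (commutator B) := by
      refine locFinite_commutator (q.subgroupComap D) ?_ h
      intro x hx
      have hxZ : (x : G) ∈ Z := (QuotientGroup.eq_one_iff _).mp (Subtype.ext_iff.mp hx :)
      refine mem_center_iff.mpr fun y => Subtype.ext ?_
      have := commutator_eq_bot_iff_le_centralizer.mp hZB hxZ
      exact mem_centralizer_iff.mp this y y.2
    have h2 : ⁅B, B⁆ = ⊥ := by
      refine hΛ _ inferInstance ?_
      rw [← map_subtype_commutator]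
      exact h1.map _
    exact isNilpotent_of_lowerCentralSeries_eq_bot (n := 1) h2
  · refine isNilpotent_of_lowerCentralSeries_eq_bot (n := 2) (le_bot_iff.mp ?_)
    rw [← hZB]
    refine commutator_mono ?_ le_rfl
    change ⁅B, B⁆ ≤ Z
    rw [commutator_le]
    intro x hx y hy
    rw [← QuotientGroup.eq_one_iff]
    have := h _ hx _ hy
    change q ⁅x, y⁆ = 1
    rw [map_commutatorElement, commutatorElement_eq_one_iff_mul_comm]
    exact this

/-! ### Embeddings of full rank -/

/-- The rank of `H` is that of `N ⊓ H` plus that of its image modulo `N`. Neither can exceed its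
counterpart for `G`, so neither can be smaller. -/
theorem HasRank.full_rank_inf {G : Type u} [Group G] {n r : ℕ} (hG : HasRank G n)
    {H : Subgroup G} (hH : HasRank H n) (N : Subgroup G) [N.Normal] (hN : HasRank N r) :
    HasRank (N ⊓ H : Subgroup G) r := by
  let q := QuotientGroup.mk' N
  obtain ⟨a, b, ha, hb, hab⟩ := hG.split_normal N
  obtain ⟨c, d, hc, hd, hcd⟩ := hH.split (q.subgroupMap H) (q.subgroupMap_surjective H)
  have hc' : HasRank (N ⊓ H : Subgroup G) c := hc.of_equiv
    { toFun := fun x => ⟨x.1.1, (QuotientGroup.eq_one_iff _).mp (Subtype.ext_iff.mp x.2 :), x.1.2⟩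
      invFun := fun x => ⟨⟨x.1, x.2.2⟩, Subtype.ext ((QuotientGroup.eq_one_iff _).mpr x.2.1)⟩
      left_inv := fun _ => rfl
      right_inv := fun _ => rfl
      map_mul' := fun _ _ => rfl }
  obtain rfl := ha.unique hN
  have hca : c ≤ r := hc'.mono inf_le_left hN
  have hdb : d ≤ b := hd.le_of_injective hb (Subgroup.subtype _) (subtype_injective _)
  have hbt : b ≠ ⊤ := by
    rintro rfl
    simp at hab
  lift b to ℕ using hbt
  lift c to ℕ using ne_top_of_le_ne_top (ENat.natCast_ne_top r) hca
  lift d to ℕ using ne_top_of_le_ne_top (ENat.natCast_ne_top b) hdb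
  norm_cast at hab hcd hca hdb
  obtain rfl : c = r := by omega
  exact hc'

/-- Two groups of the same finite rank, one embedded in the other. -/
structure FullRank {H G : Type u} [Group H] [Group G] (f : H →* G) (n : ℕ) : Prop where
  inj : Function.Injective f
  left : HasRank H n
  right : HasRank G n

theorem FullRank.exists_pow {H G : Type u} [Group H] [Group G] {f : H →* G} {n : ℕ}
    (hf : FullRank f n) {R : Subgroup G} [R.Normal] (hR : Group.IsNilpotent R) {x : G} (hx : x ∈ R) :
    ∃ k, 0 < k ∧ ∃ h, f h = x ^ k := by
  obtain ⟨r, _, hr⟩ := hf.right.exists_nat R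
  have h1 := hf.right.full_rank_inf (hf.left.of_equiv (MonoidHom.ofInjective hf.inj)) R hr
  obtain ⟨k, hk, hk'⟩ := hr.exists_pow_mem_of_nilpotent ((R ⊓ f.range).subgroupOf R)
    (h1.of_equiv (subgroupOfEquivOfLe inf_le_left).symm) ⟨x, hx⟩
  exact ⟨k, hk, (mem_subgroupOf.mp hk').2⟩

theorem TorsionFree.pow_left_injective_subgroup {G : Type v} [Group G] {R : Subgroup G}
    (hR : TorsionFree R) (hn : Group.IsNilpotent R) {a b : G} (ha : a ∈ R) (hb : b ∈ R) {k : ℕ}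
    (hk : 0 < k) (h : a ^ k = b ^ k) : a = b :=
  Subtype.ext_iff.mp (hR.pow_left_injective k hk ⟨a, ha⟩ ⟨b, hb⟩ (Subtype.ext h))

theorem TorsionFree.commute_of_pow {G : Type v} [Group G] {R : Subgroup G} [hRn : R.Normal]
    (hR : TorsionFree R) (hn : Group.IsNilpotent R) {x y : G} (hy : y ∈ R) {k : ℕ}
    (hk : 0 < k) (h : x * y ^ k = y ^ k * x) : x * y = y * x := by
  refine mul_inv_eq_iff_eq_mul.mp (hR.pow_left_injective_subgroup hn (hRn.conj_mem y hy x) hy hk ?_)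
  rw [conj_pow, h, mul_inv_cancel_right]

/-- Let `x` lie in a locally finite normal subgroup `X` of `H`. Each `y` in the Fitting subgroup of
`G` has a power `f h`; the image of the commutator of `x` and `h` is torsion and lies in the
torsion-free Fitting subgroup, so it vanishes. By uniqueness of roots `f x` centralizes the Fitting
subgroup, hence lies in it, hence is trivial. -/
theorem FullRank.noLocFinite {H G : Type u} [Group H] [Group G] {f : H →* G} {n : ℕ}
    (hf : FullRank f n) (hG : NoLocFinite G) : NoLocFinite H := by
  intro X hX hXf
  have hn := isNilpotent_fittingSubgroup hf.right hG
  have ht := hG.torsionFree_of_nilpotent inferInstance hn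
  refine (Subgroup.eq_bot_iff_forall _).mpr fun x hx => ?_
  have hxf : IsOfFinOrder x := Submonoid.isOfFinOrder_coe.mpr (hXf.isOfFinOrder ⟨x, hx⟩)
  have hcent : f x ∈ centralizer (fittingSubgroup G : Set G) := by
    refine mem_centralizer_iff.mpr fun y hy => ?_
    obtain ⟨k, hk, h, hh⟩ := hf.exists_pow hn hy
    have h1 : x * h * x⁻¹ * h⁻¹ ∈ X := by
      rw [mul_assoc, mul_assoc]
      exact mul_mem hx (by rw [← mul_assoc]; exact hX.conj_mem _ (inv_mem hx) h)
    have h2 : f (x * h * x⁻¹ * h⁻¹) ∈ fittingSubgroup G := by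
      rw [map_mul, map_mul, map_mul, map_inv, map_inv, hh]
      exact mul_mem ((fittingSubgroup_normal G).conj_mem _ (pow_mem hy k) _)
        (inv_mem (pow_mem hy k))
    have h3 : IsOfFinOrder (f (x * h * x⁻¹ * h⁻¹)) :=
      f.isOfFinOrder (Submonoid.isOfFinOrder_coe.mpr (hXf.isOfFinOrder ⟨_, h1⟩))
    have h4 : f (x * h * x⁻¹ * h⁻¹) = 1 :=
      Subtype.ext_iff.mp (ht ⟨_, h2⟩ (Submonoid.isOfFinOrder_coe.mp h3))
    refine (ht.commute_of_pow hn hy hk ?_).symm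
    rw [← hh, ← map_mul, ← map_mul, ← commutatorElement_eq_one_iff_mul_comm.mp (hf.inj (h4.trans f.map_one.symm))]
  have := centralizer_fittingSubgroup_le hf.right hG hcent
  exact hf.inj ((Subtype.ext_iff.mp (ht ⟨_, this⟩
    (Submonoid.isOfFinOrder_coe.mp (f.isOfFinOrder hxf)))).trans f.map_one.symm)

theorem HasRank.range_of_ker_locFinite {G Q : Type u} [Group G] [Group Q] {n : ℕ∞}
    (hG : HasRank G n) (f : G →* Q) (hf : LocFinite f.ker) : HasRank f.range n := by
  obtain ⟨a, b, ha, hb, rfl⟩ := hG.split f.rangeRestrict f.rangeRestrict_surjective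
  rw [MonoidHom.ker_rangeRestrict] at ha
  rwa [ha.eq_zero hf, zero_add]

theorem HasRank.quotient_of_locFinite {G : Type u} [Group G] {n : ℕ∞}
    (hG : HasRank G n) (N : Subgroup G) [N.Normal] (hf : LocFinite N) : HasRank (G ⧸ N) n := by
  obtain ⟨a, b, ha, hb, rfl⟩ := hG.split_normal N
  rwa [ha.eq_zero hf, zero_add]

/-- The image of `H` modulo the radical of `G` still has full rank, because only a locally finite
kernel is lost; there `FullRank.noLocFinite` applies. -/
theorem FullRank.map_locFiniteRadical_le {H G : Type u} [Group H] [Group G] {f : H →* G} {n : ℕ}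
    (hf : FullRank f n) : (locFiniteRadical H).map f ≤ locFiniteRadical G := by
  let g := (QuotientGroup.mk' (locFiniteRadical G)).comp f
  have hker : LocFinite g.ker := by
    refine (locFinite_locFiniteRadical G).of_injective
      ((f.comp (Subgroup.subtype _)).codRestrict _ fun x => ?_) fun x y h => ?_
    · exact (QuotientGroup.eq_one_iff _).mp x.2
    · exact Subtype.ext (hf.inj (Subtype.ext_iff.mp h :))
  have hfull : FullRank g.range.subtype n := ⟨subtype_injective _,
    hf.left.range_of_ker_locFinite g hker,
    hf.right.quotient_of_locFinite _ (locFinite_locFiniteRadical G)⟩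
  have h1 := hfull.noLocFinite (noLocFinite_quotient G) ((locFiniteRadical H).map g.rangeRestrict)
    (Normal.map inferInstance _ g.rangeRestrict_surjective) ((locFinite_locFiniteRadical H).map _)
  rw [Subgroup.map_eq_bot_iff, MonoidHom.ker_rangeRestrict] at h1
  rintro _ ⟨x, hx, rfl⟩
  exact (QuotientGroup.eq_one_iff _).mp (h1 hx)

/-- The center of the Fitting subgroup. -/
def fittingCenter (G : Type*) [Group G] : Subgroup G :=
  fittingSubgroup G ⊓ centralizer (fittingSubgroup G : Set G)

instance fittingCenter_normal (G : Type*) [Group G] : (fittingCenter G).Normal := by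
  unfold fittingCenter
  infer_instance

theorem fittingCenter_comm {G : Type*} [Group G] : ∀ a ∈ fittingCenter G, ∀ b ∈ fittingCenter G,
    a * b = b * a :=
  fun _ ha _ hb => mem_centralizer_iff.mp hb.2 _ ha.1

/-- The preimage of the Fitting subgroup of `G` is a nilpotent normal subgroup of `H`. So `f z`
commutes with a power of each element of the Fitting subgroup of `G`, and by uniqueness of roots
with the element itself. -/
theorem FullRank.map_fittingCenter_le {H G : Type u} [Group H] [Group G] {f : H →* G} {n : ℕ}
    (hf : FullRank f n) (hG : NoLocFinite G) : (fittingCenter H).map f ≤ fittingCenter G := by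
  rintro _ ⟨z, hz, rfl⟩
  have hn := isNilpotent_fittingSubgroup hf.right hG
  have ht := hG.torsionFree_of_nilpotent inferInstance hn
  have hle : (fittingSubgroup G).comap f ≤ fittingSubgroup H := by
    refine le_fittingSubgroup inferInstance ?_
    have := isNilpotent ((f.range ⊓ fittingSubgroup G).subgroupOf (fittingSubgroup G))
    have h2 : Group.IsNilpotent (f.range ⊓ fittingSubgroup G : Subgroup G) :=
      (Group.isNilpotent_congr (subgroupOfEquivOfLe inf_le_right)).mp this
    rw [← map_comap_eq] at h2
    exact (Group.isNilpotent_congr (((fittingSubgroup G).comap f).equivMapOfInjective f hf.inj)).mpr h2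
  have hcent : f z ∈ centralizer (fittingSubgroup G : Set G) := by
    refine mem_centralizer_iff.mpr fun y hy => ?_
    obtain ⟨k, hk, h, hh⟩ := hf.exists_pow hn hy
    refine (ht.commute_of_pow hn hy hk ?_).symm
    have : h ∈ fittingSubgroup H := hle (by
      rw [mem_comap, hh]
      exact pow_mem hy k)
    rw [← hh, ← map_mul, ← map_mul, mem_centralizer_iff.mp hz.2 h this]
  exact ⟨centralizer_fittingSubgroup_le hf.right hG hcent, hcent⟩

theorem fittingSubgroup_ne_bot {G : Type u} [Group G] [Nontrivial G] {n : ℕ} (hG : HasRank G n)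
    (hΛ : NoLocFinite G) : fittingSubgroup G ≠ ⊥ := by
  obtain ⟨C, hC, hC1, hC2⟩ := hG.exists_characteristic rfl inferInstance
  rcases hC2 with h | h
  · exact absurd (hΛ C inferInstance h) hC1
  · intro hbot
    refine hC1 (le_bot_iff.mp (hbot ▸ le_fittingSubgroup inferInstance ?_))
    refine isNilpotent_of_lowerCentralSeries_eq_bot (n := 1) ?_
    exact commutator_eq_bot_iff_le_centralizer.mpr fun x hx =>
      mem_centralizer_iff.mpr fun y hy => h y hy x hx

/-- This guarantees that factoring out these centres lowers the rank, which drives the induction for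
directed unions. -/
theorem not_locFinite_fittingCenter {G : Type u} [Group G] [Nontrivial G] {n : ℕ}
    (hG : HasRank G n) (hΛ : NoLocFinite G) : ¬ LocFinite (fittingCenter G) := by
  intro hf
  have hn := isNilpotent_fittingSubgroup hG hΛ
  have : Nontrivial (fittingSubgroup G) :=
    (nontrivial_iff_ne_bot _).mpr (fittingSubgroup_ne_bot hG hΛ)
  have h1 := Group.IsNilpotent.center_ne_bot (fittingSubgroup G)
  apply h1
  have h2 := hΛ _ inferInstance hf
  refine (Subgroup.eq_bot_iff_forall _).mpr fun x hx => Subtype.ext ?_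
  have : (x : G) ∈ fittingCenter G := ⟨x.2, mem_centralizer_iff.mpr fun y hy =>
    Subtype.ext_iff.mp (mem_center_iff.mp hx ⟨y, hy⟩)⟩
  rw [h2] at this
  exact this

/-! ### Directed unions have a rank; Hirsch length and rank agree -/

section Directed

variable {G : Type v} [Group G] {ι : Type w} {S : ι → Subgroup G}

theorem directed_map_subtype (hdir : Directed (· ≤ ·) S) (N : ∀ i, Subgroup (S i))
    (hmono : ∀ i j (h : S i ≤ S j), (N i).map (inclusion h) ≤ N j) :
    Directed (· ≤ ·) fun i => (N i).map (S i).subtype := by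
  have h : ∀ i j, S i ≤ S j → (N i).map (S i).subtype ≤ (N j).map (S j).subtype := by
    rintro i j hij _ ⟨x, hx, rfl⟩
    exact ⟨inclusion hij x, hmono i j hij ⟨x, hx, rfl⟩, rfl⟩
  intro i j
  obtain ⟨k, hik, hjk⟩ := hdir i j
  exact ⟨k, h i k hik, h j k hjk⟩

theorem normal_iSup_map_subtype [Nonempty ι] (hdir : Directed (· ≤ ·) S)
    (htop : ∀ g, ∃ i, g ∈ S i)
    (N : ∀ i, Subgroup (S i)) (hN : ∀ i, (N i).Normal)
    (hmono : ∀ i j (h : S i ≤ S j), (N i).map (inclusion h) ≤ N j) :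
    (⨆ i, (N i).map (S i).subtype).Normal := by
  refine ⟨fun x hx g => ?_⟩
  have hd := directed_map_subtype hdir N hmono
  obtain ⟨i, x, hxi, rfl⟩ := (mem_iSup_of_directed hd).mp hx
  obtain ⟨j, hj⟩ := htop g
  obtain ⟨k, hik, hjk⟩ := hdir i j
  refine (mem_iSup_of_directed hd).mpr ⟨k, ⟨g, hjk hj⟩ * inclusion hik x * ⟨g, hjk hj⟩⁻¹, ?_, rfl⟩
  exact (hN k).conj_mem _ (hmono i k hik ⟨x, hxi, rfl⟩) _

end Directed

theorem fullRank_inclusion {G : Type u} [Group G] {n : ℕ} {H K : Subgroup G} (h : H ≤ K)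
    (hH : HasRank H n) (hK : HasRank K n) : FullRank (inclusion h) n :=
  ⟨inclusion_injective h, hH, hK⟩

/-- A directed union of groups of bounded rank has a rank. -/
def DirectedUnionsHaveRank (n : ℕ) : Prop :=
  ∀ (G : Type u) [Group G] (ι : Type u) [Nonempty ι] (S : ι → Subgroup G),
    Directed (· ≤ ·) S → (∀ g, ∃ i, g ∈ S i) → (∀ i, ∃ m : ℕ, m ≤ n ∧ HasRank (S i) m) →
    ∃ m, HasRank G m

/-- All inclusions have full rank, so the centres of the Fitting subgroups increase and their union
`A` is abelian and normal. Each `S i` meets `A` in positive rank, so the images in `G ⧸ A` have rank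
at most `n` and the induction hypothesis applies. -/
theorem exists_hasRank_of_noLocFinite {n : ℕ} (ih : DirectedUnionsHaveRank.{u} n)
    {G : Type u} [Group G] {ι : Type u} [Nonempty ι] {S : ι → Subgroup G}
    (hdir : Directed (· ≤ ·) S) (htop : ∀ g, ∃ i, g ∈ S i) (hS : ∀ i, HasRank (S i) (n + 1 : ℕ))
    (hΛ : ∀ i, NoLocFinite (S i)) : ∃ m, HasRank G m := by
  have hmono : ∀ i j (h : S i ≤ S j), (fittingCenter (S i)).map (inclusion h) ≤ fittingCenter (S j) :=
    fun i j h => (fullRank_inclusion h (hS i) (hS j)).map_fittingCenter_le (hΛ j)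
  have hd := directed_map_subtype hdir _ hmono
  have hn := normal_iSup_map_subtype hdir htop _ (fun i => fittingCenter_normal (S i)) hmono
  set A := ⨆ i, (fittingCenter (S i)).map (S i).subtype with hA
  have hAc : ∀ a b : A, a * b = b * a := by
    rintro ⟨a, ha⟩ ⟨b, hb⟩
    obtain ⟨i, hai⟩ := (mem_iSup_of_directed hd).mp ha
    obtain ⟨j, hbj⟩ := (mem_iSup_of_directed hd).mp hb
    obtain ⟨k, hik, hjk⟩ := hd i j
    obtain ⟨a, ha', rfl⟩ := hik hai
    obtain ⟨b, hb', rfl⟩ := hjk hbj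
    exact Subtype.ext (congrArg (S k).subtype (fittingCenter_comm a ha' b hb') :)
  obtain ⟨r, hr⟩ := HasRank.of_comm A hAc
  let q := QuotientGroup.mk' A
  obtain ⟨m, hm⟩ := ih (G ⧸ A) ι (fun i => (S i).map q) (fun i j => by
      obtain ⟨k, hik, hjk⟩ := hdir i j
      exact ⟨k, map_mono hik, map_mono hjk⟩) (fun g => by
      obtain ⟨g, rfl⟩ := QuotientGroup.mk'_surjective A g
      obtain ⟨i, hi⟩ := htop g
      exact ⟨i, mem_map_of_mem q hi⟩) (fun i => by
      obtain ⟨a, b, ha, hb, hab⟩ := (hS i).split (q.subgroupMap (S i)) (q.subgroupMap_surjective _)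
      have : Nontrivial (S i) := by
        by_contra h
        rw [not_nontrivial_iff_subsingleton] at h
        have := (hS i).eq_zero .of_finite
        norm_cast at this
      have ha1 := ha.one_le fun hf => not_locFinite_fittingCenter (hS i) (hΛ i) (hf.mono fun x hx => by
        refine Subtype.ext ((QuotientGroup.eq_one_iff _).mpr ?_)
        exact (le_iSup (fun i => (fittingCenter (S i)).map (S i).subtype) i) ⟨x, hx, rfl⟩)
      obtain ⟨a, b, rfl, rfl, hab⟩ := ENat.exists_nat_of_add_eq hab
      norm_cast at ha1
      exact ⟨b, by omega, hb⟩)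
  exact ⟨r + m, .of_normal A hr hm⟩

/-- Induction on the bound. Once one member attains it, all members above that one do, and
inclusions among them have full rank. Their locally finite radicals then increase to a locally
finite normal subgroup, and modulo this union `exists_hasRank_of_noLocFinite` applies. -/
theorem directedUnionsHaveRank (n : ℕ) : DirectedUnionsHaveRank.{u} n := by
  induction n with
  | zero =>
    intro G _ ι _ S hdir htop hS
    refine ⟨0, .locFinite G (.of_directed hdir htop fun i => ?_)⟩
    obtain ⟨m, hm, hmS⟩ := hS i
    exact hmS.locFinite_of_zero (by norm_cast; omega)
  | succ n ih =>
    intro G _ ι _ S hdir htop hS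
    by_cases hall : ∀ i, ∃ m : ℕ, m ≤ n ∧ HasRank (S i) m
    · exact ih G ι S hdir htop hall
    push Not at hall
    obtain ⟨i₀, hi₀⟩ := hall
    have hi₀' : HasRank (S i₀) (n + 1 : ℕ) := by
      obtain ⟨m, hm, hmS⟩ := hS i₀
      rcases hm.lt_or_eq with h | rfl
      · exact absurd hmS (hi₀ m (by omega))
      · exact hmS
    let J := {i // S i₀ ≤ S i}
    have : Nonempty J := ⟨⟨i₀, le_rfl⟩⟩
    let T : J → Subgroup G := fun j => S j.1
    have hTdir : Directed (· ≤ ·) T := fun i j => by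
      obtain ⟨k, hik, hjk⟩ := hdir i.1 j.1
      exact ⟨⟨k, i.2.trans hik⟩, hik, hjk⟩
    have hTtop : ∀ g, ∃ j, g ∈ T j := fun g => by
      obtain ⟨i, hi⟩ := htop g
      obtain ⟨k, hik, hjk⟩ := hdir i₀ i
      exact ⟨⟨k, hik⟩, hjk hi⟩
    have hT : ∀ j, HasRank (T j) (n + 1 : ℕ) := fun j => by
      obtain ⟨m, hm, hmS⟩ := hS j.1
      have := hi₀'.mono j.2 hmS
      norm_cast at this
      obtain rfl : m = n + 1 := by omega
      exact hmS
    have hmono : ∀ i j (h : T i ≤ T j),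
        (locFiniteRadical (T i)).map (inclusion h) ≤ locFiniteRadical (T j) :=
      fun i j h => (fullRank_inclusion h (hT i) (hT j)).map_locFiniteRadical_le
    have hd := directed_map_subtype hTdir _ hmono
    have hn := normal_iSup_map_subtype hTdir hTtop _ (fun i => inferInstance) hmono
    set Λ := ⨆ j, (locFiniteRadical (T j)).map (T j).subtype with hΛ
    have hΛf : LocFinite Λ := by
      refine .of_directed (S := fun j => ((locFiniteRadical (T j)).map (T j).subtype).subgroupOf Λ)
        (fun i j => ?_) (fun g => ?_) fun j => ?_
      · obtain ⟨k, hik, hjk⟩ := hd i j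
        exact ⟨k, comap_mono hik, comap_mono hjk⟩
      · obtain ⟨i, hi⟩ := (mem_iSup_of_directed hd).mp g.2
        exact ⟨i, mem_subgroupOf.mpr hi⟩
      · exact ((locFinite_locFiniteRadical (T j)).map (T j).subtype).of_injective
          (subgroupOfEquivOfLe (le_iSup (fun j => (locFiniteRadical (T j)).map (T j).subtype) j)).toMonoidHom
          (MulEquiv.injective _)
    let q := QuotientGroup.mk' Λ
    have hker : ∀ j, (q.comp (T j).subtype).ker = locFiniteRadical (T j) := by
      intro j
      refine le_antisymm (le_locFiniteRadical inferInstance ?_) fun x hx => ?_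
      · refine hΛf.of_injective (((T j).subtype.comp (Subgroup.subtype _)).codRestrict _ fun x => ?_)
          fun x y h => ?_
        · exact (QuotientGroup.eq_one_iff _).mp x.2
        · exact Subtype.ext (Subtype.ext (Subtype.ext_iff.mp h :))
      · exact (QuotientGroup.eq_one_iff _).mpr
          ((le_iSup (fun j => (locFiniteRadical (T j)).map (T j).subtype) j) ⟨x, hx, rfl⟩)
    have hran : ∀ j, (q.comp (T j).subtype).range = (T j).map q := fun j => by
      rw [MonoidHom.range_comp, range_subtype]
    obtain ⟨m, hm⟩ := exists_hasRank_of_noLocFinite ih (G := G ⧸ Λ) (S := fun j => (T j).map q)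
      (fun i j => by
        obtain ⟨k, hik, hjk⟩ := hTdir i j
        exact ⟨k, map_mono hik, map_mono hjk⟩) (fun g => by
        obtain ⟨g, rfl⟩ := QuotientGroup.mk'_surjective Λ g
        obtain ⟨i, hi⟩ := hTtop g
        exact ⟨i, mem_map_of_mem q hi⟩) (fun j => by
        rw [← hran]
        exact (hT j).range_of_ker_locFinite _ (hker j ▸ locFinite_locFiniteRadical _)) (fun j => by
        rw [← hran]
        have e : (T j ⧸ locFiniteRadical (T j)) ≃* (q.comp (T j).subtype).range :=
          (QuotientGroup.quotientMulEquivOfEq (hker j).symm).trans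
            (QuotientGroup.quotientKerEquivRange _)
        intro N hN hNf
        have := noLocFinite_quotient (T j) (N.comap e.toMonoidHom) (hN.comap _)
          (hNf.of_injective (e.toMonoidHom.subgroupComap N) fun x y h =>
            Subtype.ext (e.injective (Subtype.ext_iff.mp h)))
        rw [← map_comap_eq_self_of_surjective (f := e.toMonoidHom) e.surjective N]
        rw [this, Subgroup.map_bot])
    exact ⟨0 + m, .of_normal Λ (.locFinite _ hΛf) hm⟩

theorem HasRank.of_infinite_cyclic {G : Type u} [Group G] (e : G ≃* Multiplicative ℤ) :
    HasRank G 1 := by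
  let _ : CommGroup G := { ‹Group G› with
    mul_comm := fun a b => e.injective (by rw [map_mul, map_mul, mul_comm]) }
  have h : commRank G = 1 := by
    have h1 := LinearEquiv.lift_rank_eq (R := ℤ) (M := Additive G) (M' := ℤ)
      (MulEquiv.toAdditive e).toIntLinearEquiv
    rw [Module.rank_self, Cardinal.lift_one, Cardinal.lift_eq_one] at h1
    rw [commRank, h1, map_one]
  exact h ▸ HasRank.comm G

/-- A group of finite Hirsch length has a rank, which is its Hirsch length. -/
theorem HasHirschLength.hasRank {G : Type u} [Group G] {k : ℕ∞} (h : HasHirschLength G k) {n : ℕ} :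
    k = n → HasRank G n := by
  induction h generalizing n with
  | of_finite G hG =>
    intro hn
    exact hn ▸ .locFinite G .of_finite
  | of_infinite_cyclic G e =>
    intro hn
    exact hn ▸ .of_infinite_cyclic e
  | of_mulEquiv G H e m hG ih => exact fun hn => (ih hn).of_equiv e
  | of_extension G N a b hN hQ ihN ihQ =>
    intro hn
    obtain ⟨a, b, rfl, rfl, -⟩ := ENat.exists_nat_of_add_eq hn
    exact hn ▸ .of_normal N (ihN rfl) (ihQ rfl)
  | of_directed G ι S hdir htop m hS ih =>
    intro hn
    have hle : ∀ i, m i ≤ n := fun i => hn ▸ le_iSup m i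
    have hr : ∀ i, HasRank (S i) (m i) := fun i => by
      obtain ⟨l, hl⟩ := ENat.ne_top_iff_exists.mp (ne_top_of_le_ne_top (ENat.natCast_ne_top n) (hle i))
      exact hl ▸ ih i hl.symm
    -- The members have ranks bounded by `n`, so the union has some rank `r`; `r` is then squeezed
    -- between the supremum and the monotonicity bound.
    obtain ⟨r, hG⟩ := directedUnionsHaveRank n G ι S hdir htop fun i => by
      obtain ⟨l, hl⟩ := ENat.ne_top_iff_exists.mp (ne_top_of_le_ne_top (ENat.natCast_ne_top n) (hle i))
      exact ⟨l, by exact_mod_cast hl ▸ hle i, hl ▸ hr i⟩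
    have : r = n := by
      rw [← hn]
      exact le_antisymm (hG.le_iSup_of_directed hdir htop hr)
        (iSup_le fun i => (hr i).le_of_injective hG (S i).subtype (subtype_injective _))
    exact this ▸ hG

/-! ### The rational representation on an abelian normal subgroup -/

open scoped nonZeroDivisors

/-- The rational representation given by the conjugation action on an abelian normal subgroup `A`:
`ι` is the embedding of `A` in `A ⊗ ℚ`. -/
structure RatRep {G : Type*} [Group G] (A : Subgroup G) (V : Type*) [AddCommGroup V] [Module ℚ V] where
  ρ : G →* Module.End ℚ V
  ι : G → V
  ι_mul : ∀ a ∈ A, ∀ b ∈ A, ι (a * b) = ι a + ι b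
  ι_inj : ∀ a ∈ A, ι a = 0 → a = 1
  ι_conj : ∀ g, ∀ a ∈ A, ι (g * a * g⁻¹) = ρ g (ι a)
  dense : ∀ v, ∃ k : ℕ, 0 < k ∧ ∃ a ∈ A, ι a = k • v

namespace RatRep

variable {G : Type v} [Group G] {A : Subgroup G} {V : Type w} [AddCommGroup V] [Module ℚ V]
  (S : RatRep A V)

theorem ι_one : S.ι 1 = 0 := by
  have := S.ι_mul 1 A.one_mem 1 A.one_mem
  simpa using this

theorem ι_inv {a : G} (ha : a ∈ A) : S.ι a⁻¹ = -S.ι a := by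
  have := S.ι_mul a ha a⁻¹ (A.inv_mem ha)
  rw [mul_inv_cancel, S.ι_one] at this
  exact (neg_eq_of_add_eq_zero_right this.symm).symm

theorem ι_pow {a : G} (ha : a ∈ A) (n : ℕ) : S.ι (a ^ n) = n • S.ι a := by
  induction n with
  | zero => simp [S.ι_one]
  | succ n ih => rw [pow_succ, S.ι_mul _ (A.pow_mem ha n) _ ha, ih, succ_nsmul]

theorem ι_zpow {a : G} (ha : a ∈ A) (n : ℤ) : S.ι (a ^ n) = n • S.ι a := by
  cases n with
  | ofNat n => simpa using S.ι_pow ha n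
  | negSucc n => rw [zpow_negSucc, S.ι_inv (A.pow_mem ha _), S.ι_pow ha, negSucc_zsmul]

theorem ι_injOn {a b : G} (ha : a ∈ A) (hb : b ∈ A) (h : S.ι a = S.ι b) : a = b := by
  refine mul_inv_eq_one.mp (S.ι_inj _ (A.mul_mem ha (A.inv_mem hb)) ?_)
  rw [S.ι_mul _ ha _ (A.inv_mem hb), S.ι_inv hb, h, add_neg_cancel]

/-- Every vector has a positive multiple in the image of `A`, so the action on `A` determines the
action on `V`. -/
theorem ρ_eq_one_iff [A.Normal] {g : G} : S.ρ g = 1 ↔ g ∈ centralizer (A : Set G) := by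
  constructor
  · intro h
    refine mem_centralizer_iff.mpr fun a ha => ?_
    have h1 := S.ι_conj g a ha
    rw [h, Module.End.one_apply] at h1
    have := S.ι_injOn (Normal.conj_mem inferInstance a ha g) ha h1
    exact (mul_inv_eq_iff_eq_mul.mp this).symm
  · intro h
    ext v
    obtain ⟨k, hk, a, ha, hav⟩ := S.dense v
    have h1 := S.ι_conj g a ha
    rw [← mem_centralizer_iff.mp h a ha, mul_inv_cancel_right, hav, map_nsmul] at h1
    have hk' : (k : ℚ) ≠ 0 := by positivity
    rw [← Nat.cast_smul_eq_nsmul ℚ, ← Nat.cast_smul_eq_nsmul ℚ] at h1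
    exact (smul_right_injective V hk' h1).symm

theorem ρ_mul_inv (g : G) : S.ρ g * S.ρ g⁻¹ = 1 := by
  rw [← map_mul, mul_inv_cancel, map_one]

theorem ρ_inv_mul (g : G) : S.ρ g⁻¹ * S.ρ g = 1 := by
  rw [← map_mul, inv_mul_cancel, map_one]

end RatRep

theorem exists_ratRep {G : Type u} [Group G] (A : Subgroup G) [A.Normal]
    (hc : ∀ a ∈ A, ∀ b ∈ A, a * b = b * a) (ht : TorsionFree A) {n : ℕ} (hn : HasRank A n) :
    ∃ (V : Type u) (_ : AddCommGroup V) (_ : Module ℚ V) (_ : FiniteDimensional ℚ V),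
      Module.finrank ℚ V = n ∧ Nonempty (RatRep A V) := by
  classical
  have hcA : ∀ a b : A, a * b = b * a := fun a b => Subtype.ext (hc a a.2 b b.2)
  let _ : CommGroup A := { (inferInstance : Group A) with mul_comm := hcA }
  let conj : G →* Module.End ℤ (Additive A) :=
    { toFun := fun g => (MulAut.conjNormal g : MulAut A).toMonoidHom.toAdditive.toIntLinearMap
      map_one' := LinearMap.ext fun x => congrArg (fun f : MulAut A => f x.toMul) (map_one MulAut.conjNormal)
      map_mul' := fun g h => LinearMap.ext fun x =>
        congrArg (fun f : MulAut A => f x.toMul) (map_mul MulAut.conjNormal g h) }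
  have hr : Module.rank ℤ (Additive A) = n := by
    have := hn.eq_commRank hcA
    exact Cardinal.toENat_eq_natCast.mp this.symm
  let W := TensorProduct ℤ ℚ (Additive A)
  let i : Additive A →ₗ[ℤ] W := TensorProduct.mk ℤ ℚ (Additive A) 1
  have hi : IsLocalizedModule ℤ⁰ i := IsLocalization.tensorProduct_isLocalizedModule ℤ⁰ ℚ
  have hrW : Module.rank ℚ W = n := by
    rw [IsLocalization.rank_eq ℚ ℤ⁰ le_rfl, IsLocalizedModule.rank_eq ℤ⁰ le_rfl i, hr]
  have hi0 : ∀ x, i x = 0 → x = 0 := by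
    intro x hx
    obtain ⟨s, hs⟩ := (IsLocalizedModule.eq_zero_iff ℤ⁰ i).mp hx
    have h1 : (x.toMul) ^ (s : ℤ) = 1 := hs
    exact ht x.toMul (isOfFinOrder_iff_zpow_eq_one.mpr ⟨s, nonZeroDivisors.ne_zero s.2, h1⟩)
  refine ⟨W, inferInstance, inferInstance, ?_, ?_, ⟨?_⟩⟩
  · exact Module.rank_lt_aleph0_iff.mp (hrW ▸ Cardinal.natCast_lt_aleph0)
  · exact Module.finrank_eq_of_rank_eq hrW
  refine
    { ρ := (Module.End.baseChangeHom ℤ ℚ (Additive A)).toMonoidHom.comp conj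
      -- The value 0 off `A` is a default; the fields constrain `ι` on `A` only.
      ι := fun g => if h : g ∈ A then i (Additive.ofMul ⟨g, h⟩) else 0
      ι_mul := fun a ha b hb => ?_
      ι_inj := fun a ha h => ?_
      ι_conj := fun g a ha => ?_
      dense := fun v => ?_ }
  · simp only [ha, hb, A.mul_mem ha hb, dif_pos, ← map_add]
    rfl
  · simp only [ha, dif_pos] at h
    exact Subtype.ext_iff.mp (hi0 _ h :)
  · have := Normal.conj_mem (inferInstance : A.Normal) a ha g
    simp only [ha, this, dif_pos]
    rfl
  · obtain ⟨⟨m, s⟩, hms⟩ := IsLocalizedModule.surj ℤ⁰ i v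
    have hs0 : (s : ℤ) ≠ 0 := nonZeroDivisors.ne_zero s.2
    have h1 : (s : ℤ) • v = i m := hms
    refine ⟨(s : ℤ).natAbs, Int.natAbs_pos.mpr hs0, ?_⟩
    rcases Int.natAbs_eq (s : ℤ) with h | h
    · refine ⟨(m.toMul : A), m.toMul.2, ?_⟩
      simp only [SetLike.coe_mem, dif_pos]
      rw [← natCast_zsmul, ← h, h1]
      rfl
    · refine ⟨((-m).toMul : A), (-m).toMul.2, ?_⟩
      simp only [SetLike.coe_mem, dif_pos]
      rw [← natCast_zsmul, ← neg_neg (((s : ℤ).natAbs : ℤ)), ← h, neg_smul, h1, ← map_neg]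
      rfl

theorem eq_det_smul_one {V : Type v} [AddCommGroup V] [Module ℚ V] (h : Module.finrank ℚ V = 1)
    (f : Module.End ℚ V) : f = LinearMap.det f • (1 : Module.End ℚ V) := by
  have := Module.finite_of_finrank_eq_succ h
  have : Nontrivial V := Module.nontrivial_of_finrank_pos (R := ℚ) (by omega)
  obtain ⟨v, hv⟩ := exists_ne (0 : V)
  have hspan := (finrank_eq_one_iff_of_nonzero' v hv).mp h
  obtain ⟨c, hc⟩ := hspan (f v)
  have hf : f = c • (1 : Module.End ℚ V) := by
    ext w
    obtain ⟨d, rfl⟩ := hspan w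
    rw [map_smul, ← hc, LinearMap.smul_apply, Module.End.one_apply, smul_comm]
  have hd : LinearMap.det f = c := by
    rw [hf, LinearMap.det_smul, map_one, h]
    simp
  rw [hd]
  exact hf

/-! ### Torsion-free nilpotent groups of small rank -/

/-- A torsion-free nilpotent group of rank one: any two nontrivial elements are commensurable. -/
theorem HasRank.exists_pow_eq_zpow {G : Type u} [Group G] [Group.IsNilpotent G] (hG : HasRank G 1)
    (ht : TorsionFree G) {y : G} (hy : y ≠ 1) (x : G) : ∃ k : ℕ, 0 < k ∧ ∃ j : ℤ, y ^ j = x ^ k := by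
  obtain ⟨m, hm, hr⟩ := HasRank.exists_nat (n := 1) hG (zpowers y)
  have : Nontrivial (zpowers y) := ⟨⟨y, mem_zpowers y⟩, 1, fun h => hy (Subtype.ext_iff.mp h)⟩
  have h1 := hr.one_le (ht.subgroup _).not_locFinite
  norm_cast at h1
  obtain rfl : m = 1 := by omega
  obtain ⟨k, hk, j, hj⟩ := HasRank.exists_pow_mem_of_nilpotent (n := 1) hG (zpowers y) hr x
  exact ⟨k, hk, j, hj⟩

/-- A torsion-free nilpotent group whose central quotient has rank one is abelian. -/
theorem HasRank.comm_of_quotient_center {G : Type u} [Group G] [Group.IsNilpotent G]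
    (hG : HasRank (G ⧸ center G) 1) (ht : TorsionFree G) (x y : G) : x * y = y * x := by
  by_cases hy : y ∈ center G
  · exact mem_center_iff.mp hy x
  obtain ⟨k, hk, j, hj⟩ := hG.exists_pow_eq_zpow ht.quotient_center (y := (y : G ⧸ center G))
    (fun h => hy ((QuotientGroup.eq_one_iff _).mp h)) (x : G ⧸ center G)
  have hz : (y ^ j)⁻¹ * x ^ k ∈ center G := QuotientGroup.eq.mp (by exact_mod_cast hj)
  -- Modulo the centre `x ^ k` is a power of `y`, so `y` commutes with `x ^ k`; uniqueness of roots
  -- removes the exponent.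
  have h1 : y * x ^ k = x ^ k * y := by
    have h2 := mem_center_iff.mp hz y
    rw [← mul_assoc, ← zpow_neg, ← zpow_one_add, add_comm, zpow_add, mul_assoc, mul_assoc,
      mul_right_inj, zpow_one] at h2
    exact h2
  refine (mul_inv_eq_iff_eq_mul.mp (ht.pow_left_injective k hk (y * x * y⁻¹) x ?_)).symm
  rw [conj_pow, h1, mul_inv_cancel_right]

/-- In a nonabelian torsion-free nilpotent group the center has positive rank and the central
quotient has rank at least two. -/
theorem HasRank.split_center {G : Type u} [Group G] [Group.IsNilpotent G] {n : ℕ}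
    (hG : HasRank G n) (ht : TorsionFree G) {x y : G} (hxy : x * y ≠ y * x) :
    ∃ a b : ℕ, 1 ≤ a ∧ 2 ≤ b ∧ a + b = n ∧ HasRank (center G) a ∧ HasRank (G ⧸ center G) b := by
  obtain ⟨a, b, ha, hb, hab⟩ := hG.split_normal (center G)
  obtain ⟨a, b, rfl, rfl, hab⟩ := ENat.exists_nat_of_add_eq hab
  have hy : y ∉ center G := fun hy => hxy (mem_center_iff.mp hy x)
  have hne : Nontrivial G := ⟨y, 1, fun h => hy (h ▸ one_mem _)⟩
  have : Nontrivial (center G) := (nontrivial_iff_ne_bot _).mpr (Group.IsNilpotent.center_ne_bot G)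
  have ha1 := ha.one_le (ht.subgroup _).not_locFinite
  have : Nontrivial (G ⧸ center G) := ⟨y, 1, fun h => hy ((QuotientGroup.eq_one_iff _).mp h)⟩
  have hb1 := hb.one_le ht.quotient_center.not_locFinite
  norm_cast at ha1 hb1
  refine ⟨a, b, ha1, ?_, by exact_mod_cast hab, ha, hb⟩
  by_contra h2
  obtain rfl : b = 1 := by omega
  exact hxy (hb.comm_of_quotient_center ht x y)

/-- A torsion-free nilpotent group of rank at most two is abelian. -/
theorem HasRank.comm_of_le_two {G : Type u} [Group G] [Group.IsNilpotent G] {n : ℕ}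
    (hG : HasRank G n) (hn : n ≤ 2) (ht : TorsionFree G) (x y : G) : x * y = y * x := by
  by_contra hxy
  obtain ⟨a, b, ha, hb, hab, -, -⟩ := hG.split_center ht hxy
  omega

/-! ### Residually integral abelian groups and the radical of rank one -/

theorem eq_one_of_isOfFinOrder_multiplicative_int {x : Multiplicative ℤ} (hx : IsOfFinOrder x) :
    x = 1 := by
  obtain ⟨k, hk, hk'⟩ := isOfFinOrder_iff_pow_eq_one.mp hx
  have h2 : k • x.toAdd = 0 := hk'
  rw [smul_eq_zero] at h2
  exact h2.resolve_left hk.ne'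

/-- An abelian group of finite rank whose elements are separated by homomorphisms to `ℤ` is finitely
generated. -/
theorem finite_of_residually_int (n : ℕ) : ∀ {G : Type u} [CommGroup G] {m : ℕ} (_ : m ≤ n)
    (_ : HasRank G m) (_ : ∀ g : G, g ≠ 1 → ∃ φ : G →* Multiplicative ℤ, φ g ≠ 1),
    Module.Finite ℤ (Additive G) := by
  induction n with
  | zero =>
    intro G _ m hm hG h
    have hf := hG.locFinite_of_zero (by norm_cast; omega)
    have : Subsingleton (Additive G) := subsingleton_of_forall_eq (1 : G) fun g => by
      by_contra hg
      obtain ⟨φ, hφ⟩ := h g hg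
      exact hφ (eq_one_of_isOfFinOrder_multiplicative_int (φ.isOfFinOrder (hf.isOfFinOrder g)))
    exact Module.Finite.of_finite
  | succ n ih =>
    intro G _ m hm hG h
    by_cases hs : ∀ g : G, g = 1
    · have : Subsingleton (Additive G) := subsingleton_of_forall_eq (1 : G) hs
      exact Module.Finite.of_finite
    push Not at hs
    obtain ⟨g, hg⟩ := hs
    obtain ⟨φ, hφ⟩ := h g hg
    obtain ⟨a, b, ha, hb, hab⟩ := hG.split_normal φ.ker
    obtain ⟨a, b, rfl, rfl, hab⟩ := ENat.exists_nat_of_add_eq hab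
    -- The quotient by `φ.ker` embeds in `ℤ` and is nontrivial, so it uses up rank and the kernel
    -- has smaller rank.
    have hb1 := hb.one_le fun hf => hφ (eq_one_of_isOfFinOrder_multiplicative_int
      ((QuotientGroup.kerLift φ).isOfFinOrder (hf.isOfFinOrder (g : G ⧸ φ.ker))))
    norm_cast at hb1
    have hK : Module.Finite ℤ (Additive φ.ker) := by
      refine ih (m := a) (by omega) ha fun x hx => ?_
      obtain ⟨ψ, hψ⟩ := h x fun h => hx (Subtype.ext h)
      exact ⟨ψ.comp φ.ker.subtype, hψ⟩
    let f : Additive G →ₗ[ℤ] ℤ := φ.toAdditive.toIntLinearMap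
    let e : Additive φ.ker →ₗ[ℤ] Additive G := φ.ker.subtype.toAdditive.toIntLinearMap
    refine ⟨Submodule.fg_of_fg_map_of_fg_inf_ker f (IsNoetherian.noetherian _) ?_⟩
    have : LinearMap.range e = ⊤ ⊓ LinearMap.ker f := by
      rw [top_inf_eq]
      ext x
      constructor
      · rintro ⟨y, rfl⟩
        exact y.toMul.2
      · intro hx
        exact ⟨Additive.ofMul ⟨x.toMul, hx⟩, rfl⟩
    rw [← this]
    exact Module.Finite.iff_fg.mp (Module.Finite.range e)

theorem nonempty_mulEquiv_of_residually_int {G : Type u} [CommGroup G] {m : ℕ} (hG : HasRank G m)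
    (h : ∀ g : G, g ≠ 1 → ∃ φ : G →* Multiplicative ℤ, φ g ≠ 1) {L : Type} [AddCommGroup L]
    [Module.Finite ℤ L] [Module.Free ℤ L] (hL : Module.finrank ℤ L = m) :
    Nonempty (G ≃* Multiplicative L) := by
  have := finite_of_residually_int m le_rfl hG h
  have ht : Module.IsTorsionFree ℤ (Additive G) := by
    refine Module.isTorsionFree_int_iff_isAddTorsionFree.mpr ?_
    have : IsMulTorsionFree G := ⟨fun k hk a b hab => by
      by_contra hne
      obtain ⟨φ, hφ⟩ := h (a * b⁻¹) fun h => hne (mul_inv_eq_one.mp h)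
      refine hφ (eq_one_of_isOfFinOrder_multiplicative_int (φ.isOfFinOrder
        (isOfFinOrder_iff_pow_eq_one.mpr ⟨k, Nat.pos_of_ne_zero hk, ?_⟩)))
      have hab' : a ^ k = b ^ k := hab
      rw [mul_pow, inv_pow, hab', mul_inv_cancel]⟩
    infer_instance
  have hfree : Module.Free ℤ (Additive G) := Module.free_of_finite_type_torsion_free'
  have hr : Module.finrank ℤ (Additive G) = Module.finrank ℤ L := by
    rw [hL]
    exact Module.finrank_eq_of_rank_eq
      (Cardinal.toENat_eq_natCast.mp ((HasRank.comm G).unique hG))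
  exact ⟨MulEquiv.toAdditive.symm (LinearEquiv.ofFinrankEq _ _ hr).toAddEquiv⟩

/-- The `p`-adic valuation as a homomorphism. -/
def padicValUnits (p : ℕ) [Fact p.Prime] : ℚˣ →* Multiplicative ℤ where
  toFun q := Multiplicative.ofAdd (padicValRat p q)
  map_one' := by simp
  map_mul' q r := by
    rw [Units.val_mul, padicValRat.mul q.ne_zero r.ne_zero]
    rfl

theorem eq_one_or_neg_one_of_padicValRat {q : ℚ} (hq : q ≠ 0)
    (h : ∀ p : ℕ, p.Prime → padicValRat p q = 0) : q = 1 ∨ q = -1 := by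
  have hnum : q.num.natAbs = 1 := by
    by_contra hne
    obtain ⟨p, hp, hpd⟩ := Nat.exists_prime_and_dvd hne
    have : Fact p.Prime := ⟨hp⟩
    have hden : ¬ p ∣ q.den := fun hd => by
      have := Nat.dvd_gcd hpd hd
      rw [q.reduced] at this
      exact hp.one_lt.ne' (Nat.dvd_one.mp this)
    have h1 := h p hp
    rw [padicValRat_def, padicValNat.eq_zero_of_not_dvd hden] at h1
    have h2 : padicValInt p q.num = 0 := by simpa using h1
    have h3 : 1 ≤ padicValNat p q.num.natAbs :=
      one_le_padicValNat_of_dvd (Int.natAbs_ne_zero.mpr (Rat.num_ne_zero.mpr hq)) hpd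
    rw [padicValInt] at h2
    omega
  have hden : q.den = 1 := by
    by_contra hne
    obtain ⟨p, hp, hpd⟩ := Nat.exists_prime_and_dvd hne
    have : Fact p.Prime := ⟨hp⟩
    have h1 := h p hp
    have h3 : 1 ≤ padicValNat p q.den := one_le_padicValNat_of_dvd q.den_ne_zero hpd
    rw [padicValRat_def, padicValInt, hnum] at h1
    rw [padicValNat_one_right, Nat.cast_zero, zero_sub, neg_eq_zero, Nat.cast_eq_zero] at h1
    omega
  rw [← Rat.num_div_den q, hden]
  rcases Int.natAbs_eq q.num with h | h <;> rw [h, hnum] <;> norm_num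

section RankOne

variable {G : Type u} [Group G] {A : Subgroup G} [A.Normal] {V : Type v} [AddCommGroup V]
  [Module ℚ V]

/-- If `g` acts as `-1`, then `g ^ 2` acts trivially and lies in `A`. As a power of `g` it is fixed
by `g`, which also negates it, so `g ^ 2 = 1` and `g = 1`, whose determinant is 1. -/
theorem RatRep.det_ne_neg_one (S : RatRep A V) (hV : Module.finrank ℚ V = 1) (ht : TorsionFree G)
    (hA : centralizer (A : Set G) ≤ A) (g : G) : LinearMap.det (S.ρ g) ≠ -1 := by
  intro h
  have hg : S.ρ g = -1 := by rw [eq_det_smul_one hV (S.ρ g), h, neg_smul, one_smul]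
  have h2 : g ^ 2 ∈ A := hA (S.ρ_eq_one_iff.mp (by rw [map_pow, hg]; simp))
  have h3 := S.ι_conj g _ h2
  rw [show g * g ^ 2 * g⁻¹ = g ^ 2 by group, hg] at h3
  have h4 : S.ι (g ^ 2) = 0 := by
    have : S.ι (g ^ 2) = - S.ι (g ^ 2) := h3
    have h5 : (2 : ℚ) • S.ι (g ^ 2) = 0 := by
      rw [two_smul]
      exact eq_neg_iff_add_eq_zero.mp this
    exact (smul_eq_zero.mp h5).resolve_left two_ne_zero
  have h5 := ht.eq_one_of_pow two_pos (S.ι_inj _ h2 h4)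
  rw [h5, map_one, map_one] at h
  norm_num at h

/-- If `A` is self-centralizing of rank one then `G/A` is free abelian. -/
theorem nonempty_quotient_mulEquiv_of_rank_one (ht : TorsionFree G)
    (hA : centralizer (A : Set G) ≤ A) (hc : ∀ a ∈ A, ∀ b ∈ A, a * b = b * a) (h1 : HasRank A 1)
    {m : ℕ} (hm : HasRank (G ⧸ A) m) {L : Type} [AddCommGroup L] [Module.Finite ℤ L]
    [Module.Free ℤ L] (hL : Module.finrank ℤ L = m) :
    Nonempty (G ⧸ A ≃* Multiplicative L) := by
  obtain ⟨V, _, _, _, hV, ⟨S⟩⟩ := exists_ratRep A hc (ht.subgroup A) (n := 1) h1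
  let χ : G →* ℚˣ := (LinearMap.det.comp S.ρ).toHomUnits
  have hχ : ∀ g, (χ g : ℚ) = LinearMap.det (S.ρ g) := fun g => rfl
  have hker : χ.ker = A := by
    ext g
    rw [MonoidHom.mem_ker]
    constructor
    · intro h
      refine hA (S.ρ_eq_one_iff.mp ?_)
      rw [eq_det_smul_one hV (S.ρ g), ← hχ, h, Units.val_one, one_smul]
    · intro h
      have : g ∈ centralizer (A : Set G) := mem_centralizer_iff.mpr fun a ha => hc a ha g h
      rw [← S.ρ_eq_one_iff] at this
      ext
      rw [hχ, this, map_one, Units.val_one]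
  have e : G ⧸ A ≃* χ.range :=
    (QuotientGroup.quotientMulEquivOfEq hker.symm).trans (QuotientGroup.quotientKerEquivRange χ)
  let _ : CommGroup (G ⧸ A) := { (inferInstance : Group (G ⧸ A)) with
    mul_comm := fun a b => e.injective (by rw [map_mul, map_mul, mul_comm]) }
  refine nonempty_mulEquiv_of_residually_int hm (fun g hg => ?_) hL
  -- The valuations are homomorphisms to `ℤ`; a rational number killed by all of them is `1` or
  -- `-1`, and `-1` does not occur.
  by_contra hall
  push Not at hall
  apply hg
  obtain ⟨x, rfl⟩ := QuotientGroup.mk_surjective g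
  have hval : ∀ p : ℕ, p.Prime → padicValRat p (χ x : ℚ) = 0 := by
    intro p hp
    have : Fact p.Prime := ⟨hp⟩
    have := hall ((padicValUnits p).comp (QuotientGroup.lift A χ hker.ge))
    exact this
  rcases eq_one_or_neg_one_of_padicValRat (χ x).ne_zero hval with h | h
  · refine (QuotientGroup.eq_one_iff _).mpr ?_
    rw [← hker, MonoidHom.mem_ker]
    exact Units.ext h
  · exact absurd h (S.det_ne_neg_one hV ht hA x)

end RankOne

/-! ### Traces and elements of finite order in dimension two -/

/-- Modulo `n` the recursion is multiplication by `m`. The statement starts at index 1, since `S 0`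
is unconstrained and may share a factor with `n`. -/
theorem IsCoprime.sequence {m n : ℤ} (hmn : IsCoprime m n) {S : ℕ → ℤ} (h1 : S 1 = m)
    (hS : ∀ k, S (k + 2) = m * S (k + 1) - n ^ 2 * S k) (k : ℕ) : IsCoprime (S (k + 1)) n := by
  induction k with
  | zero => rwa [zero_add, h1]
  | succ k ih =>
    rw [hS, sub_eq_add_neg, show m * S (k + 1) + -(n ^ 2 * S k) = m * S (k + 1) + n * (-(n * S k)) by ring]
    exact (hmn.mul_left ih).add_mul_left_left _

/-- The traces of the powers of a matrix of determinant `1` and trace `t` grow (in height) at least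
linearly, unless `t` is an integer with `|t| ≤ 2`. -/
theorem le_den_add_natAbs_num {s : ℕ → ℚ} {t : ℚ} (h0 : s 0 = 2) (h1 : s 1 = t)
    (hs : ∀ k, s (k + 2) = t * s (k + 1) - s k) (ht : ∀ m : ℤ, |m| ≤ 2 → t ≠ m) (k : ℕ) :
    k ≤ (s k).den + (s k).num.natAbs := by
  by_cases hd : t.den = 1
  · have htm : t = t.num := by conv_lhs => rw [← Rat.num_div_den t, hd, Nat.cast_one, div_one]
    have h3 : 3 ≤ |t| := by
      by_contra h
      refine ht t.num ?_ htm
      rw [htm] at h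
      have : |t.num| < 3 := by exact_mod_cast not_le.mp h
      omega
    -- An integral trace of absolute value at least 3 makes the traces themselves grow; a
    -- nonintegral trace, treated below, makes their denominators grow.
    have hmono : ∀ k, |s k| + 1 ≤ |s (k + 1)| := by
      intro k
      induction k with
      | zero => rw [h0, zero_add, h1, abs_two]; linarith
      | succ k ih =>
        rw [hs]
        have h4 : |t * s (k + 1)| - |s k| ≤ |t * s (k + 1) - s k| := abs_sub_abs_le_abs_sub _ _
        rw [abs_mul] at h4
        nlinarith [abs_nonneg (s (k + 1)), abs_nonneg (s k)]
    have hge : (k : ℚ) ≤ |s k| := by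
      induction k with
      | zero => simp
      | succ k ih => push_cast; linarith [hmono k]
    have hle : |s k| ≤ ((s k).num.natAbs : ℚ) := by
      conv_lhs => rw [← Rat.num_div_den (s k)]
      rw [abs_div, Nat.cast_natAbs, Int.cast_abs, Nat.abs_cast]
      exact div_le_self (abs_nonneg _) (by exact_mod_cast (s k).den_pos)
    have : k ≤ (s k).num.natAbs := by exact_mod_cast hge.trans hle
    omega
  · obtain _ | k := k
    · simp
    -- The recursion with denominators cleared, `S k = t.den ^ k * s k`. As `S k` is prime to
    -- `t.den` for `k ≥ 1`, the denominator of `s k` is exactly `t.den ^ k`.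
    let S : ℕ → ℤ := fun k => (Nat.rec ((2 : ℤ), t.num)
      (fun _ x => (x.2, t.num * x.2 - (t.den : ℤ) ^ 2 * x.1)) k : ℤ × ℤ).1
    have hS1 : S 1 = t.num := rfl
    have hS : ∀ k, S (k + 2) = t.num * S (k + 1) - (t.den : ℤ) ^ 2 * S k := fun k => rfl
    have hd0 : (t.den : ℚ) ≠ 0 := by exact_mod_cast t.den_ne_zero
    have hval : ∀ k, s k = S k / (t.den : ℚ) ^ k ∧ s (k + 1) = S (k + 1) / (t.den : ℚ) ^ (k + 1) := by
      intro k
      induction k with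
      | zero =>
        refine ⟨by rw [h0]; simp [S], ?_⟩
        rw [zero_add, h1, hS1, pow_one, Rat.num_div_den]
      | succ k ih =>
        refine ⟨ih.2, ?_⟩
        rw [hs, ih.1, ih.2, hS]
        push_cast
        rw [← Rat.mul_den_eq_num t]
        field_simp
        ring
    have hcop := IsCoprime.sequence
      (Int.isCoprime_iff_nat_coprime.mpr (by simpa using t.reduced)) hS1 hS k
    have hden : ((s (k + 1)).den : ℤ) = (t.den : ℤ) ^ (k + 1) := by
      have hpos : (0 : ℤ) < (t.den : ℤ) ^ (k + 1) := by
        have := t.den_pos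
        positivity
      have := Rat.den_div_eq_of_coprime hpos (Int.isCoprime_iff_nat_coprime.mp hcop.pow_right)
      rw [(hval k).2, ← this]
      push_cast
      rfl
    have h2 : 2 ≤ t.den := by have := t.den_pos; omega
    have : (s (k + 1)).den = t.den ^ (k + 1) := by exact_mod_cast hden
    have := (Nat.lt_two_pow_self (n := k + 1)).le.trans (Nat.pow_le_pow_left h2 (k + 1))
    omega

theorem eq_one_or_neg_one_of_pow {q : ℚ} {k : ℕ} (hk : 0 < k) (h : q ^ k = 1) : q = 1 ∨ q = -1 := by
  have h1 : |q| ^ k = 1 := by rw [← abs_pow, h, abs_one]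
  have h2 := (pow_eq_one_iff_of_nonneg (abs_nonneg q) hk.ne').mp h1
  exact abs_eq zero_le_one |>.mp h2

section Unipotent

variable {V : Type v} [AddCommGroup V] [Module ℚ V]

/-- Finite order makes `f` semisimple, because `X ^ k - 1` is separable over `ℚ`; then `f - 1` is
both semisimple and nilpotent. -/
theorem eq_one_of_unipotent [FiniteDimensional ℚ V] {f : Module.End ℚ V} {k : ℕ} (hk : 0 < k)
    (hf : f ^ k = 1) (hn : IsNilpotent (f - 1)) : f = 1 := by
  have hk' : ((k : ℕ) : ℚ) ≠ 0 := by positivity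
  have hs : f.IsSemisimple := Module.End.isSemisimple_of_squarefree_aeval_eq_zero
    (p := Polynomial.X ^ k - Polynomial.C (1 : ℚ))
    (Polynomial.separable_X_pow_sub_C 1 hk' one_ne_zero).squarefree (by simp [hf])
  have hs1 : (f - 1).IsSemisimple :=
    Module.End.IsSemisimple.sub_of_commute (Commute.one_right f) hs
      (Module.End.isSemisimple_id)
  exact sub_eq_zero.mp (Module.End.eq_zero_of_isNilpotent_isSemisimple hn hs1)

end Unipotent

section Dimension2

variable {V : Type v} [AddCommGroup V] [Module ℚ V]

theorem sq_eq_of_finrank_two (hV : Module.finrank ℚ V = 2) (f : Module.End ℚ V) :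
    f ^ 2 = LinearMap.trace ℚ V f • f - LinearMap.det f • (1 : Module.End ℚ V) := by
  have := Module.finite_of_finrank_eq_succ hV
  let b := Module.finBasisOfFinrankEq ℚ V hV
  apply (LinearMap.toMatrixAlgEquiv b).injective
  rw [map_pow, map_sub, map_smul, map_smul, map_one, LinearMap.trace_eq_matrix_trace ℚ b,
    ← LinearMap.det_toMatrix b]
  change (LinearMap.toMatrix b b f) ^ 2 = _ • (LinearMap.toMatrix b b f) - _
  generalize LinearMap.toMatrix b b f = M
  ext i j
  fin_cases i <;> fin_cases j <;>
    simp [pow_two, Matrix.mul_apply, Matrix.trace, Matrix.det_fin_two, Fin.sum_univ_two] <;> ring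

theorem trace_pow_add_two (hV : Module.finrank ℚ V = 2) {f : Module.End ℚ V}
    (hf : LinearMap.det f = 1) (k : ℕ) :
    LinearMap.trace ℚ V (f ^ (k + 2)) =
      LinearMap.trace ℚ V f * LinearMap.trace ℚ V (f ^ (k + 1)) - LinearMap.trace ℚ V (f ^ k) := by
  rw [pow_add, sq_eq_of_finrank_two hV, hf, mul_sub, mul_smul_comm, ← pow_succ, one_smul, mul_one,
    map_sub, map_smul, smul_eq_mul]

/-- Used in two ways: an `f` of finite order must have a small integral trace, and an element `f ^
k` of a group without small traces admits only boundedly many exponents `k`. -/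
theorem le_den_trace_pow (hV : Module.finrank ℚ V = 2) {f : Module.End ℚ V}
    (hf : LinearMap.det f = 1) (ht : ∀ m : ℤ, |m| ≤ 2 → LinearMap.trace ℚ V f ≠ m) (k : ℕ) :
    k ≤ (LinearMap.trace ℚ V (f ^ k)).den + (LinearMap.trace ℚ V (f ^ k)).num.natAbs := by
  have := Module.finite_of_finrank_eq_succ hV
  exact le_den_add_natAbs_num (s := fun k => LinearMap.trace ℚ V (f ^ k))
    (by rw [pow_zero, LinearMap.trace_one, hV]; rfl) (by rw [pow_one]) (trace_pow_add_two hV hf) ht k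

theorem sq_sub_one_of_trace_eq_two (hV : Module.finrank ℚ V = 2) {f : Module.End ℚ V}
    (hd : LinearMap.det f = 1) (ht : LinearMap.trace ℚ V f = 2) : (f - 1) ^ 2 = 0 := by
  have h := sq_eq_of_finrank_two hV f
  rw [hd, ht, one_smul, two_smul, pow_two] at h
  rw [pow_two, sub_mul, mul_sub, h, mul_one, one_mul]
  abel

theorem eq_one_of_trace_eq_two (hV : Module.finrank ℚ V = 2) {f : Module.End ℚ V} {k : ℕ}
    (hk : 0 < k) (hf : f ^ k = 1) (hd : LinearMap.det f = 1) (ht : LinearMap.trace ℚ V f = 2) :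
    f = 1 := by
  have := Module.finite_of_finrank_eq_succ hV
  exact eq_one_of_unipotent hk hf ⟨2, sq_sub_one_of_trace_eq_two hV hd ht⟩

theorem eq_neg_one_of_trace_eq_neg_two (hV : Module.finrank ℚ V = 2) {f : Module.End ℚ V} {k : ℕ}
    (hk : 0 < k) (hf : f ^ k = 1) (hd : LinearMap.det f = 1) (ht : LinearMap.trace ℚ V f = -2) :
    f = -1 := by
  rw [← neg_eq_iff_eq_neg]
  refine eq_one_of_trace_eq_two hV (k := 2 * k) (by omega) ?_ ?_ ?_
  · rw [pow_mul, neg_sq, ← pow_mul, mul_comm, pow_mul, hf, one_pow]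
  · rw [← neg_one_smul ℚ, LinearMap.det_smul, hV, hd]; norm_num
  · rw [map_neg, ht, neg_neg]

theorem exists_trace_eq_of_pow_eq_one (hV : Module.finrank ℚ V = 2) {f : Module.End ℚ V} {k : ℕ}
    (hk : 0 < k) (hf : f ^ k = 1) (hd : LinearMap.det f = 1) :
    ∃ m : ℤ, |m| ≤ 2 ∧ LinearMap.trace ℚ V f = m := by
  by_contra! h
  -- `f ^ (k * 4)` is the identity, of trace 2, for which denominator plus numerator is 3; the
  -- factor 4 pushes the exponent beyond 3.
  have h1 := le_den_trace_pow hV hd h (k * 4)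
  have := Module.finite_of_finrank_eq_succ hV
  rw [pow_mul, hf, one_pow, LinearMap.trace_one, hV] at h1
  have h2 : ((2 : ℕ) : ℚ).den = 1 := Rat.den_natCast 2
  have h3 : ((2 : ℕ) : ℚ).num = 2 := Rat.num_natCast 2
  rw [h2, h3] at h1
  have : (2 : ℤ).natAbs = 2 := rfl
  omega

theorem det_of_pow_eq_one {f : Module.End ℚ V} {k : ℕ} (hk : 0 < k) (hf : f ^ k = 1) :
    LinearMap.det f = 1 ∨ LinearMap.det f = -1 :=
  eq_one_or_neg_one_of_pow hk (by rw [← map_pow, hf, map_one])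

/-- By Cayley–Hamilton `f ^ 2` has trace `t ^ 2 + 2`, where `t` is the trace of `f`; its determinant
is 1 and its order finite, so this is at most 2. -/
theorem trace_eq_zero_of_det_eq_neg_one (hV : Module.finrank ℚ V = 2) {f : Module.End ℚ V} {k : ℕ}
    (hk : 0 < k) (hf : f ^ k = 1) (hd : LinearMap.det f = -1) : LinearMap.trace ℚ V f = 0 := by
  have := Module.finite_of_finrank_eq_succ hV
  obtain ⟨m, hm, h⟩ := exists_trace_eq_of_pow_eq_one hV (f := f ^ 2) hk
    (by rw [← pow_mul, mul_comm, pow_mul, hf, one_pow]) (by rw [map_pow, hd]; norm_num)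
  rw [sq_eq_of_finrank_two hV, hd, map_sub, map_smul, map_smul, LinearMap.trace_one, hV, smul_eq_mul,
    smul_eq_mul] at h
  have hm' : (m : ℚ) ≤ 2 := by exact_mod_cast (abs_le.mp hm).2
  push_cast at h
  nlinarith

theorem sq_eq_one_of_det_eq_neg_one (hV : Module.finrank ℚ V = 2) {f : Module.End ℚ V} {k : ℕ}
    (hk : 0 < k) (hf : f ^ k = 1) (hd : LinearMap.det f = -1) : f ^ 2 = 1 := by
  rw [sq_eq_of_finrank_two hV, trace_eq_zero_of_det_eq_neg_one hV hk hf hd, hd]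
  simp

/-- Commuting nilpotent endomorphisms of a plane have product zero. -/
theorem mul_eq_zero_of_isNilpotent (hV : Module.finrank ℚ V = 2) {M N : Module.End ℚ V}
    (hM : IsNilpotent M) (hN : IsNilpotent N) (h : Commute M N) : M * N = 0 := by
  have := Module.finite_of_finrank_eq_succ hV
  have : Nontrivial V := Module.nontrivial_of_finrank_pos (R := ℚ) (by omega)
  have tr0 : ∀ {f : Module.End ℚ V}, IsNilpotent f → LinearMap.trace ℚ V f = 0 := fun hf =>
    (LinearMap.isNilpotent_trace_of_isNilpotent hf).eq_zero
  -- Trace-zero endomorphisms of a plane have scalar squares. Applied to `M`, `N` and `M + N` this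
  -- makes `M * N` scalar; it is also nilpotent.
  have h1 := sq_eq_of_finrank_two hV (M + N)
  rw [h.add_sq, sq_eq_of_finrank_two hV M, sq_eq_of_finrank_two hV N, map_add, tr0 hM, tr0 hN] at h1
  simp only [zero_smul, add_zero, zero_sub] at h1
  have h2 : M * N = ((LinearMap.det M + LinearMap.det N - LinearMap.det (M + N)) / 2) •
      (1 : Module.End ℚ V) := by
    have h3 : (2 : ℚ) • (M * N) = (LinearMap.det M + LinearMap.det N - LinearMap.det (M + N)) •
        (1 : Module.End ℚ V) := by
      rw [two_smul, ← two_mul, ← mul_assoc, sub_smul, add_smul]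
      rw [← sub_eq_zero] at h1 ⊢
      rw [← h1]
      abel
    rw [div_eq_inv_mul, mul_smul, ← h3, smul_smul]
    norm_num
  obtain ⟨n, hn⟩ := h.isNilpotent_mul_right hM
  rw [h2, smul_pow, one_pow, smul_eq_zero] at hn
  rw [h2, eq_zero_of_pow_eq_zero (hn.resolve_right one_ne_zero), zero_smul]

/-- For `f` of determinant one with trace strictly between `-2` and `2`, minus the determinant is a
positive definite form on the matrices `f * g - g * f`; so a nonnegative determinant forces the
commutator to vanish. -/
theorem matrix_commute_of_trace_commutator_le {f g : Matrix (Fin 2) (Fin 2) ℚ} (hf : f.det = 1)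
    (hft : f.trace ^ 2 < 4) (hdet : 0 ≤ (f * g - g * f).det) : f * g = g * f := by
  rw [Matrix.det_fin_two] at hf hdet
  simp only [Matrix.trace, Fin.sum_univ_two, Matrix.diag_apply] at hft
  simp only [Matrix.sub_apply, Matrix.mul_apply, Fin.sum_univ_two] at hdet
  obtain ⟨p, hp⟩ : ∃ x, x = f 0 0 := ⟨_, rfl⟩
  obtain ⟨q, hq⟩ : ∃ x, x = f 0 1 := ⟨_, rfl⟩
  obtain ⟨r, hr⟩ : ∃ x, x = f 1 0 := ⟨_, rfl⟩
  obtain ⟨s, hs⟩ : ∃ x, x = f 1 1 := ⟨_, rfl⟩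
  obtain ⟨a, ha⟩ : ∃ x, x = g 0 0 := ⟨_, rfl⟩
  obtain ⟨b, hb⟩ : ∃ x, x = g 0 1 := ⟨_, rfl⟩
  obtain ⟨c, hc⟩ : ∃ x, x = g 1 0 := ⟨_, rfl⟩
  obtain ⟨d, hd⟩ : ∃ x, x = g 1 1 := ⟨_, rfl⟩
  rw [← hp, ← hq, ← hr, ← hs] at hf hdet
  rw [← ha, ← hb, ← hc, ← hd] at hdet
  rw [← hp, ← hs] at hft
  have hκ : 0 < -(q * r) - (p - s) ^ 2 / 4 := by nlinarith
  have hq0 : q ≠ 0 := by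
    rintro rfl
    nlinarith [sq_nonneg (p - s)]
  obtain ⟨α, hα⟩ : ∃ x, x = b * (p - s) - q * (a - d) := ⟨_, rfl⟩
  obtain ⟨β, hβ⟩ : ∃ x, x = q * c - b * r := ⟨_, rfl⟩
  -- `α` and `β` are entries of `f * g - g * f`. The left side is minus `q ^ 2` times its
  -- determinant with the square completed; the coefficient of `α ^ 2` is `1 - (p + s) ^ 2 / 4`,
  -- which is positive.
  have key : (q * β - (p - s) * α / 2) ^ 2 + (-(q * r) - (p - s) ^ 2 / 4) * α ^ 2 ≤ 0 := by
    have h1 : (q * β - (p - s) * α / 2) ^ 2 + (-(q * r) - (p - s) ^ 2 / 4) * α ^ 2 = -(q ^ 2 *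
        ((p * a + q * c - (a * p + b * r)) * (r * b + s * d - (c * q + d * s)) -
        (p * b + q * d - (a * q + b * s)) * (r * a + s * c - (c * p + d * r)))) := by
      rw [hα, hβ]; ring
    rw [h1]
    exact neg_nonpos.mpr (mul_nonneg (sq_nonneg q) hdet)
  have hα0 : α = 0 := by
    by_contra hne
    have : 0 < α ^ 2 := by positivity
    nlinarith [sq_nonneg (q * β - (p - s) * α / 2), mul_pos hκ this]
  have hβ0 : β = 0 := by
    rw [hα0] at key
    have : (q * β) ^ 2 ≤ 0 := by nlinarith
    have := pow_eq_zero_iff two_ne_zero |>.mp (le_antisymm this (sq_nonneg _))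
    exact (mul_eq_zero.mp this).resolve_left hq0
  rw [hα0] at hα
  rw [hβ0] at hβ
  have hγ : r * (a - d) - c * (p - s) = 0 := by
    have : q * (r * (a - d) - c * (p - s)) = 0 := by linear_combination r * hα + (p - s) * hβ
    exact (mul_eq_zero.mp this).resolve_left hq0
  ext i j
  fin_cases i <;> fin_cases j <;>
    simp only [Matrix.mul_apply, Fin.sum_univ_two, Fin.zero_eta, Fin.mk_one, Fin.isValue,
      ← hp, ← hq, ← hr, ← hs, ← ha, ← hb, ← hc, ← hd]
  · linear_combination -hβ
  · linear_combination -hα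
  · linear_combination hγ
  · linear_combination hβ

/-- With inverses written as adjugates this is a polynomial identity modulo the determinant
equations. It reflects `det (c - 1) = 2 - trace c` for the group commutator `c`, which has
determinant one. -/
theorem matrix_det_commutator {f g f' g' : Matrix (Fin 2) (Fin 2) ℚ} (hf : f.det = 1)
    (hg : g.det = 1) (hf' : f * f' = 1) (hg' : g * g' = 1) :
    (f * g - g * f).det = 2 - (f * g * f' * g').trace := by
  have hadj : ∀ {h h' : Matrix (Fin 2) (Fin 2) ℚ}, h.det = 1 → h * h' = 1 → h' = h.adjugate := by
    intro h h' hd hm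
    have := congrArg (h.adjugate * ·) hm
    simp only [← mul_assoc, Matrix.adjugate_mul, hd, one_smul, one_mul, mul_one] at this
    exact this
  rw [hadj hf hf', hadj hg hg', Matrix.adjugate_fin_two, Matrix.adjugate_fin_two]
  rw [Matrix.det_fin_two] at hf hg
  simp only [Matrix.det_fin_two, Matrix.trace, Fin.sum_univ_two, Matrix.diag_apply, Matrix.sub_apply,
    Matrix.mul_apply, Matrix.of_apply, Matrix.cons_val', Matrix.cons_val_zero, Matrix.cons_val_one,
    Matrix.cons_val_fin_one]
  linear_combination (2 : ℚ) * hf * (g 0 0 * g 1 1 - g 0 1 * g 1 0) + 2 * hg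

/-- In `SL₂(ℚ)`, elements of finite order whose commutator has finite order commute. -/
theorem commute_of_finite_order (hV : Module.finrank ℚ V = 2) {f g f' g' : Module.End ℚ V}
    (hf : LinearMap.det f = 1) (hg : LinearMap.det g = 1) (hf' : f * f' = 1) (hg' : g * g' = 1)
    {k l : ℕ} (hk : 0 < k) (hfk : f ^ k = 1) (hl : 0 < l) (hfl : (f * g * f' * g') ^ l = 1) :
    f * g = g * f := by
  have := Module.finite_of_finrank_eq_succ hV
  obtain ⟨m, hm, h⟩ := exists_trace_eq_of_pow_eq_one hV hk hfk hf
  -- Trace `2` or `-2` forces `f = 1` or `f = -1`. Otherwise the trace of `f` is small, and the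
  -- trace of the commutator is at most 2, so the determinant of `f * g - g * f` is nonnegative.
  by_cases h2 : m = 2
  · rw [eq_one_of_trace_eq_two hV hk hfk hf (by rw [h, h2]; norm_num), one_mul, mul_one]
  by_cases h2' : m = -2
  · rw [eq_neg_one_of_trace_eq_neg_two hV hk hfk hf (by rw [h, h2']; norm_num)]
    simp
  have hdf' : LinearMap.det f' = 1 := by
    have := congrArg LinearMap.det hf'
    rwa [map_mul, hf, one_mul, map_one] at this
  have hdg' : LinearMap.det g' = 1 := by
    have := congrArg LinearMap.det hg'
    rwa [map_mul, hg, one_mul, map_one] at this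
  obtain ⟨n, hn, h'⟩ := exists_trace_eq_of_pow_eq_one hV hl hfl
    (by simp only [map_mul, hf, hg, hdf', hdg', mul_one])
  let b := Module.finBasisOfFinrankEq ℚ V hV
  let φ := LinearMap.toMatrixAlgEquiv b
  have hdet : ∀ x, (φ x).det = LinearMap.det x := fun x => LinearMap.det_toMatrix b x
  have htr : ∀ x, (φ x).trace = LinearMap.trace ℚ V x := fun x =>
    (LinearMap.trace_eq_matrix_trace ℚ b x).symm
  apply φ.injective
  rw [map_mul, map_mul]
  refine matrix_commute_of_trace_commutator_le (by rw [hdet, hf]) ?_ ?_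
  · rw [htr, h]
    obtain ⟨hm1, hm2⟩ := abs_le.mp hm
    have h3 : -1 ≤ m := by omega
    have h4 : m ≤ 1 := by omega
    have : m ^ 2 < 4 := by nlinarith
    exact_mod_cast this
  · rw [matrix_det_commutator (f' := φ f') (g' := φ g') (by rw [hdet, hf]) (by rw [hdet, hg])
      (by rw [← map_mul, hf', map_one]) (by rw [← map_mul, hg', map_one]), ← map_mul, ← map_mul,
      ← map_mul, htr, h']
    have : (n : ℚ) ≤ 2 := by exact_mod_cast (abs_le.mp hn).2
    linarith

end Dimension2

/-! ### Groups of rank one and their planar representations -/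

/-- A torsion-free elementary amenable group of rank one is abelian. -/
theorem TorsionFree.comm_of_hasRank_one {F : Type u} [Group F] (ht : TorsionFree F)
    (h1 : HasRank F 1) (x y : F) : x * y = y * x := by
  by_cases hs : Subsingleton F
  · exact Subsingleton.elim _ _
  rw [not_subsingleton_iff_nontrivial] at hs
  obtain ⟨C, hC, hC1, hC2⟩ := h1.exists_characteristic (n := 1) rfl hs
  have : Nontrivial C := (nontrivial_iff_ne_bot _).mpr hC1
  have hCnot : ¬ LocFinite C := (ht.subgroup C).not_locFinite
  have hcomm := hC2.resolve_left hCnot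
  obtain ⟨m, hm, hr⟩ := HasRank.exists_nat (n := 1) h1 C
  have hm1 := hr.one_le hCnot
  norm_cast at hm1
  obtain rfl : m = 1 := by omega
  have htC : ∀ b ∈ C, IsOfFinOrder b → b = 1 := fun b _ => ht b
  -- For `g ≠ 1` some nontrivial power `g ^ k` lies in `C`. In the rank one group `C` a power of `c`
  -- is a power of `g ^ k`, hence fixed by `g`, and roots in `C` are unique.
  have hcen : C ≤ center F := by
    intro c hc
    refine mem_center_iff.mpr fun g => ?_
    obtain ⟨k, hk, hgk⟩ := HasRank.exists_pow_mem (n := 1) h1 (K := C) hr g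
    by_cases hg1 : g ^ k = 1
    · rw [ht.eq_one_of_pow hk hg1, one_mul, mul_one]
    let _ : CommGroup C := { (inferInstance : Group C) with
      mul_comm := fun a b => Subtype.ext (hcomm a a.2 b b.2) }
    have hnil : Group.IsNilpotent C := CommGroup.isNilpotent
    obtain ⟨n, hn, j, hj⟩ := hr.exists_pow_eq_zpow (ht.subgroup C) (y := ⟨g ^ k, hgk⟩)
      (fun h => hg1 (Subtype.ext_iff.mp h)) ⟨c, hc⟩
    have hj' : (g ^ k) ^ j = c ^ n := Subtype.ext_iff.mp hj
    have h2 : (g * c * g⁻¹) ^ n = c ^ n := by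
      rw [conj_pow, ← hj']
      exact mul_inv_eq_iff_eq_mul.mpr (((Commute.refl g).pow_right k).zpow_right j)
    exact mul_inv_eq_iff_eq_mul.mp
      (pow_left_injective_of_comm hcomm htC (Normal.conj_mem inferInstance c hc g) hc hn h2)
  have hQ : LocFinite (F ⧸ C) := by
    obtain ⟨a, b, ha, hb, hab⟩ := h1.split_normal C
    rw [ha.unique hr] at hab
    refine hb.locFinite_of_zero ?_
    obtain ⟨a', b', h1, rfl, hab⟩ := ENat.exists_nat_of_add_eq (n := 1) hab
    have h1' : a' = 1 := by exact_mod_cast h1.symm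
    norm_cast
    omega
  -- `F` is central by locally finite, so Schur's theorem leaves a locally finite derived group,
  -- trivial in a torsion-free group.
  have hLF := locFinite_commutator (QuotientGroup.mk' C) (by rwa [QuotientGroup.ker_mk']) hQ
  have := ht ⁅x, y⁆ ((Submonoid.isOfFinOrder_coe (H := (_root_.commutator F).toSubmonoid)).mpr
    (hLF.isOfFinOrder ⟨⁅x, y⁆, commutator_mem_commutator (mem_top x) (mem_top y)⟩))
  exact commutatorElement_eq_one_iff_mul_comm.mp this

/-- An abelian torsion-free group of rank one with a nontrivial element that is divisible by boundedly
many integers only is cyclic. -/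
theorem exists_generator_of_bounded {F : Type u} [CommGroup F] (ht : TorsionFree F)
    (h1 : HasRank F 1) {y : F} (hy : y ≠ 1) {B : ℕ} (hB : ∀ (f : F) (k : ℕ), f ^ k = y → k ≤ B) :
    ∃ a : F, ∀ x, x ∈ zpowers a := by
  classical
  have hnil : Group.IsNilpotent F := CommGroup.isNilpotent
  have hex : ∃ k, ∃ f : F, f ^ k = y := ⟨1, y, pow_one y⟩
  -- The generator is a root `a` of `y` with the largest possible exponent.
  obtain ⟨k, ⟨a, ha⟩, hmax⟩ : ∃ k, (∃ f : F, f ^ k = y) ∧ ∀ l, (∃ f : F, f ^ l = y) → l ≤ k :=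
    ⟨_, Nat.findGreatest_spec (P := fun k => ∃ f : F, f ^ k = y) (hB y 1 (pow_one y)) ⟨y, pow_one y⟩,
      fun l ⟨f, hf⟩ => Nat.le_findGreatest (hB f l hf) ⟨f, hf⟩⟩
  have hk : 0 < k := hmax 1 ⟨y, pow_one y⟩
  have ha1 : a ≠ 1 := by
    rintro rfl
    exact hy (by rw [← ha, one_pow])
  refine ⟨a, fun x => ?_⟩
  obtain ⟨n, hn, j, hj⟩ := h1.exists_pow_eq_zpow ht ha1 x
  obtain ⟨d, hd⟩ : ∃ d : ℕ, d = Int.gcd j n := ⟨_, rfl⟩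
  have hd0 : 0 < d := by
    rw [hd]
    exact Int.gcd_pos_of_ne_zero_right _ (by exact_mod_cast hn.ne')
  obtain ⟨j', hj'⟩ : (d : ℤ) ∣ j := hd ▸ Int.gcd_dvd_left _ _
  obtain ⟨n', hn'⟩ : (d : ℤ) ∣ n := hd ▸ Int.gcd_dvd_right _ _
  have hn'pos : 0 < n' := by
    have : (0 : ℤ) < d * n' := by rw [← hn']; exact_mod_cast hn
    exact (mul_pos_iff_of_pos_left (by exact_mod_cast hd0)).mp this
  have hrel : a ^ j' = x ^ n' := by
    refine ht.pow_left_injective d hd0 _ _ ?_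
    rw [← zpow_natCast, ← zpow_natCast, ← zpow_mul, ← zpow_mul, mul_comm, ← hj', mul_comm, ← hn', hj,
      zpow_natCast]
  have hbez : j' * Int.gcdA j n + n' * Int.gcdB j n = 1 := by
    have h2 := Int.gcd_eq_gcd_ab j n
    rw [← hd] at h2
    have hd1 : (d : ℤ) ≠ 0 := by exact_mod_cast hd0.ne'
    apply mul_left_cancel₀ hd1
    linear_combination -h2 - Int.gcdA j n * hj' - Int.gcdB j n * hn'
  obtain ⟨α, hα⟩ : ∃ α, α = Int.gcdA j n := ⟨_, rfl⟩
  obtain ⟨β, hβ⟩ : ∃ β, β = Int.gcdB j n := ⟨_, rfl⟩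
  rw [← hα, ← hβ] at hbez
  -- Since `a ^ j' = x ^ n'` with `j'` and `n'` coprime, Bézout yields an `n'`-th root of `a`, hence
  -- an `n' * k`-th root of `y`; maximality of `k` forces `n' = 1`.
  have hc : (a ^ β * x ^ α) ^ n' = a := by
    rw [mul_zpow, ← zpow_mul, ← zpow_mul, mul_comm α n', zpow_mul x, ← hrel, ← zpow_mul, ← zpow_add,
      show β * n' + j' * α = 1 by linear_combination hbez, zpow_one]
  have hlast : n' * k ≤ k := by
    lift n' to ℕ using hn'pos.le
    have := hmax (n' * k) ⟨a ^ β * x ^ α, by rw [pow_mul, ← zpow_natCast _ n', hc, ha]⟩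
    exact_mod_cast this
  have hn1 : n' = 1 := by nlinarith
  rw [hn1, zpow_one] at hrel
  exact ⟨j', hrel⟩

/-- Groups with an infinite cyclic subgroup of index at most two. -/
theorem classification_of_infinite_cyclic_index_two {F : Type u} [Group F] (a : F)
    (ha : ∀ n : ℤ, a ^ n = 1 → n = 0) (h : ∀ x y : F, x ∉ zpowers a → y ∉ zpowers a → x * y ∈ zpowers a) :
    Nonempty (F ≃* Multiplicative ℤ) ∨ Nonempty (F ≃* DihedralGroup 0) ∨
      Nonempty (F ≃* Multiplicative (ℤ × ZMod 2)) := by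
  have hinj : ∀ m n : ℤ, a ^ m = a ^ n → m = n := fun m n hmn =>
    sub_eq_zero.mp (ha _ (by rw [zpow_sub, hmn, mul_inv_cancel]))
  have hcyc : ∀ b : F, (∀ n : ℤ, b ^ n = 1 → n = 0) → (∀ x, x ∈ zpowers b) →
      Nonempty (F ≃* Multiplicative ℤ) := by
    intro b hb hall
    refine ⟨(MulEquiv.ofBijective (zpowersHom F b) ⟨?_, fun x => ?_⟩).symm⟩
    · refine (injective_iff_map_eq_one _).mpr fun n hn => ?_
      exact hb n.toAdd (by simpa [zpowersHom_apply] using hn)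
    · obtain ⟨n, hn⟩ := hall x
      exact ⟨Multiplicative.ofAdd n, by simpa [zpowersHom_apply] using hn⟩
  by_cases htop : ∀ x, x ∈ zpowers a
  · exact Or.inl (hcyc a ha htop)
  push Not at htop
  obtain ⟨z, hz⟩ := htop
  have hz' : z⁻¹ ∉ zpowers a := fun h => hz (by simpa using inv_mem h)
  have hmul : ∀ {x y : F}, x ∉ zpowers a → y ∈ zpowers a → x * y ∉ zpowers a := fun hx hy hxy =>
    hx (by simpa using mul_mem hxy (inv_mem hy))
  obtain ⟨ε, hε⟩ : z * a * z⁻¹ ∈ zpowers a := h _ _ (hmul hz (mem_zpowers a)) hz'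
  obtain ⟨δ, hδ⟩ : z⁻¹ * a * z ∈ zpowers a := h _ _ (hmul hz' (mem_zpowers a)) hz
  have hεn : ∀ n : ℤ, z * a ^ n * z⁻¹ = a ^ (ε * n) := fun n => by
    rw [← conj_zpow, ← hε, zpow_mul]
  have hεδ : ε * δ = 1 := hinj _ _ (by
    rw [← hεn]
    change a ^ δ = _ at hδ
    rw [hδ]
    group)
  obtain ⟨i, hi⟩ : z * z ∈ zpowers a := h z z hz hz
  change a ^ i = z * z at hi
  have hcases : ∀ x, x ∈ zpowers a ∨ ∃ n : ℤ, x = z * a ^ n := by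
    intro x
    by_cases hx : x ∈ zpowers a
    · exact Or.inl hx
    obtain ⟨n, hn⟩ := h _ _ hz' hx
    exact Or.inr ⟨n, by change a ^ n = _ at hn; rw [hn]; group⟩
  have hnz : ∀ m n : ℤ, a ^ m ≠ z * a ^ n := fun m n hmn =>
    hz ⟨m - n, by change a ^ (m - n) = z; rw [zpow_sub, hmn]; group⟩
  -- `z` acts on `⟨a⟩` by the sign `ε`, and `z * z = a ^ i`. For `ε = 1`, halving `i` gives `w = z *
  -- a ^ (-j)` with `w * w = 1` (direct product with `ℤ/2`) or `w * w = a` (cyclic). For `ε = -1`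
  -- the group is dihedral.
  rcases Int.eq_one_or_neg_one_of_mul_eq_one hεδ with rfl | rfl
  · have hcom : ∀ n : ℤ, z * a ^ n = a ^ n * z := fun n => by
      have := hεn n
      rwa [one_mul, mul_inv_eq_iff_eq_mul] at this
    rcases Int.even_or_odd' i with ⟨j, rfl | rfl⟩
    · right; right
      obtain ⟨w, hw⟩ : ∃ w, w = z * a ^ (-j) := ⟨_, rfl⟩
      have hww : w * w = 1 := by
        rw [hw]
        nth_rewrite 2 [hcom]
        rw [mul_assoc, ← mul_assoc (a ^ (-j)), ← zpow_add, ← mul_assoc, hcom, mul_assoc, ← hi,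
          ← zpow_add, show -j + -j + 2 * j = 0 by ring, zpow_zero]
      have hcw : ∀ n : ℤ, w * a ^ n = a ^ n * w := fun n => by
        rw [hw, mul_assoc, ← zpow_add, add_comm, zpow_add, ← mul_assoc, hcom, mul_assoc]
      have hval : ∀ e e' : ZMod 2, w ^ (e + e').val = w ^ e.val * w ^ e'.val := by
        intro e e'
        rw [ZMod.val_add, ← pow_eq_pow_mod _ (by rw [pow_two, hww]), pow_add]
      have hcw' : ∀ (e : ZMod 2) (n : ℤ), w ^ e.val * a ^ n = a ^ n * w ^ e.val := fun e n =>
        (show Commute w (a ^ n) from hcw n).pow_left _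
      have hzw : z = w * a ^ j := by rw [hw, mul_assoc, ← zpow_add, neg_add_cancel, zpow_zero, mul_one]
      have hwn : ∀ m : ℤ, w ≠ a ^ m := fun m hm => hnz (m + j) 0 (by
        rw [zpow_zero, mul_one, hzw, zpow_add, hm])
      let f : Multiplicative (ℤ × ZMod 2) →* F :=
        { toFun := fun x => a ^ x.toAdd.1 * w ^ x.toAdd.2.val
          map_one' := by simp
          map_mul' := fun x y => by
            simp only [toAdd_mul, Prod.fst_add, Prod.snd_add, zpow_add, hval]
            rw [mul_assoc, mul_assoc, mul_right_inj, ← mul_assoc, ← mul_assoc, hcw'] }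
      refine ⟨(MulEquiv.ofBijective f ⟨?_, fun x => ?_⟩).symm⟩
      · refine (injective_iff_map_eq_one _).mpr fun x hx => ?_
        obtain ⟨n, e⟩ := x
        have hx' : a ^ n * w ^ e.val = 1 := hx
        fin_cases e
        · have : a ^ n = 1 := by simpa [ZMod.val] using hx'
          rw [ha n this]
          rfl
        · have : a ^ n * w = 1 := by simpa [ZMod.val] using hx'
          exact absurd (by rw [zpow_neg, ← eq_inv_of_mul_eq_one_right this]) (hwn (-n))
      · rcases hcases x with ⟨n, hn⟩ | ⟨n, rfl⟩
        · exact ⟨Multiplicative.ofAdd (n, 0), by simpa [f] using hn⟩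
        · refine ⟨Multiplicative.ofAdd (j + n, 1), ?_⟩
          rw [hzw, mul_assoc, ← zpow_add, hcw]
          change a ^ (j + n) * w ^ (1 : ZMod 2).val = _
          rw [show (1 : ZMod 2).val = 1 from rfl, pow_one]
    · left
      obtain ⟨w, hw⟩ : ∃ w, w = z * a ^ (-j) := ⟨_, rfl⟩
      have hww : w * w = a := by
        rw [hw]
        nth_rewrite 2 [hcom]
        rw [mul_assoc, ← mul_assoc (a ^ (-j)), ← zpow_add, ← mul_assoc, hcom, mul_assoc, ← hi,
          ← zpow_add, show -j + -j + (2 * j + 1) = 1 by ring, zpow_one]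
      have hwa : ∀ n : ℤ, a ^ n = w ^ (2 * n) := fun n => by
        rw [zpow_mul, ← hww, ← pow_two]
        norm_cast
      refine hcyc w (fun n hn => ha n ?_) fun x => ?_
      · rw [hwa, mul_comm, zpow_mul, hn, one_zpow]
      · rcases hcases x with ⟨n, rfl⟩ | ⟨n, rfl⟩
        · exact ⟨2 * n, (hwa n).symm⟩
        · refine ⟨1 + 2 * (j + n), ?_⟩
          change w ^ _ = _
          rw [zpow_add, ← hwa, zpow_one, hw, mul_assoc, ← zpow_add, neg_add_cancel_left]
  · right; left
    -- `z` commutes with its own square `a ^ i` and also inverts it.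
    have hi0 : i = 0 := by
      have h1 := hεn i
      rw [hi, mul_assoc, mul_assoc, mul_inv_cancel, mul_one, ← hi] at h1
      have := hinj _ _ h1
      omega
    have hzz : z * z = 1 := by rw [← hi, hi0, zpow_zero]
    have hcom : ∀ n : ℤ, a ^ n * z = z * a ^ (-n) := fun n => by
      have h1 := hεn (-n)
      rw [mul_inv_eq_iff_eq_mul] at h1
      rw [h1, neg_mul_neg, one_mul]
    let f : DihedralGroup 0 → F := fun x => match x with
      | .r n => a ^ (show ℤ from n)
      | .sr n => z * a ^ (show ℤ from n)
    have hf : ∀ x y, f (x * y) = f x * f y := by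
      rintro (m | m) (n | n)
      · change a ^ (_ + _ : ℤ) = _
        exact zpow_add a _ _
      · change z * a ^ (_ - _ : ℤ) = a ^ (_ : ℤ) * (z * a ^ (_ : ℤ))
        rw [← mul_assoc, hcom, mul_assoc, ← zpow_add, neg_add_eq_sub]
      · exact (congrArg (z * ·) (zpow_add a _ _)).trans (mul_assoc _ _ _).symm
      · change a ^ (_ - _ : ℤ) = z * a ^ (_ : ℤ) * (z * a ^ (_ : ℤ))
        rw [mul_assoc, ← mul_assoc (a ^ _), hcom, mul_assoc, ← mul_assoc, hzz, one_mul, ← zpow_add,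
          neg_add_eq_sub]
    refine ⟨(MulEquiv.ofBijective (MonoidHom.mk' f hf) ⟨?_, fun x => ?_⟩).symm⟩
    · refine (injective_iff_map_eq_one _).mpr fun x hx => ?_
      obtain n | n := x
      · have : (show ℤ from n) = 0 := ha _ hx
        change n = 0 at this
        rw [this]
        rfl
      · exact absurd (by rw [zpow_zero]; exact hx.symm) (hnz 0 n)
    · rcases hcases x with ⟨n, rfl⟩ | ⟨n, rfl⟩
      · exact ⟨.r n, rfl⟩
      · exact ⟨.sr n, rfl⟩

/-- The determinant character of a linear representation. -/
noncomputable def detChar {F : Type u} [Group F] {V : Type v} [AddCommGroup V] [Module ℚ V]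
    (ρ : F →* Module.End ℚ V) : F →* ℚˣ := (LinearMap.det.comp ρ).toHomUnits

section

variable {F : Type u} [Group F] {V : Type v} [AddCommGroup V] [Module ℚ V]
  (ρ : F →* Module.End ℚ V)

theorem coe_detChar (f : F) : (detChar ρ f : ℚ) = LinearMap.det (ρ f) := rfl

theorem isNilpotent_mul_sub_one {R : Type*} [Ring R] {a b : R} (h : Commute a b)
    (ha : IsNilpotent (a - 1)) (hb : IsNilpotent (b - 1)) : IsNilpotent (a * b - 1) := by
  have h1 : Commute (a - 1) b := h.sub_left (Commute.one_left b)
  have h2 : Commute (a - 1) (b - 1) := h1.sub_right (Commute.one_right _)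
  rw [show a * b - 1 = (a - 1) * b + (b - 1) by noncomm_ring]
  exact Commute.isNilpotent_add (h2.mul_left ((Commute.refl b).sub_right (Commute.one_right b)))
    (h1.isNilpotent_mul_right ha) hb

/-- The elements of a commutative subgroup which act unipotently. -/
def unipotentSubgroup (N : Subgroup F) (hN : ∀ a ∈ N, ∀ b ∈ N, a * b = b * a) : Subgroup F where
  carrier := {f | f ∈ N ∧ IsNilpotent (ρ f - 1)}
  one_mem' := ⟨N.one_mem, by rw [map_one, sub_self]; exact IsNilpotent.zero⟩
  mul_mem' := fun {a b} ha hb => ⟨N.mul_mem ha.1 hb.1, by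
    rw [map_mul]
    refine isNilpotent_mul_sub_one ?_ ha.2 hb.2
    change ρ a * ρ b = ρ b * ρ a
    rw [← map_mul, hN a ha.1 b hb.1, map_mul]⟩
  inv_mem' := fun {a} ha => ⟨N.inv_mem ha.1, by
    have h1 : ρ a⁻¹ * ρ a = 1 := by rw [← map_mul, inv_mul_cancel, map_one]
    have h2 : ρ a * ρ a⁻¹ = 1 := by rw [← map_mul, mul_inv_cancel, map_one]
    rw [show ρ a⁻¹ - 1 = (-ρ a⁻¹) * (ρ a - 1) by
      rw [mul_sub, neg_mul, h1, mul_one]; abel]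
    refine Commute.isNilpotent_mul_left ?_ ha.2
    refine Commute.neg_left (Commute.sub_right ?_ (Commute.one_right _))
    exact h1.trans h2.symm⟩

theorem unipotentSubgroup_normal (N : Subgroup F) [N.Normal]
    (hN : ∀ a ∈ N, ∀ b ∈ N, a * b = b * a) : (unipotentSubgroup ρ N hN).Normal := by
  refine ⟨fun a ha g => ⟨Normal.conj_mem inferInstance a ha.1 g, ?_⟩⟩
  have h1 : ρ g⁻¹ * ρ g = 1 := by rw [← map_mul, inv_mul_cancel, map_one]
  have h2 : ρ g * ρ g⁻¹ = 1 := by rw [← map_mul, mul_inv_cancel, map_one]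
  have h3 : ρ (g * a * g⁻¹) - 1 = ρ g * (ρ a - 1) * ρ g⁻¹ := by
    rw [map_mul, map_mul, mul_sub, sub_mul, mul_one, h2]
  have h4 : ∀ n : ℕ, (ρ (g * a * g⁻¹) - 1) ^ n = ρ g * (ρ a - 1) ^ n * ρ g⁻¹ := by
    intro n
    induction n with
    | zero => rw [pow_zero, pow_zero, mul_one, h2]
    | succ n ih =>
      rw [pow_succ, ih, h3, pow_succ]
      simp only [mul_assoc]
      rw [← mul_assoc (ρ g⁻¹) (ρ g), h1, one_mul]
  obtain ⟨n, hn⟩ := ha.2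
  exact ⟨n, by rw [h4, hn, mul_zero, zero_mul]⟩

/-- An endomorphism of a plane of determinant one and trace `m ∈ {-1, 0, 1}` has finite order. -/
theorem pow_twelve_eq_one (hV : Module.finrank ℚ V = 2) {f : Module.End ℚ V}
    (hd : LinearMap.det f = 1) {m : ℤ} (hm : |m| ≤ 1) (ht : LinearMap.trace ℚ V f = m) :
    f ^ 12 = 1 := by
  have h2 := sq_eq_of_finrank_two hV f
  rw [hd, ht, one_smul] at h2
  obtain ⟨h3, h4⟩ := abs_le.mp hm
  obtain rfl | rfl | rfl : m = -1 ∨ m = 0 ∨ m = 1 := by omega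
  · have h3 : f ^ 3 = 1 := by
      rw [pow_succ, h2]
      push_cast
      rw [neg_one_smul, sub_mul, neg_mul, ← pow_two, h2, one_mul]
      push_cast
      rw [neg_one_smul]
      abel
    rw [show 12 = 3 * 4 by norm_num, pow_mul, h3, one_pow]
  · have h3 : f ^ 2 = -1 := by
      rw [h2, Int.cast_zero, zero_smul, zero_sub]
    rw [show 12 = 2 * 6 by norm_num, pow_mul, h3]
    exact Even.neg_one_pow (by decide)
  · have h3 : f ^ 3 = -1 := by
      rw [pow_succ, h2, Int.cast_one, one_smul, sub_mul, ← pow_two, h2, one_mul, Int.cast_one, one_smul]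
      abel
    rw [show 12 = 3 * 4 by norm_num, pow_mul, h3]
    exact Even.neg_one_pow (by decide)

/-- The elements of positive determinant form a subgroup `N` of index at most two. By `htor` it is
torsion-free, so it is abelian, being of rank one. The work is to show that `N` is infinite cyclic;
`hunip` removes the unipotent elements, whose traces give no bound on roots. -/
theorem classification_of_rank_one_linear (h1 : HasRank F 1) (hV : Module.finrank ℚ V = 2)
    (hρ : Function.Injective ρ) (htor : ∀ f, IsOfFinOrder f → LinearMap.det (ρ f) = 1 → f = 1)
    (hunip : ∀ U : Subgroup F, U.Normal → (∀ a ∈ U, ∀ b ∈ U, a * b = b * a) →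
      (∀ a ∈ U, IsNilpotent (ρ a - 1)) → U = ⊥) :
    Nonempty (F ≃* Multiplicative ℤ) ∨ Nonempty (F ≃* DihedralGroup 0) ∨
      Nonempty (F ≃* Multiplicative (ℤ × ZMod 2)) := by
  have := Module.finite_of_finrank_eq_succ hV
  let χ := detChar ρ
  let N : Subgroup F := (Units.posSubgroup ℚ).comap χ
  have hN : ∀ f, f ∈ N ↔ 0 < LinearMap.det (ρ f) := fun f => Iff.rfl
  have hNn : N.Normal := inferInstance
  have hidx : ∀ x y : F, x ∉ N → y ∉ N → x * y ∈ N := by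
    intro x y hx hy
    rw [hN] at hx hy ⊢
    rw [map_mul, map_mul]
    refine mul_pos_of_neg_of_neg ?_ ?_
    · exact lt_of_le_of_ne (not_lt.mp hx) (χ x).ne_zero
    · exact lt_of_le_of_ne (not_lt.mp hy) (χ y).ne_zero
  have hdet : ∀ f ∈ N, ∀ k : ℕ, 0 < k → LinearMap.det (ρ f) ^ k = 1 → LinearMap.det (ρ f) = 1 := by
    intro f hf k hk h
    refine (eq_one_or_neg_one_of_pow hk h).resolve_right fun h => ?_
    rw [hN, h] at hf
    norm_num at hf
  have htN : TorsionFree N := by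
    intro f hf
    obtain ⟨k, hk, hk'⟩ := isOfFinOrder_iff_pow_eq_one.mp hf
    have hk1 : (f : F) ^ k = 1 := Subtype.ext_iff.mp hk'
    exact Subtype.ext (htor f (isOfFinOrder_iff_pow_eq_one.mpr ⟨k, hk, hk1⟩)
      (hdet f f.2 k hk (by rw [← map_pow, ← map_pow, hk1, map_one, map_one])))
  have hNr : HasRank N 1 := by
    obtain ⟨a, b, ha, hb, hab⟩ := h1.split_normal N
    have hfin : Finite (F ⧸ N) := by
      by_cases hall : ∀ x, x ∈ N
      · have : N = ⊤ := eq_top_iff.mpr fun x _ => hall x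
        have : Subsingleton (F ⧸ N) := QuotientGroup.subsingleton_iff.mpr this
        infer_instance
      push Not at hall
      obtain ⟨z, hz⟩ := hall
      refine Finite.of_surjective (fun b : Bool => if b then (1 : F ⧸ N) else z) fun x => ?_
      obtain ⟨x, rfl⟩ := QuotientGroup.mk_surjective x
      by_cases hx : x ∈ N
      · exact ⟨true, by simpa using ((QuotientGroup.eq_one_iff x).mpr hx).symm⟩
      · refine ⟨false, ?_⟩
        simp only [Bool.false_eq_true, if_false]
        exact QuotientGroup.eq.mpr (hidx _ _ (fun h => hz (by simpa using inv_mem h)) hx)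
    rw [hb.eq_zero (LocFinite.of_finite), add_zero] at hab
    exact hab ▸ ha
  have hcN' := htN.comm_of_hasRank_one hNr
  have hcN : ∀ a ∈ N, ∀ b ∈ N, a * b = b * a := fun a ha b hb =>
    Subtype.ext_iff.mp (hcN' ⟨a, ha⟩ ⟨b, hb⟩)
  let _ : CommGroup N := { (inferInstance : Group N) with mul_comm := hcN' }
  have hU := hunip _ (unipotentSubgroup_normal ρ N hcN) (fun a ha b hb => hcN a ha.1 b hb.1)
    (fun a ha => ha.2)
  have hU1 : ∀ f ∈ N, LinearMap.det (ρ f) = 1 → LinearMap.trace ℚ V (ρ f) = 2 → f = 1 := by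
    intro f hf hd ht
    have : f ∈ unipotentSubgroup ρ N hcN := ⟨hf, 2, sq_sub_one_of_trace_eq_two hV hd ht⟩
    rw [hU] at this
    exact mem_bot.mp this
  have htNpow : ∀ f ∈ N, ∀ k : ℕ, 0 < k → f ^ k = 1 → f = 1 := fun f hf k hk h =>
    Subtype.ext_iff.mp (htN.eq_one_of_pow hk (g := ⟨f, hf⟩) (Subtype.ext h))
  -- Trace 2 means unipotent, trace -2 means that the square is unipotent, and the remaining small
  -- traces mean that the twelfth power is trivial.
  have hsmall : ∀ f ∈ N, LinearMap.det (ρ f) = 1 → f ≠ 1 → ∀ m : ℤ, |m| ≤ 2 →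
      LinearMap.trace ℚ V (ρ f) ≠ m := by
    intro f hf hd hf1 m hm ht
    apply hf1
    by_cases h2 : m = 2
    · exact hU1 f hf hd (by rw [ht, h2]; norm_num)
    by_cases h2' : m = -2
    · refine htNpow f hf 2 two_pos (hU1 _ (N.pow_mem hf 2) (by rw [map_pow, map_pow, hd, one_pow]) ?_)
      rw [map_pow, sq_eq_of_finrank_two hV, hd, ht, h2', map_sub, map_smul, map_smul, ht, h2',
        LinearMap.trace_one, hV]
      norm_num
    have hm1 : |m| ≤ 1 := by
      rw [abs_le] at hm ⊢
      omega
    refine htNpow f hf 12 (by norm_num) (hρ ?_)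
    rw [map_pow, map_one, pow_twelve_eq_one hV hd hm1 ht]
  have hfinal : ∀ a : N, (∀ x, x ∈ zpowers a) → Nonempty (F ≃* Multiplicative ℤ) ∨
      Nonempty (F ≃* DihedralGroup 0) ∨ Nonempty (F ≃* Multiplicative (ℤ × ZMod 2)) := by
    intro a ha
    have hNa : N = zpowers (a : F) := by
      refine le_antisymm (fun x hx => ?_) ((zpowers_le).mpr a.2)
      obtain ⟨n, hn⟩ := ha ⟨x, hx⟩
      exact ⟨n, Subtype.ext_iff.mp hn⟩
    refine classification_of_infinite_cyclic_index_two (a : F) (fun n hn => ?_) (hNa ▸ hidx)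
    by_contra hn0
    have ha1 : a = 1 := htN a (isOfFinOrder_iff_zpow_eq_one.mpr ⟨n, hn0, Subtype.ext hn⟩)
    have : Finite N := by
      have : Subsingleton N := ⟨fun x y => by
        obtain ⟨i, rfl⟩ := ha x
        obtain ⟨j, rfl⟩ := ha y
        simp [ha1]⟩
      exact Finite.of_subsingleton
    exact one_ne_zero (hNr.eq_zero LocFinite.of_finite)
  -- Nontrivial elements of `N` are commensurable, so one of determinant 1 forces determinant 1
  -- throughout, and the trace of `u` bounds its roots. Otherwise the determinant is faithful on `N`
  -- and valuations separate its elements.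
  by_cases hA : ∃ u : N, u ≠ 1 ∧ LinearMap.det (ρ u) = 1
  · obtain ⟨u, hu, hdu⟩ := hA
    have hall : ∀ f : N, LinearMap.det (ρ f) = 1 := by
      intro f
      have hnil : Group.IsNilpotent N := CommGroup.isNilpotent
      obtain ⟨k, hk, j, hj⟩ := hNr.exists_pow_eq_zpow htN hu f
      refine hdet f f.2 k hk ?_
      have h2 : χ (f : F) ^ k = 1 := by
        have hχu : χ (u : F) = 1 := Units.ext hdu
        rw [← map_pow, ← coe_pow, ← hj, coe_zpow, map_zpow, hχu, one_zpow]
      exact Units.ext_iff.mp h2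
    obtain ⟨a, ha⟩ := exists_generator_of_bounded htN hNr hu
      (B := (LinearMap.trace ℚ V (ρ u)).den + (LinearMap.trace ℚ V (ρ u)).num.natAbs)
      (fun f k hfk => by
        have hf1 : (f : F) ≠ 1 := fun h => hu (by
          rw [← hfk, Subtype.ext (a1 := f) (a2 := 1) h, one_pow])
        have := le_den_trace_pow hV (hall f) (hsmall f f.2 (hall f) hf1) k
        rwa [← map_pow, ← coe_pow, hfk] at this)
    exact hfinal a ha
  · push Not at hA
    obtain ⟨e⟩ := nonempty_mulEquiv_of_residually_int (m := 1) (L := ℤ) hNr (fun g hg => by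
      by_contra hall
      push Not at hall
      rcases eq_one_or_neg_one_of_padicValRat (χ (g : F)).ne_zero (fun p hp => by
        have : Fact p.Prime := ⟨hp⟩
        exact hall ((padicValUnits p).comp (χ.comp N.subtype))) with h | h
      · exact hA g hg h
      · have h3 := (hN g).mp g.2
        rw [← coe_detChar] at h3
        change (0 : ℚ) < (χ (g : F) : ℚ) at h3
        rw [h] at h3
        norm_num at h3) (Module.finrank_self ℤ)
    refine hfinal (e.symm (Multiplicative.ofAdd 1)) fun x => ⟨(e x).toAdd, ?_⟩
    apply e.injective
    change e (e.symm _ ^ _) = _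
    rw [map_zpow, MulEquiv.apply_symm_apply, ← ofAdd_zsmul, smul_eq_mul, mul_one, ofAdd_toAdd]

end

/-! ### The radical of rank two -/

theorem isNilpotent_of_commutator {P : Type u} [Group P]
    (h : ∀ x y z w : P, ⁅⁅⁅x, y⁆, z⁆, w⁆ = 1) : Group.IsNilpotent P := by
  refine ⟨3, eq_top_iff.mpr fun x _ => ?_⟩
  refine Subgroup.mem_upperCentralSeries_succ_iff.mpr fun y => Subgroup.mem_upperCentralSeries_succ_iff.mpr fun z =>
    Subgroup.mem_upperCentralSeries_succ_iff.mpr fun w => ?_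
  rw [h]
  exact one_mem _

section RankTwo

variable {G : Type u} [Group G] {A : Subgroup G} {V : Type v} [AddCommGroup V] [Module ℚ V]
  (S : RatRep A V)

theorem RatRep.ρ_ι_of_commute {g a : G} (ha : a ∈ A) (h : g * a = a * g) : S.ρ g (S.ι a) = S.ι a := by
  rw [← S.ι_conj g a ha, h, mul_inv_cancel_right]

theorem RatRep.ρ_ι_pow {g : G} {k : ℕ} (hk : g ^ k ∈ A) : S.ρ g (S.ι (g ^ k)) = S.ι (g ^ k) :=
  S.ρ_ι_of_commute hk (pow_mul_comm' g k).symm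

/-- If `A` is self-centralizing of rank two in a torsion-free group and contains the nilpotent normal
subgroups, and `G/A` has rank one, then `G/A` is `ℤ`, `D∞` or `ℤ × ℤ/2`. -/
theorem classification_of_rank_two [A.Normal] (ht : TorsionFree G) (hA : centralizer (A : Set G) ≤ A)
    (hc : ∀ a ∈ A, ∀ b ∈ A, a * b = b * a) (h2 : HasRank A 2) (h1 : HasRank (G ⧸ A) 1)
    (hnil : ∀ N : Subgroup G, N.Normal → Group.IsNilpotent N → N ≤ A) :
    Nonempty (G ⧸ A ≃* Multiplicative ℤ) ∨ Nonempty (G ⧸ A ≃* DihedralGroup 0) ∨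
      Nonempty (G ⧸ A ≃* Multiplicative (ℤ × ZMod 2)) := by
  obtain ⟨V, _, _, _, hV, ⟨S⟩⟩ := exists_ratRep A hc (ht.subgroup A) (n := 2) h2
  have hcent : ∀ g, S.ρ g = 1 ↔ g ∈ A := fun g => S.ρ_eq_one_iff.trans
    ⟨fun h => hA h, fun h => mem_centralizer_iff.mpr fun a ha => hc a ha g h⟩
  let ρ : G ⧸ A →* Module.End ℚ V := QuotientGroup.lift A S.ρ fun g hg => (hcent g).mpr hg
  have hρ : ∀ g : G, ρ g = S.ρ g := fun g => rfl
  refine classification_of_rank_one_linear ρ h1 hV ?_ ?_ ?_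
  · have hunits : Function.Injective ρ.toHomUnits := by
      refine (injective_iff_map_eq_one _).mpr fun x hx => ?_
      obtain ⟨g, rfl⟩ := QuotientGroup.mk_surjective x
      exact (QuotientGroup.eq_one_iff g).mpr ((hcent g).mp (Units.ext_iff.mp hx))
    exact fun x y hxy => hunits (Units.ext hxy)
  · intro f hf hd
    obtain ⟨g, rfl⟩ := QuotientGroup.mk_surjective f
    obtain ⟨k, hk, hk'⟩ := isOfFinOrder_iff_pow_eq_one.mp hf
    have hgk : g ^ k ∈ A := (QuotientGroup.eq_one_iff _).mp hk'
    refine (QuotientGroup.eq_one_iff g).mpr ?_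
    by_cases hg1 : g ^ k = 1
    · rw [ht.eq_one_of_pow hk hg1]
      exact A.one_mem
    rw [hρ] at hd
    have hfix := S.ρ_ι_pow hgk
    have hne : S.ι (g ^ k) ≠ 0 := fun h => hg1 (S.ι_inj _ hgk h)
    -- Cayley–Hamilton on the nonzero fixed vector `S.ι (g ^ k)` gives trace 2 from determinant 1;
    -- with finite order this is the identity.
    have hsq := congrArg (fun f : Module.End ℚ V => f (S.ι (g ^ k))) (sq_eq_of_finrank_two hV (S.ρ g))
    simp only [pow_two, Module.End.mul_apply, hfix, hd, one_smul, LinearMap.sub_apply,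
      LinearMap.smul_apply, Module.End.one_apply] at hsq
    have htr : LinearMap.trace ℚ V (S.ρ g) = 2 := by
      have h3 : (LinearMap.trace ℚ V (S.ρ g) - 2) • S.ι (g ^ k) = 0 := by
        rw [sub_smul, two_smul]
        nth_rewrite 2 [hsq]
        abel
      exact sub_eq_zero.mp ((smul_eq_zero.mp h3).resolve_right hne)
    exact (hcent g).mp (eq_one_of_trace_eq_two hV hk (by rw [← map_pow, (hcent _).mpr hgk]) hd htr)
  · intro U hU hcU hUnip
    -- As products of two operators `ρ - 1` from `U` vanish, the third commutators in the preimage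
    -- of `U` are trivial. The preimage is thus a nilpotent normal subgroup and lies in `A`.
    have hprod : ∀ x ∈ U.comap (QuotientGroup.mk' A), ∀ y ∈ U.comap (QuotientGroup.mk' A),
        (S.ρ y - 1) * (S.ρ x - 1) = 0 := by
      intro x hx y hy
      refine mul_eq_zero_of_isNilpotent hV (hUnip _ hy) (hUnip _ hx) ?_
      have hcom : Commute (S.ρ y) (S.ρ x) := by
        have := congrArg ρ (hcU _ hy _ hx)
        rwa [map_mul, map_mul] at this
      exact (hcom.sub_left (Commute.one_left _)).sub_right (Commute.one_right _)
    have hle : U.comap (QuotientGroup.mk' A) ≤ A := by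
      refine hnil _ inferInstance (isNilpotent_of_commutator ?_)
      rintro ⟨x, hx⟩ ⟨y, hy⟩ ⟨z, hz⟩ ⟨w, hw⟩
      have hr : ⁅x, y⁆ ∈ A := by
        refine (QuotientGroup.eq_one_iff _).mp ?_
        have : QuotientGroup.mk' A ⁅x, y⁆ = 1 := by
          rw [map_commutatorElement]
          exact commutatorElement_eq_one_iff_mul_comm.mpr (hcU _ hx _ hy)
        exact this
      obtain ⟨r, hr'⟩ : ∃ r, r = ⁅x, y⁆ := ⟨_, rfl⟩
      rw [← hr'] at hr
      have hrz : ⁅r, z⁆ ∈ A := by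
        rw [commutatorElement_def, mul_assoc, mul_assoc]
        refine A.mul_mem hr ?_
        rw [← mul_assoc]
        exact Normal.conj_mem inferInstance _ (A.inv_mem hr) z
      have hι : S.ι ⁅r, z⁆ = -(S.ρ z - 1) (S.ι r) := by
        rw [commutatorElement_def, mul_assoc, mul_assoc, ← mul_assoc z]
        rw [S.ι_mul _ hr _ (Normal.conj_mem inferInstance _ (A.inv_mem hr) z),
          S.ι_conj _ _ (A.inv_mem hr), S.ι_inv hr, map_neg, LinearMap.sub_apply, Module.End.one_apply]
        abel
      have hw2 : S.ρ w (S.ι ⁅r, z⁆) = S.ι ⁅r, z⁆ := by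
        have h3 := congrArg (fun f : Module.End ℚ V => f (S.ι r)) (hprod z hz w hw)
        simp only [Module.End.mul_apply, LinearMap.zero_apply] at h3
        rw [LinearMap.sub_apply (S.ρ w), Module.End.one_apply, sub_eq_zero] at h3
        rw [hι, map_neg, h3]
      rw [← S.ι_conj w _ hrz] at hw2
      have h4 := mul_inv_eq_iff_eq_mul.mp
        (S.ι_injOn (Normal.conj_mem inferInstance _ hrz w) hrz hw2)
      refine Subtype.ext ?_
      change ⁅⁅⁅x, y⁆, z⁆, w⁆ = 1
      rw [← hr']
      exact commutatorElement_eq_one_iff_mul_comm.mpr h4.symm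
    refine eq_bot_iff.mpr fun f hf => ?_
    obtain ⟨g, rfl⟩ := QuotientGroup.mk_surjective f
    exact mem_bot.mpr ((QuotientGroup.eq_one_iff g).mpr (hle hf))

end RankTwo

/-! ### Reflections in the holonomy of a rank two abelian subgroup -/

section Reflections

variable {H : Type u} [Group H] {A : Subgroup H} {V : Type v} [AddCommGroup V] [Module ℚ V]
  (S : RatRep A V)

theorem RatRep.ι_conj_inv (g : H) {a : H} (ha : a ∈ A) : S.ι (g⁻¹ * a * g) = S.ρ g⁻¹ (S.ι a) := by
  have := S.ι_conj g⁻¹ a ha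
  rwa [inv_inv] at this

theorem RatRep.conj_inv_mem [A.Normal] (g : H) {a : H} (ha : a ∈ A) : g⁻¹ * a * g ∈ A := by
  have := Normal.conj_mem (inferInstance : A.Normal) a ha g⁻¹
  rwa [inv_inv] at this

theorem End.mul_apply_eq {f g h : Module.End ℚ V} (hfg : f * g = h) (v : V) : f (g v) = h v :=
  congrArg (fun f : Module.End ℚ V => f v) hfg

variable [A.Normal]

include S in
/-- A reflection and an element of order three do not generate a dihedral group of order six in the
holonomy of a group whose reflections do not lift to involutions. -/
theorem RatRep.false_of_reflection_of_order_three {r t : H} (hr2 : r ^ 2 ∈ A)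
    (hRR : S.ρ r * S.ρ r = 1) (hRT : S.ρ r * S.ρ t * S.ρ r * S.ρ t = 1)
    (he : S.ι (r ^ 2) + S.ρ t (S.ι (r ^ 2)) + S.ρ t (S.ρ t (S.ι (r ^ 2))) = 0)
    (hx : (r * (t * r * t⁻¹) * r) ^ 2 ≠ 1) : False := by
  obtain ⟨e, hee⟩ : ∃ e, e = S.ι (r ^ 2) := ⟨_, rfl⟩
  have hRe : S.ρ r e = e := by rw [hee, S.ρ_ι_pow hr2]
  have hinv : S.ρ r * S.ρ t⁻¹ = S.ρ t * S.ρ r := by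
    calc S.ρ r * S.ρ t⁻¹ = S.ρ r * (S.ρ r * S.ρ t * S.ρ r * S.ρ t) * S.ρ t⁻¹ := by rw [hRT, mul_one]
      _ = (S.ρ r * S.ρ r) * S.ρ t * S.ρ r * (S.ρ t * S.ρ t⁻¹) := by simp only [mul_assoc]
      _ = S.ρ t * S.ρ r := by rw [hRR, S.ρ_mul_inv, one_mul, mul_one]
  have h1 : S.ρ (t * r * t⁻¹) e = S.ρ t (S.ρ t e) := by
    rw [map_mul, map_mul, mul_assoc, hinv, Module.End.mul_apply, Module.End.mul_apply, hRe]
  have hr1 : t * r ^ 2 * t⁻¹ ∈ A := Normal.conj_mem inferInstance _ hr2 t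
  have hr2' : t * r * t⁻¹ * r ^ 2 * (t * r * t⁻¹)⁻¹ ∈ A := Normal.conj_mem inferInstance _ hr2 _
  -- With `e` the vector of `r ^ 2` and `T` the action of `t`, this square has vector `R (T² e + T
  -- e) + e = R (-e) + e = 0`, as `R` fixes `e`.
  have hexp : (r * (t * r * t⁻¹) * r) ^ 2 =
      r * ((t * r * t⁻¹ * r ^ 2 * (t * r * t⁻¹)⁻¹) * (t * r ^ 2 * t⁻¹)) * r⁻¹ * r ^ 2 := by
    simp only [pow_two]
    group
  apply hx
  rw [hexp]
  have hm := A.mul_mem hr2' hr1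
  refine S.ι_inj _ (A.mul_mem (Normal.conj_mem inferInstance _ hm r) hr2) ?_
  rw [S.ι_mul _ (Normal.conj_mem inferInstance _ hm r) _ hr2, S.ι_conj _ _ hm, S.ι_mul _ hr2' _ hr1,
    S.ι_conj _ _ hr2, S.ι_conj _ _ hr2, ← hee, h1]
  rw [← hee] at he
  have h2 : S.ρ t (S.ρ t e) + S.ρ t e = -e := by
    rw [eq_neg_iff_add_eq_zero, ← he]
    abel
  rw [h2, map_neg, hRe, neg_add_cancel]

include S in
/-- A reflection and an element of order four do not generate a dihedral group of order eight in the
holonomy of a group whose reflections do not lift to involutions. -/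
theorem RatRep.false_of_reflection_of_order_four (hV : Module.finrank ℚ V = 2)
    (hA : ∀ g, S.ρ g = 1 ↔ g ∈ A) {r t : H} (hr2 : r ^ 2 ∈ A)
    (hRR : S.ρ r * S.ρ r = 1) (hRT : S.ρ r * S.ρ t * S.ρ r * S.ρ t = 1)
    (hTT : S.ρ t * S.ρ t = -1) (hr : r ^ 2 ≠ 1)
    (hx : ∀ w ∈ A, (r * w) ^ 2 ≠ 1) (hy : ∀ w ∈ A, (t * r * w) ^ 2 ≠ 1) : False := by
  obtain ⟨e, hee⟩ : ∃ e, e = S.ι (r ^ 2) := ⟨_, rfl⟩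
  obtain ⟨d, hdd⟩ : ∃ d, d = S.ρ t e := ⟨_, rfl⟩
  have he0 : e ≠ 0 := fun h => hr (S.ι_inj _ hr2 (hee ▸ h))
  have hRe : S.ρ r e = e := by rw [hee, S.ρ_ι_pow hr2]
  have hTd : S.ρ t d = -e := by
    rw [hdd, End.mul_apply_eq hTT, LinearMap.neg_apply, Module.End.one_apply]
  have hTinv : S.ρ t⁻¹ = - S.ρ t := by
    have h1 : S.ρ t⁻¹ * (S.ρ t * S.ρ t) = S.ρ t := by rw [← mul_assoc, S.ρ_inv_mul, one_mul]
    rw [hTT, mul_neg, mul_one] at h1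
    rw [← h1, neg_neg]
  have hRinv : S.ρ r⁻¹ = S.ρ r := by
    rw [← mul_one (S.ρ r⁻¹), ← hRR, ← mul_assoc, S.ρ_inv_mul, one_mul]
  have hTR : S.ρ t * S.ρ r = - (S.ρ r * S.ρ t) := by
    calc S.ρ t * S.ρ r = (S.ρ r * S.ρ r) * S.ρ t * S.ρ r * (S.ρ t * S.ρ t⁻¹) := by
          rw [hRR, S.ρ_mul_inv, one_mul, mul_one]
      _ = S.ρ r * (S.ρ r * S.ρ t * S.ρ r * S.ρ t) * S.ρ t⁻¹ := by simp only [mul_assoc]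
      _ = - (S.ρ r * S.ρ t) := by rw [hRT, hTinv, mul_one, mul_neg]
  have hRd : S.ρ r d = -d := by
    have := congrArg (fun f : Module.End ℚ V => f e) hTR
    simp only [Module.End.mul_apply, LinearMap.neg_apply, hRe, ← hdd] at this
    rw [← neg_eq_iff_eq_neg] at this
    exact this.symm
  have hd0 : d ≠ 0 := by
    intro h
    rw [h, map_zero] at hTd
    exact he0 (neg_eq_zero.mp hTd.symm)
  have hli : ∀ a b : ℚ, a • e + b • d = 0 → a = 0 ∧ b = 0 := by
    intro a b hab
    have h1 := congrArg (S.ρ r) hab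
    rw [map_add, map_smul, map_smul, hRe, hRd, map_zero, smul_neg] at h1
    have h2 : (2 * a) • e = 0 := by
      rw [mul_smul, two_smul]
      calc a • e + a • e = (a • e + b • d) + (a • e + -(b • d)) := by abel
        _ = 0 := by rw [hab, h1, add_zero]
    have ha : a = 0 := by
      have := (smul_eq_zero.mp h2).resolve_right he0
      linarith
    rw [ha, zero_smul, zero_add] at hab
    exact ⟨ha, (smul_eq_zero.mp hab).resolve_right hd0⟩
  have hspan : ∀ v : V, ∃ a b : ℚ, v = a • e + b • d := by
    have hind : LinearIndependent ℚ ![e, d] := LinearIndependent.pair_iff.mpr hli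
    have htop := hind.span_eq_top_of_card_eq_finrank (by simp [hV])
    intro v
    have hv : v ∈ Submodule.span ℚ (Set.range ![e, d]) := htop ▸ Submodule.mem_top
    rw [Matrix.range_cons, Matrix.range_cons, Matrix.range_empty, Set.union_empty,
      Set.singleton_union, Submodule.mem_span_pair] at hv
    obtain ⟨a, b, h⟩ := hv
    exact ⟨a, b, h.symm⟩
  have hcA : ∀ w ∈ A, S.ρ w = 1 := fun w hw => (hA w).mpr hw
  have hv : r * t * r⁻¹ * t ∈ A := by
    rw [← hA, map_mul, map_mul, map_mul, hRinv, hRT]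
  have hs2 : (t * r) ^ 2 ∈ A := by
    rw [← hA, pow_two, map_mul, map_mul, hTR, neg_mul_neg, ← mul_assoc, hRT]
  -- In the basis `e`, `d` the configuration depends on one rational number: `(t * r) ^ 2` is fixed
  -- by the action of `t * r`, which exchanges `e` and `d`, and this yields `x = 1 - y`.
  obtain ⟨x, y, hxy⟩ := hspan (S.ι (r * t * r⁻¹ * t))
  have hs : S.ι ((t * r) ^ 2) = x • e + (1 - y) • d := by
    have hexp : (t * r) ^ 2 = r⁻¹ * ((r * t * r⁻¹ * t) * (t⁻¹ * r ^ 2 * t)) * r := by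
      simp only [pow_two]
      group
    have h1 := RatRep.conj_inv_mem (A := A) t hr2
    rw [hexp, S.ι_conj_inv _ (A.mul_mem hv h1), S.ι_mul _ hv _ h1, S.ι_conj_inv _ hr2, ← hee, hxy,
      hTinv, hRinv, LinearMap.neg_apply, ← hdd, map_add, map_add, map_smul, map_smul, map_neg, hRe,
      hRd, sub_smul, one_smul, smul_neg]
    abel
  have hTRe : S.ρ (t * r) e = d := by rw [map_mul, Module.End.mul_apply, hRe, ← hdd]
  have hTRd : S.ρ (t * r) d = e := by
    rw [map_mul, Module.End.mul_apply, hRd, map_neg, hTd, neg_neg]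
  have hx1 : x = 1 - y := by
    have h1 := S.ρ_ι_pow hs2
    rw [hs, map_add, map_smul, map_smul, hTRe, hTRd, ← sub_eq_zero] at h1
    have h2 : (1 - y - x) • e + (x - (1 - y)) • d = 0 := by
      rw [← h1, sub_smul, sub_smul x]
      abel
    have := (hli _ _ h2).2
    linarith
  rw [← hx1] at hs
  have hTRinv : S.ρ (t * r)⁻¹ = S.ρ (t * r) := by
    have h1 : S.ρ (t * r) * S.ρ (t * r) = 1 := by rw [← map_mul, ← pow_two, hcA _ hs2]
    rw [← mul_one (S.ρ (t * r)⁻¹), ← h1, ← mul_assoc, S.ρ_inv_mul, one_mul]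
  have hrw : ∀ w ∈ A, ∀ a b : ℚ, S.ι w = a • e + b • d → 1 + 2 * a ≠ 0 := by
    intro w hw a b hab h0
    have h1 := RatRep.conj_inv_mem (A := A) r hw
    have hexp : (r * w) ^ 2 = r ^ 2 * ((r⁻¹ * w * r) * w) := by
      simp only [pow_two]
      group
    refine hx w hw ?_
    rw [hexp]
    refine S.ι_inj _ (A.mul_mem hr2 (A.mul_mem h1 hw)) ?_
    rw [S.ι_mul _ hr2 _ (A.mul_mem h1 hw), S.ι_mul _ h1 _ hw, S.ι_conj_inv _ hw, hRinv, hab, ← hee,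
      map_add, map_smul, map_smul, hRe, hRd]
    calc e + (a • e + b • -d + (a • e + b • d)) = (1 + 2 * a) • e := by
          rw [add_smul, one_smul, mul_smul, two_smul, smul_neg]; abel
      _ = 0 := by rw [h0, zero_smul]
  have htrw : ∀ w ∈ A, ∀ a b : ℚ, S.ι w = a • e + b • d → x + (a + b) ≠ 0 := by
    intro w hw a b hab h0
    have h1 := RatRep.conj_inv_mem (A := A) (t * r) hw
    have hexp : (t * r * w) ^ 2 = (t * r) ^ 2 * (((t * r)⁻¹ * w * (t * r)) * w) := by
      simp only [pow_two]
      group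
    refine hy w hw ?_
    rw [hexp]
    refine S.ι_inj _ (A.mul_mem hs2 (A.mul_mem h1 hw)) ?_
    rw [S.ι_mul _ hs2 _ (A.mul_mem h1 hw), S.ι_mul _ h1 _ hw, S.ι_conj_inv _ hw, hTRinv, hab, hs,
      map_add, map_smul, map_smul, hTRe, hTRd]
    calc x • e + x • d + (a • d + b • e + (a • e + b • d)) = (x + (a + b)) • e + (x + (a + b)) • d := by
          simp only [add_smul]; abel
      _ = 0 := by rw [h0, zero_smul, zero_smul, add_zero]
  -- The translations generated by `(t * r) ^ 2` and `r ^ 2` suffice to correct one of the two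
  -- reflections.
  have hw : ∀ α β : ℤ, ∃ w ∈ A, S.ι w = (α * x + β) • e + (α * x) • d := by
    intro α β
    refine ⟨((t * r) ^ 2) ^ α * (r ^ 2) ^ β, A.mul_mem (A.zpow_mem hs2 α) (A.zpow_mem hr2 β), ?_⟩
    rw [S.ι_mul _ (A.zpow_mem hs2 α) _ (A.zpow_mem hr2 β), S.ι_zpow hs2, S.ι_zpow hr2, hs, ← hee,
      ← Int.cast_smul_eq_zsmul ℚ, ← Int.cast_smul_eq_zsmul ℚ, smul_add, smul_smul, smul_smul, add_smul]
    abel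
  have hmn : x * x.den = x.num := Rat.mul_den_eq_num x
  -- For these `w`, `hrw` forbids `1 + 2 (α x + β) = 0` and `htrw` forbids `(2 α + 1) x + β = 0`. An
  -- even denominator of `x` solves the first equation, an odd one the second.
  rcases Nat.even_or_odd' x.den with ⟨n, hn | hn⟩
  · have hodd : Odd x.num := by
      rw [← Int.not_even_iff_odd]
      intro hev
      have h1 : 2 ∣ x.num.natAbs := Int.natCast_dvd.mp (by exact_mod_cast hev.two_dvd)
      have h2 := Nat.dvd_gcd h1 (⟨n, hn⟩ : 2 ∣ x.den)
      rw [x.reduced] at h2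
      omega
    obtain ⟨m, hm⟩ := hodd
    obtain ⟨w, hwA, hw⟩ := hw n (-(m + 1))
    refine hrw w hwA _ _ hw ?_
    rw [hn, hm] at hmn
    push_cast at hmn ⊢
    linear_combination hmn
  · obtain ⟨w, hwA, hw⟩ := hw n (-x.num)
    refine htrw w hwA _ _ hw ?_
    rw [hn] at hmn
    push_cast at hmn ⊢
    linear_combination hmn

include S in
/-- Let `A` be an abelian normal subgroup of rank two with torsion quotient, acting as the kernel of
the action on `A ⊗ ℚ`. If no reflection lifts to an involution then the quotient is abelian. -/
theorem RatRep.commute_of_reflections (hV : Module.finrank ℚ V = 2)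
    (hA : ∀ g, S.ρ g = 1 ↔ g ∈ A) (htor : ∀ g, ∃ k, 0 < k ∧ g ^ k ∈ A)
    (hrefl : ∀ g, LinearMap.det (S.ρ g) = -1 → g ^ 2 ≠ 1) (x y : H) :
    S.ρ x * S.ρ y = S.ρ y * S.ρ x := by
  have htorρ : ∀ g, ∃ k, 0 < k ∧ S.ρ g ^ k = 1 := fun g => by
    obtain ⟨k, hk, h⟩ := htor g
    exact ⟨k, hk, by rw [← map_pow, (hA _).mpr h]⟩
  have hdet : ∀ g, LinearMap.det (S.ρ g) = 1 ∨ LinearMap.det (S.ρ g) = -1 := fun g => by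
    obtain ⟨k, hk, h⟩ := htorρ g
    exact det_of_pow_eq_one hk h
  have hsq : ∀ g, LinearMap.det (S.ρ g) = -1 → S.ρ g * S.ρ g = 1 := fun g hg => by
    obtain ⟨k, hk, h⟩ := htorρ g
    rw [← pow_two, sq_eq_one_of_det_eq_neg_one hV hk h hg]
  have hmain : ∀ r t, LinearMap.det (S.ρ r) = -1 → LinearMap.det (S.ρ t) = 1 →
      S.ρ r * S.ρ t = S.ρ t * S.ρ r := by
    intro r t hr ht
    have hRR := hsq r hr
    have hr2 : r ^ 2 ∈ A := by rw [← hA, pow_two, map_mul, hRR]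
    -- `r * t` again has determinant `-1`, so it acts as an involution; in other words `r` inverts
    -- the action of `t`.
    have hdec : ∀ t, LinearMap.det (S.ρ t) = 1 → S.ρ r * S.ρ t * S.ρ r * S.ρ t = 1 := by
      intro t ht
      have := hsq (r * t) (by rw [map_mul, map_mul, hr, ht, mul_one])
      rwa [map_mul, ← mul_assoc] at this
    have h3 : ∀ t, LinearMap.det (S.ρ t) = 1 → S.ρ t * S.ρ t = -S.ρ t - 1 → False := by
      intro t ht hT
      refine S.false_of_reflection_of_order_three hr2 hRR (hdec t ht) ?_ (hrefl _ ?_)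
      · rw [End.mul_apply_eq hT, LinearMap.sub_apply, LinearMap.neg_apply, Module.End.one_apply]
        abel
      · have h1 : LinearMap.det (S.ρ t) * LinearMap.det (S.ρ t⁻¹) = 1 := by
          rw [← map_mul, S.ρ_mul_inv, map_one]
        rw [ht, one_mul] at h1
        simp only [map_mul, hr, ht, h1]
        norm_num
    obtain ⟨k, hk, hk1⟩ := htorρ t
    obtain ⟨m, hm, htr⟩ := exists_trace_eq_of_pow_eq_one hV hk hk1 ht
    have hT := sq_eq_of_finrank_two hV (S.ρ t)
    rw [ht, htr, one_smul, pow_two] at hT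
    obtain ⟨hm1, hm2⟩ := abs_le.mp hm
    -- By the possible traces `t` acts with order 2, 3, 4, 6 or 1. Order 6 reduces to order 3 by
    -- squaring, and orders 3 and 4 are excluded, so `t` acts as `-1` or `1`.
    obtain rfl | rfl | rfl | rfl | rfl : m = -2 ∨ m = -1 ∨ m = 0 ∨ m = 1 ∨ m = 2 := by omega
    · rw [eq_neg_one_of_trace_eq_neg_two hV hk hk1 ht (by rw [htr]; norm_num)]
      simp
    · exact (h3 t ht (by rw [hT]; simp)).elim
    · rw [Int.cast_zero, zero_smul, zero_sub] at hT
      refine (S.false_of_reflection_of_order_four hV hA hr2 hRR (hdec t ht) hT (hrefl r hr)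
        (fun w hw => hrefl _ ?_) (fun w hw => hrefl _ ?_)).elim
      · rw [map_mul, (hA w).mpr hw, mul_one, hr]
      · rw [map_mul, map_mul, (hA w).mpr hw, map_one, mul_one, map_mul, map_mul, hr, ht, one_mul]
    · rw [Int.cast_one, one_smul] at hT
      refine (h3 (t * t) (by rw [map_mul, map_mul, ht, one_mul]) ?_).elim
      rw [map_mul, hT, sub_mul, mul_sub, mul_one, one_mul, hT]
      abel
    · rw [eq_one_of_trace_eq_two hV hk hk1 ht (by rw [htr]; norm_num)]
      simp
  rcases hdet x with hx | hx <;> rcases hdet y with hy | hy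
  · obtain ⟨k, hk, h⟩ := htorρ x
    obtain ⟨l, hl, h'⟩ := htorρ (x * y * x⁻¹ * y⁻¹)
    simp only [map_mul] at h'
    exact commute_of_finite_order hV hx hy (S.ρ_mul_inv x) (S.ρ_mul_inv y) hk h hl h'
  · exact (hmain y x hy hx).symm
  · exact hmain x y hx hy
  -- The product of two reflections has determinant one, so `x` commutes with the action of `x * y`.
  · have h1 := hmain x (x * y) hx (by rw [map_mul, map_mul, hx, hy]; norm_num)
    rw [map_mul, ← mul_assoc, hsq x hx, one_mul] at h1
    calc S.ρ x * S.ρ y = S.ρ x * (S.ρ x * S.ρ y * S.ρ x) := by rw [← h1]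
      _ = (S.ρ x * S.ρ x) * S.ρ y * S.ρ x := by simp only [mul_assoc]
      _ = S.ρ y * S.ρ x := by rw [hsq x hx, one_mul]

end Reflections

/-! ### Finiteness of periodic rational linear groups -/

/-- A linear group whose traces lie in a finite set, and in which only the identity has maximal trace,
is finite. -/
theorem finite_of_trace {F : Type u} [Group F] {V : Type v} [AddCommGroup V] [Module ℚ V]
    [FiniteDimensional ℚ V] (ρ : F →* Module.End ℚ V) {T : Set ℚ} (hT : T.Finite)
    (h : ∀ f, LinearMap.trace ℚ V (ρ f) ∈ T)
    (h1 : ∀ f, LinearMap.trace ℚ V (ρ f) = Module.finrank ℚ V → f = 1) : Finite F := by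
  obtain ⟨s, hs, hspan⟩ := (Submodule.fg_span_iff_fg_span_finset_subset (R := ℚ) (Set.range ρ)).mp
    (IsNoetherian.noetherian _)
  have : Finite T := hT
  have hmem : ∀ (f : F) (x : s), LinearMap.trace ℚ V (ρ f * x) ∈ T := by
    rintro f ⟨x, hx⟩
    obtain ⟨g, rfl⟩ := hs hx
    change LinearMap.trace ℚ V (ρ f * ρ g) ∈ T
    rw [← map_mul]
    exact h _
  -- Burnside's argument: the traces against a finite spanning set of `ρ F` take finitely many
  -- values, and they determine the traces against all of `ρ F`. Testing against `g⁻¹` then gives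
  -- maximal trace for `f * g⁻¹`.
  refine Finite.of_injective (fun (f : F) (x : s) => (⟨_, hmem f x⟩ : T)) fun f g hfg => ?_
  have h2 : ∀ x ∈ Submodule.span ℚ (Set.range ρ),
      LinearMap.trace ℚ V (ρ f * x) = LinearMap.trace ℚ V (ρ g * x) := by
    intro x hx
    rw [hspan] at hx
    induction hx using Submodule.span_induction with
    | mem x hx => exact Subtype.ext_iff.mp (congrFun hfg ⟨x, hx⟩)
    | zero => simp
    | add x y _ _ hx hy => rw [mul_add, mul_add, map_add, map_add, hx, hy]
    | smul c x _ hx => rw [mul_smul_comm, mul_smul_comm, map_smul, map_smul, hx]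
  have h3 := h2 _ (Submodule.subset_span ⟨g⁻¹, rfl⟩)
  rw [← map_mul, ← map_mul, mul_inv_cancel, map_one, LinearMap.trace_one] at h3
  exact mul_inv_eq_one.mp (h1 _ h3)

/-- A periodic group with a faithful rational representation of degree two is finite. -/
theorem finite_of_periodic_of_finrank_two {F : Type u} [Group F] {V : Type v} [AddCommGroup V]
    [Module ℚ V] (hV : Module.finrank ℚ V = 2) (ρ : F →* Module.End ℚ V)
    (hρ : ∀ f, ρ f = 1 → f = 1) (htor : ∀ f : F, IsOfFinOrder f) : Finite F := by
  have := Module.finite_of_finrank_eq_succ hV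
  have key : ∀ f, (LinearMap.det (ρ f) = 1 ∧ ∃ m : ℤ, |m| ≤ 2 ∧ LinearMap.trace ℚ V (ρ f) = m) ∨
      LinearMap.trace ℚ V (ρ f) = 0 := by
    intro f
    obtain ⟨k, hk, hk'⟩ := isOfFinOrder_iff_pow_eq_one.mp (htor f)
    have hpow : ρ f ^ k = 1 := by rw [← map_pow, hk', map_one]
    rcases det_of_pow_eq_one hk hpow with hd | hd
    · exact Or.inl ⟨hd, exists_trace_eq_of_pow_eq_one hV hk hpow hd⟩
    · exact Or.inr (trace_eq_zero_of_det_eq_neg_one hV hk hpow hd)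
  refine finite_of_trace ρ (T := (fun m : ℤ => (m : ℚ)) '' Set.Icc (-2) 2)
    ((Set.finite_Icc _ _).image _) (fun f => ?_) fun f hf => hρ f ?_
  · rcases key f with ⟨-, m, hm, h⟩ | h
    · exact ⟨m, abs_le.mp hm, h.symm⟩
    · exact ⟨0, by simp, by rw [h]; simp⟩
  · obtain ⟨k, hk, hk'⟩ := isOfFinOrder_iff_pow_eq_one.mp (htor f)
    rw [hV] at hf
    refine eq_one_of_trace_eq_two hV hk (by rw [← map_pow, hk', map_one]) ?_ hf
    rcases key f with ⟨hd, -⟩ | h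
    · exact hd
    · rw [h] at hf
      norm_num at hf

/-! ### The nonabelian radical of rank three -/

section Nonabelian

variable {G : Type u} [Group G] {R : Subgroup G}

/-- If `R` contains its centralizer and the centralizer has rank one, then any two nontrivial
elements of the centralizer are commensurable. -/
theorem exists_pow_eq_zpow_of_centralizer (ht : TorsionFree G) (hR : centralizer (R : Set G) ≤ R)
    (hZ : HasRank (centralizer (R : Set G)) 1) {c : G} (hc : c ∈ centralizer (R : Set G))
    (hc1 : c ≠ 1) {z : G} (hz : z ∈ centralizer (R : Set G)) :
    ∃ k : ℕ, 0 < k ∧ ∃ j : ℤ, c ^ j = z ^ k := by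
  let _ : CommGroup (centralizer (R : Set G)) :=
    { (inferInstance : Group (centralizer (R : Set G))) with
      mul_comm := fun a b => Subtype.ext (mem_centralizer_iff.mp b.2 _ (hR a.2)) }
  have hnil : Group.IsNilpotent (centralizer (R : Set G)) := CommGroup.isNilpotent
  obtain ⟨k, hk, j, hj⟩ := hZ.exists_pow_eq_zpow (ht.subgroup _) (y := ⟨c, hc⟩)
    (fun h => hc1 (Subtype.ext_iff.mp h)) ⟨z, hz⟩
  exact ⟨k, hk, j, Subtype.ext_iff.mp hj⟩

/-- The stability group of `1 ≤ Z(R) ≤ R` lies in `R`. -/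
theorem mem_of_commutator_mem_centralizer [R.Normal] (ht : TorsionFree G) (hR : centralizer (R : Set G) ≤ R)
    (hnil : ∀ N : Subgroup G, N.Normal → Group.IsNilpotent N → N ≤ R)
    (hZ : HasRank (centralizer (R : Set G)) 1)
    (hRR : ∀ a ∈ R, ∀ b ∈ R, ⁅a, b⁆ ∈ centralizer (R : Set G))
    {a b : G} (ha : a ∈ R) (hb : b ∈ R) (hab : a * b ≠ b * a) {g : G}
    (hg : ∀ r ∈ R, ⁅g, r⁆ ∈ centralizer (R : Set G)) : g ∈ R := by
  obtain ⟨Z, hZdef⟩ : ∃ Z, Z = centralizer (R : Set G) := ⟨_, rfl⟩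
  have hZn : Z.Normal := hZdef ▸ (inferInstance : (centralizer (R : Set G)).Normal)
  have hZR : ∀ z ∈ Z, ∀ r ∈ R, r * z = z * r := fun z hz r hr =>
    mem_centralizer_iff.mp (hZdef ▸ hz) r hr
  have hZle : Z ≤ R := hZdef ▸ hR
  have hconj : ∀ x y : G, x * y * x⁻¹ = ⁅x, y⁆ * y := fun x y => by
    rw [commutatorElement_def]; group
  rw [← hZdef] at hRR hg
  -- The elements acting trivially on `R/Z`. They form a normal subgroup which is shown to be
  -- nilpotent of class at most two, hence lies in `R`.
  let T : Subgroup G := (centralizer ((R.map (QuotientGroup.mk' Z) : Subgroup (G ⧸ Z)) :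
    Set (G ⧸ Z))).comap (QuotientGroup.mk' Z)
  have hTmem : ∀ x, x ∈ T ↔ ∀ r ∈ R, ⁅x, r⁆ ∈ Z := by
    intro x
    constructor
    · intro hx r hr
      have h1 := mem_centralizer_iff.mp (mem_comap.mp hx) _ (mem_map_of_mem _ hr)
      rw [← QuotientGroup.eq_one_iff]
      change QuotientGroup.mk' Z ⁅x, r⁆ = 1
      rw [map_commutatorElement]
      exact commutatorElement_eq_one_iff_mul_comm.mpr h1.symm
    · intro hx
      refine mem_comap.mpr (mem_centralizer_iff.mpr ?_)
      rintro _ ⟨r, hr, rfl⟩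
      have h1 := (QuotientGroup.eq_one_iff _).mpr (hx r hr)
      change QuotientGroup.mk' Z ⁅x, r⁆ = 1 at h1
      rw [map_commutatorElement] at h1
      exact (commutatorElement_eq_one_iff_mul_comm.mp h1).symm
  have hRn : (R.map (QuotientGroup.mk' Z)).Normal :=
    Normal.map inferInstance _ (QuotientGroup.mk'_surjective Z)
  have hTn : T.Normal := inferInstance
  -- Conjugation by `x` multiplies `a` and `b` by central elements, so it fixes `⁅a, b⁆`, a
  -- nontrivial element of `Z`. Since `Z` has rank one, it then fixes all of `Z`.
  have hTZ : ∀ x ∈ T, ∀ z ∈ Z, x * z = z * x := by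
    intro x hx z hz
    have hc1 : ⁅a, b⁆ ≠ 1 := fun h => hab (commutatorElement_eq_one_iff_mul_comm.mp h)
    have hc : x * ⁅a, b⁆ * x⁻¹ = ⁅a, b⁆ := by
      rw [conjugate_commutatorElement, hconj, hconj]
      have h1 := (hTmem x).mp hx a ha
      have h2 := (hTmem x).mp hx b hb
      generalize ⁅x, a⁆ = z1 at h1
      generalize ⁅x, b⁆ = z2 at h2
      have hcomm : ∀ z ∈ Z, ∀ r ∈ R, Commute z r := fun z hz r hr => (hZR z hz r hr).symm
      have e1 : Commute z1 (z2 * b) := (hcomm z1 h1 _ (hZle h2)).mul_right (hcomm z1 h1 b hb)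
      have e2 : Commute z2 a := hcomm z2 h2 a ha
      calc z1 * a * (z2 * b) * (z1 * a)⁻¹ * (z2 * b)⁻¹
          = z1 * (a * z2) * b * a⁻¹ * z1⁻¹ * (z2 * b)⁻¹ := by group
        _ = z1 * (z2 * a) * b * a⁻¹ * (z1⁻¹ * (z2 * b)⁻¹) := by rw [← e2.eq]; group
        _ = z1 * (z2 * a) * b * a⁻¹ * ((z2 * b)⁻¹ * z1⁻¹) := by rw [e1.inv_inv.eq]
        _ = z1 * (z2 * (a * b * a⁻¹ * b⁻¹) * z2⁻¹) * z1⁻¹ := by group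
        _ = a * b * a⁻¹ * b⁻¹ := by
          have hr : a * b * a⁻¹ * b⁻¹ ∈ R := hZle (hRR a ha b hb)
          rw [(hcomm z2 h2 _ hr).eq, mul_inv_cancel_right, (hcomm z1 h1 _ hr).eq,
            mul_inv_cancel_right]
    obtain ⟨k, hk, j, hj⟩ := exists_pow_eq_zpow_of_centralizer ht hR hZ
      (hZdef ▸ hRR a ha b hb) hc1 (hZdef ▸ hz)
    have h3 : (x * z * x⁻¹) ^ k = z ^ k := by
      rw [conj_pow, ← hj, ← conj_zpow, hc]
    refine mul_inv_eq_iff_eq_mul.mp (pow_left_injective_of_comm (B := Z)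
      (fun a ha b hb => hZR b hb a (hZle ha)) (fun b _ => ht b) (Normal.conj_mem hZn z hz x) hz hk h3)
  -- Both `x` and `y` act on `r` through central factors, which commute; so `x * y` and `y * x` move
  -- `r` in the same way and `⁅x, y⁆` centralizes `R`.
  have hTT : ∀ x ∈ T, ∀ y ∈ T, ⁅x, y⁆ ∈ Z := by
    intro x hx y hy
    rw [hZdef]
    refine mem_centralizer_iff.mpr fun r hr => ?_
    have h1 := (hTmem x).mp hx r hr
    have h2 := (hTmem y).mp hy r hr
    have hx' := hconj x r
    have hy' := hconj y r
    generalize ⁅x, r⁆ = z1 at h1 hx'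
    generalize ⁅y, r⁆ = z2 at h2 hy'
    have hxr : x * r = z1 * r * x := by rw [← hx', inv_mul_cancel_right]
    have hyr : y * r = z2 * r * y := by rw [← hy', inv_mul_cancel_right]
    have h3 : x * y * r = z1 * z2 * r * (x * y) := by
      rw [mul_assoc, hyr, ← mul_assoc, ← mul_assoc, hTZ x hx z2 h2, mul_assoc z2, hxr, ← mul_assoc,
        ← mul_assoc, hZR z1 h1 z2 (hZle h2)]
      simp only [mul_assoc]
    have h4 : y * x * r = z1 * z2 * r * (y * x) := by
      rw [mul_assoc, hxr, ← mul_assoc, ← mul_assoc, hTZ y hy z1 h1, mul_assoc z1, hyr]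
      simp only [mul_assoc]
    have h5 : ⁅x, y⁆ * (y * x) = x * y := by rw [commutatorElement_def]; group
    have h6 : ⁅x, y⁆ * (z1 * z2 * r) = z1 * z2 * r * ⁅x, y⁆ := by
      refine mul_right_cancel (b := y * x) ?_
      rw [mul_assoc _ _ (y * x), ← h4, ← mul_assoc, h5, h3, mul_assoc _ _ (y * x), h5]
    have hcT : ⁅x, y⁆ ∈ T := by
      rw [commutatorElement_def]
      exact T.mul_mem (T.mul_mem (T.mul_mem hx hy) (T.inv_mem hx)) (T.inv_mem hy)
    rw [← mul_assoc, hTZ _ hcT _ (Z.mul_mem h1 h2), mul_assoc, mul_assoc (z1 * z2), mul_right_inj] at h6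
    exact h6.symm
  have : Group.IsNilpotent T := by
    refine isNilpotent_of_commutator fun x y z w => ?_
    have h1 : ⁅⁅x, y⁆, z⁆ = 1 := Subtype.ext
      (commutatorElement_eq_one_iff_mul_comm.mpr (hTZ z z.2 _ (hTT x x.2 y y.2)).symm)
    rw [h1, commutatorElement_one_left]
  exact hnil T hTn this ((hTmem g).mpr hg)

end Nonabelian

section Nonabelian

variable {G : Type u} [Group G] {R : Subgroup G}

theorem centralizer_eq_map_center (hR : centralizer (R : Set G) ≤ R) :
    (center R).map R.subtype = centralizer (R : Set G) := by
  ext z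
  constructor
  · rintro ⟨z, hz, rfl⟩
    exact mem_centralizer_iff.mpr fun r hr => Subtype.ext_iff.mp (mem_center_iff.mp hz ⟨r, hr⟩)
  · intro hz
    exact ⟨⟨z, hR hz⟩, mem_center_iff.mpr fun r => Subtype.ext (mem_centralizer_iff.mp hz r r.2), rfl⟩

theorem ker_subgroupMap_mk_centralizer [(centralizer (R : Set G)).Normal] :
    ((QuotientGroup.mk' (centralizer (R : Set G))).subgroupMap R).ker = center R := by
  ext r
  rw [MonoidHom.mem_ker, mem_center_iff]
  constructor
  · intro h x
    have h1 : ((r : G) : G ⧸ centralizer (R : Set G)) = 1 := Subtype.ext_iff.mp h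
    exact Subtype.ext (mem_centralizer_iff.mp ((QuotientGroup.eq_one_iff _).mp h1) x x.2)
  · intro h
    refine Subtype.ext ((QuotientGroup.eq_one_iff _).mpr ?_)
    exact mem_centralizer_iff.mpr fun x hx => Subtype.ext_iff.mp (h ⟨x, hx⟩)

/-- A torsion-free group whose Fitting subgroup `R` is nonabelian of rank three and has torsion quotient:
the quotient is a finite abelian group and `R` has class two. -/
theorem quotient_of_nonabelian_rank_three [R.Normal] (ht : TorsionFree G) [Group.IsNilpotent R]
    (hR : centralizer (R : Set G) ≤ R)
    (hnil : ∀ N : Subgroup G, N.Normal → Group.IsNilpotent N → N ≤ R) (h3 : HasRank R 3)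
    (htor : ∀ g : G, ∃ k, 0 < k ∧ g ^ k ∈ R) {x₀ y₀ : R} (hxy : x₀ * y₀ ≠ y₀ * x₀) :
    (∀ x y : G, ⁅x, y⁆ ∈ R) ∧ (∀ a ∈ R, ∀ b ∈ R, ⁅a, b⁆ ∈ centralizer (R : Set G)) ∧
      Finite (G ⧸ R) := by
  have htR := ht.subgroup R
  obtain ⟨m, n, hm, hn, hmn, hcen, hquo⟩ := HasRank.split_center (n := 3) h3 htR hxy
  obtain rfl : m = 1 := by omega
  obtain rfl : n = 2 := by omega
  obtain ⟨Z, hZdef⟩ : ∃ Z, Z = centralizer (R : Set G) := ⟨_, rfl⟩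
  have hZr : HasRank Z 1 := by
    rw [hZdef, ← centralizer_eq_map_center hR]
    exact HasRank.of_equiv ((center R).equivMapOfInjective R.subtype R.subtype_injective) hcen
  have hZn : Z.Normal := hZdef ▸ (inferInstance : (centralizer (R : Set G)).Normal)
  have hZle : Z ≤ R := hZdef ▸ hR
  have hZR : ∀ z ∈ Z, ∀ r ∈ R, r * z = z * r := fun z hz r hr =>
    mem_centralizer_iff.mp (hZdef ▸ hz) r hr
  have hZc : ∀ a ∈ Z, ∀ b ∈ Z, a * b = b * a := fun a ha b hb => hZR b hb a (hZle ha)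
  let π := QuotientGroup.mk' Z
  have hπ : ∀ g, π g = 1 ↔ g ∈ Z := fun g => QuotientGroup.eq_one_iff g
  let A : Subgroup (G ⧸ Z) := R.map π
  have hAn : A.Normal := Normal.map inferInstance _ (QuotientGroup.mk'_surjective Z)
  have hmemA : ∀ g, π g ∈ A ↔ g ∈ R := by
    intro g
    refine ⟨?_, fun h => mem_map_of_mem _ h⟩
    rintro ⟨r, hr, h⟩
    have : r⁻¹ * g ∈ Z := QuotientGroup.eq.mp h
    simpa using R.mul_mem hr (hZle this)
  have e : R ⧸ center R ≃* A := by
    subst hZdef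
    exact (QuotientGroup.quotientMulEquivOfEq ker_subgroupMap_mk_centralizer.symm).trans
      (QuotientGroup.quotientKerEquivOfSurjective _ (MonoidHom.subgroupMap_surjective π R))
  have hAr : HasRank A 2 := HasRank.of_equiv e hquo
  have htA : TorsionFree A := htR.quotient_center.of_injective e.symm.toMonoidHom e.symm.injective
  have hAc : ∀ a ∈ A, ∀ b ∈ A, a * b = b * a := by
    intro a ha b hb
    have h1 := HasRank.comm_of_le_two hquo le_rfl htR.quotient_center (e.symm ⟨a, ha⟩) (e.symm ⟨b, hb⟩)
    rw [← map_mul, ← map_mul] at h1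
    exact Subtype.ext_iff.mp (e.symm.injective h1)
  have hRR : ∀ a ∈ R, ∀ b ∈ R, ⁅a, b⁆ ∈ Z := by
    intro a ha b hb
    rw [← hπ, map_commutatorElement]
    exact commutatorElement_eq_one_iff_mul_comm.mpr
      (hAc _ (mem_map_of_mem π ha) _ (mem_map_of_mem π hb))
  obtain ⟨V, _, _, _, hV, ⟨S⟩⟩ := exists_ratRep A hAc htA (n := 2) hAr
  have hρ : ∀ g : G, S.ρ (π g) = 1 ↔ g ∈ R := by
    intro g
    rw [S.ρ_eq_one_iff]
    constructor
    · intro h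
      refine mem_of_commutator_mem_centralizer ht hR hnil (hZdef ▸ hZr) (hZdef ▸ hRR) x₀.2 y₀.2
        (fun h => hxy (Subtype.ext h)) fun r hr => ?_
      rw [← hZdef, ← hπ, map_commutatorElement]
      exact commutatorElement_eq_one_iff_mul_comm.mpr
        (mem_centralizer_iff.mp h _ (mem_map_of_mem π hr)).symm
    · intro h
      exact mem_centralizer_iff.mpr fun a ha => hAc a ha _ (mem_map_of_mem π h)
  have hA : ∀ g, S.ρ g = 1 ↔ g ∈ A := by
    intro g
    obtain ⟨g, rfl⟩ := QuotientGroup.mk'_surjective Z g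
    exact (hρ g).trans (hmemA g).symm
  have hconj : ∀ x y : G, x * y * x⁻¹ = ⁅x, y⁆ * y := fun x y => by
    rw [commutatorElement_def]; group
  -- If a reflection lifted to an involution of `G/Z`, then `g ^ 2 ∈ Z`. But `g` inverts the
  -- commutator of lifts of its two eigenvectors, hence inverts a power of `g ^ 2`, with which it
  -- also commutes.
  have hrefl : ∀ g, LinearMap.det (S.ρ g) = -1 → g ^ 2 ≠ 1 := by
    intro g hd hg2
    obtain ⟨g, rfl⟩ := QuotientGroup.mk'_surjective Z g
    change LinearMap.det (S.ρ (π g)) = -1 at hd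
    have hg2' : g ^ 2 ∈ Z := by rwa [← hπ, map_pow]
    have hff : S.ρ (π g) * S.ρ (π g) = 1 := by
      rw [← map_mul, ← pow_two, ← map_pow, (hρ _).mpr (hZle hg2')]
    have hfne : S.ρ (π g) ≠ 1 := fun h => by
      rw [h, map_one] at hd
      norm_num at hd
    have hfne' : S.ρ (π g) ≠ -1 := fun h => by
      rw [h, ← neg_one_smul ℚ, LinearMap.det_smul, hV, map_one] at hd
      norm_num at hd
    generalize hfdef : S.ρ (π g) = f at *
    obtain ⟨v, hv⟩ : ∃ v, v + f v ≠ 0 := by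
      by_contra! hall
      exact hfne' (LinearMap.ext fun v => by
        rw [LinearMap.neg_apply, Module.End.one_apply]
        exact (neg_eq_of_add_eq_zero_right (hall v)).symm)
    obtain ⟨u, hu⟩ : ∃ u, u - f u ≠ 0 := by
      by_contra! hall
      exact hfne (LinearMap.ext fun v => (sub_eq_zero.mp (hall v)).symm)
    have hlift : ∀ v : V, v ≠ 0 → ∃ a ∈ R, ∃ k : ℕ, S.ι (π a) = k • v ∧ S.ι (π a) ≠ 0 := by
      intro v hv
      obtain ⟨k, hk, _, ⟨a, ha, rfl⟩, h⟩ := S.dense v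
      refine ⟨a, ha, k, h, ?_⟩
      rw [h, ← Nat.cast_smul_eq_nsmul ℚ]
      exact smul_ne_zero (by positivity) hv
    obtain ⟨a, ha, k, hak, ha0⟩ := hlift _ hv
    obtain ⟨b, hb, l, hbl, hb0⟩ := hlift _ hu
    have hfa : f (S.ι (π a)) = S.ι (π a) := by
      rw [hak, map_nsmul, map_add, End.mul_apply_eq hff, Module.End.one_apply, add_comm]
    have hfb : f (S.ι (π b)) = -S.ι (π b) := by
      rw [hbl, map_nsmul, map_sub, End.mul_apply_eq hff, Module.End.one_apply, ← smul_neg, neg_sub]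
    have hli : ∀ p q : ℚ, p • S.ι (π a) + q • S.ι (π b) = 0 → p = 0 ∧ q = 0 := by
      intro p q hpq
      have h1 := congrArg f hpq
      rw [map_add, map_smul, map_smul, hfa, hfb, map_zero, smul_neg] at h1
      have h2 : (2 * p) • S.ι (π a) = 0 := by
        rw [mul_smul, two_smul]
        calc p • S.ι (π a) + p • S.ι (π a) = (p • S.ι (π a) + q • S.ι (π b)) +
              (p • S.ι (π a) + -(q • S.ι (π b))) := by abel
          _ = 0 := by rw [hpq, h1, add_zero]
      have hp : p = 0 := by
        have := (smul_eq_zero.mp h2).resolve_right ha0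
        linarith
      rw [hp, zero_smul, zero_add] at hpq
      exact ⟨hp, (smul_eq_zero.mp hpq).resolve_right hb0⟩
    -- The images of `a` and `b` span the plane, so if they commuted, `a` would commute with a power
    -- of every element of `R`, hence be central and have zero image.
    have hab : ⁅a, b⁆ ≠ 1 := by
      intro hab
      have hab' : Commute a b := commutatorElement_eq_one_iff_mul_comm.mp hab
      have hac : a ∈ Z := by
        rw [hZdef]
        refine mem_centralizer_iff.mpr fun r hr => ?_
        have hind : LinearIndependent ℚ ![S.ι (π a), S.ι (π b)] := LinearIndependent.pair_iff.mpr hli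
        have htop := hind.span_eq_top_of_card_eq_finrank (by simp [hV])
        have hv : S.ι (π r) ∈ Submodule.span ℚ (Set.range ![S.ι (π a), S.ι (π b)]) :=
          htop ▸ Submodule.mem_top
        rw [Matrix.range_cons, Matrix.range_cons, Matrix.range_empty, Set.union_empty,
          Set.singleton_union, Submodule.mem_span_pair] at hv
        obtain ⟨p, q, hpq⟩ := hv
        have hn : 0 < p.den * q.den := Nat.mul_pos p.den_pos q.den_pos
        have hpow : (π r) ^ (p.den * q.den) =
            (π a) ^ (p.num * q.den) * (π b) ^ (q.num * p.den) := by
          have hra := (hmemA r).mpr hr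
          have haa := (hmemA a).mpr ha
          have hbb := (hmemA b).mpr hb
          refine S.ι_injOn (A.pow_mem hra _) (A.mul_mem (A.zpow_mem haa _) (A.zpow_mem hbb _)) ?_
          rw [S.ι_pow hra, S.ι_mul _ (A.zpow_mem haa _) _ (A.zpow_mem hbb _), S.ι_zpow haa,
            S.ι_zpow hbb, ← hpq, ← Nat.cast_smul_eq_nsmul ℚ, ← Int.cast_smul_eq_zsmul ℚ,
            ← Int.cast_smul_eq_zsmul ℚ, smul_add, smul_smul, smul_smul]
          have e1 : (p.den : ℚ) * p = p.num := Rat.den_mul_eq_num p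
          have e2 : (q.den : ℚ) * q = q.num := Rat.den_mul_eq_num q
          push_cast
          rw [← e1, ← e2]
          congr 2 <;> ring
        have hz : (a ^ (p.num * q.den) * b ^ (q.num * p.den))⁻¹ * r ^ (p.den * q.den) ∈ Z := by
          rw [← hπ, map_mul, map_inv, map_mul, map_zpow, map_zpow, map_pow, hpow, inv_mul_cancel]
        obtain ⟨z, hzdef⟩ : ∃ z, z = (a ^ (p.num * q.den) * b ^ (q.num * p.den))⁻¹ *
          r ^ (p.den * q.den) := ⟨_, rfl⟩
        rw [← hzdef] at hz
        have hrz : r ^ (p.den * q.den) = a ^ (p.num * q.den) * b ^ (q.num * p.den) * z := by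
          rw [hzdef, mul_inv_cancel_left]
        have hcom : Commute a (r ^ (p.den * q.den)) := by
          rw [hrz]
          exact (((Commute.refl a).zpow_right _).mul_right (hab'.zpow_right _)).mul_right
            (hZR z hz a ha)
        have h4 := htR.pow_left_injective (p.den * q.den) hn ⟨a * r * a⁻¹,
          R.mul_mem (R.mul_mem ha hr) (R.inv_mem ha)⟩ ⟨r, hr⟩ (Subtype.ext (by
            change (a * r * a⁻¹) ^ _ = r ^ _
            rw [conj_pow, hcom.eq, mul_inv_cancel_right]))
        exact (mul_inv_eq_iff_eq_mul.mp (Subtype.ext_iff.mp h4 :)).symm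
      exact ha0 (by rw [(hπ a).mpr hac, S.ι_one])
    have hcZ := hRR a ha b hb
    have hga : ∃ z ∈ Z, g * a * g⁻¹ = z * a := by
      rw [← hfdef, ← S.ι_conj _ _ ((hmemA a).mpr ha)] at hfa
      have h1 := S.ι_injOn (Normal.conj_mem hAn _ ((hmemA a).mpr ha) _) ((hmemA a).mpr ha) hfa
      refine ⟨g * a * g⁻¹ * a⁻¹, ?_, by group⟩
      rw [← hπ, map_mul, map_mul, map_mul, map_inv, h1, map_inv, mul_inv_cancel]
    have hgb : ∃ z ∈ Z, g * b * g⁻¹ = z * b⁻¹ := by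
      rw [← hfdef, ← S.ι_conj _ _ ((hmemA b).mpr hb), ← S.ι_inv ((hmemA b).mpr hb)] at hfb
      have h1 := S.ι_injOn (Normal.conj_mem hAn _ ((hmemA b).mpr hb) _)
        (A.inv_mem ((hmemA b).mpr hb)) hfb
      refine ⟨g * b * g⁻¹ * b, ?_, by group⟩
      rw [← hπ, map_mul, map_mul, map_mul, map_inv, h1, inv_mul_cancel]
    obtain ⟨z1, hz1, hga⟩ := hga
    obtain ⟨z2, hz2, hgb⟩ := hgb
    have hcomm : ∀ z ∈ Z, ∀ r ∈ R, Commute z r := fun z hz r hr => (hZR z hz r hr).symm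
    have hgc : g * ⁅a, b⁆ * g⁻¹ = ⁅a, b⁆⁻¹ := by
      rw [conjugate_commutatorElement, hga, hgb]
      have e1 : Commute z1 (z2 * b⁻¹) :=
        (hcomm z1 hz1 _ (hZle hz2)).mul_right (hcomm z1 hz1 _ (R.inv_mem hb))
      have e2 : Commute z2 a := hcomm z2 hz2 a ha
      have hr : a * b⁻¹ * a⁻¹ * b ∈ R :=
        R.mul_mem (R.mul_mem (R.mul_mem ha (R.inv_mem hb)) (R.inv_mem ha)) hb
      have e3 : Commute (⁅a, b⁆⁻¹) b⁻¹ := hcomm _ (Z.inv_mem hcZ) _ (R.inv_mem hb)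
      calc z1 * a * (z2 * b⁻¹) * (z1 * a)⁻¹ * (z2 * b⁻¹)⁻¹
          = z1 * (a * z2) * b⁻¹ * a⁻¹ * z1⁻¹ * (z2 * b⁻¹)⁻¹ := by group
        _ = z1 * (z2 * a) * b⁻¹ * a⁻¹ * (z1⁻¹ * (z2 * b⁻¹)⁻¹) := by rw [← e2.eq]; group
        _ = z1 * (z2 * a) * b⁻¹ * a⁻¹ * ((z2 * b⁻¹)⁻¹ * z1⁻¹) := by rw [e1.inv_inv.eq]
        _ = z1 * (z2 * (a * b⁻¹ * a⁻¹ * b) * z2⁻¹) * z1⁻¹ := by group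
        _ = a * b⁻¹ * a⁻¹ * b := by
          rw [(hcomm z2 hz2 _ hr).eq, mul_inv_cancel_right, (hcomm z1 hz1 _ hr).eq,
            mul_inv_cancel_right]
        _ = b⁻¹ * ⁅a, b⁆⁻¹ * b := by rw [commutatorElement_def]; group
        _ = ⁅a, b⁆⁻¹ := by rw [← e3.eq, inv_mul_cancel_right]
    -- `Z` has rank one, so some `(g ^ 2) ^ n` is a power of `⁅a, b⁆` and is inverted by `g`. Hence
    -- `g` has finite order and is trivial.
    obtain ⟨n, hn, j, hj⟩ := exists_pow_eq_zpow_of_centralizer ht hR (hZdef ▸ hZr) (hZdef ▸ hcZ) hab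
      (hZdef ▸ hg2')
    have h5 : g * (g ^ 2) ^ n * g⁻¹ = ((g ^ 2) ^ n)⁻¹ := by
      rw [← hj, ← conj_zpow, hgc, inv_zpow]
    have h6 : g * (g ^ 2) ^ n * g⁻¹ = (g ^ 2) ^ n := by
      rw [((Commute.refl g).pow_right 2 |>.pow_right n).eq, mul_inv_cancel_right]
    rw [h6] at h5
    have h7 : g ^ (2 * n * 2) = 1 := by
      rw [pow_mul, pow_mul, pow_two]
      nth_rewrite 1 [h5]
      exact inv_mul_cancel _
    have h8 := ht.eq_one_of_pow (by omega) h7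
    refine hfne ?_
    rw [← hfdef, h8, map_one, map_one]
  have htor' : ∀ g : G ⧸ Z, ∃ k, 0 < k ∧ g ^ k ∈ A := by
    intro g
    obtain ⟨g, rfl⟩ := QuotientGroup.mk'_surjective Z g
    obtain ⟨k, hk, h⟩ := htor g
    exact ⟨k, hk, (hmemA _).mpr h⟩
  refine ⟨fun x y => ?_, hZdef ▸ hRR, ?_⟩
  · rw [← hρ, map_commutatorElement]
    have h1 := S.commute_of_reflections hV hA htor' hrefl (π x) (π y)
    rw [commutatorElement_def, map_mul, map_mul, map_mul, h1, mul_assoc (S.ρ (π y)), S.ρ_mul_inv,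
      mul_one, S.ρ_mul_inv]
  · let ρ : G ⧸ R →* Module.End ℚ V := QuotientGroup.lift R (S.ρ.comp π) fun g hg => (hρ g).mpr hg
    refine finite_of_periodic_of_finrank_two hV ρ (fun f hf => ?_) fun f => ?_
    · obtain ⟨g, rfl⟩ := QuotientGroup.mk_surjective f
      exact (QuotientGroup.eq_one_iff g).mpr ((hρ g).mp hf)
    · obtain ⟨g, rfl⟩ := QuotientGroup.mk_surjective f
      obtain ⟨k, hk, h⟩ := htor g
      exact isOfFinOrder_iff_pow_eq_one.mpr ⟨k, hk, (QuotientGroup.eq_one_iff _).mpr h⟩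

end Nonabelian

/-! ### Elements of finite order in dimension three with a fixed line -/

section Quotient

variable {V : Type v} [AddCommGroup V] [Module ℚ V]

/-- In a basis adapted to `W` the matrix of `f` is block triangular. -/
theorem trace_eq_trace_add_trace [FiniteDimensional ℚ V] (W : Submodule ℚ V) (f : Module.End ℚ V)
    (hf : W ≤ W.comap f) : LinearMap.trace ℚ V f =
      LinearMap.trace ℚ W (f.restrict hf) + LinearMap.trace ℚ (V ⧸ W) (W.mapQ W f hf) := by
  let bW := Module.Free.chooseBasis ℚ W
  let bQ := Module.Free.chooseBasis ℚ (V ⧸ W)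
  rw [LinearMap.trace_eq_matrix_trace ℚ (Module.Basis.sumQuot bW bQ),
    LinearMap.trace_eq_matrix_trace ℚ bW, LinearMap.trace_eq_matrix_trace ℚ bQ, Matrix.trace,
    Matrix.trace, Matrix.trace, Fintype.sum_sum_type]
  congr 1
  · refine Finset.sum_congr rfl fun i _ => ?_
    simp only [Matrix.diag_apply, LinearMap.toMatrix_apply, Module.Basis.sumQuot_inl]
    exact Module.Basis.sumQuot_repr_inl_of_mem bW bQ _ (hf (bW i).2) i
  · refine Finset.sum_congr rfl fun i _ => ?_
    simp only [Matrix.diag_apply, LinearMap.toMatrix_apply, Module.Basis.sumQuot_repr_inr]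
    rw [← Module.Basis.sumQuot_inr bW bQ i, Submodule.mapQ_apply, Submodule.mkQ_apply]

/-- An endomorphism of finite order which acts trivially on an invariant subspace and on the quotient
is the identity. -/
theorem eq_one_of_restrict_of_mapQ [FiniteDimensional ℚ V] {W : Submodule ℚ V} {f : Module.End ℚ V}
    {k : ℕ} (hk : 0 < k) (hfk : f ^ k = 1) (hW : ∀ w ∈ W, f w = w) (hQ : ∀ v, f v - v ∈ W) :
    f = 1 := by
  refine eq_one_of_unipotent hk hfk ⟨2, ?_⟩
  ext v
  rw [pow_two, Module.End.mul_apply, LinearMap.sub_apply f, LinearMap.sub_apply f,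
    Module.End.one_apply, Module.End.one_apply, hW _ (hQ v), sub_self, LinearMap.zero_apply]

end Quotient

theorem sq_eq_one_of_trace_eq_neg_two {V : Type v} [AddCommGroup V] [Module ℚ V]
    (hV : Module.finrank ℚ V = 2) {f : Module.End ℚ V} {k : ℕ} (hk : 0 < k) (hf : f ^ k = 1)
    (hd : LinearMap.det f = 1) (ht : LinearMap.trace ℚ V f = -2) : f ^ 2 = 1 := by
  rw [eq_neg_one_of_trace_eq_neg_two hV hk hf hd ht, neg_sq, one_pow]

section Dimension3

variable {V : Type v} [AddCommGroup V] [Module ℚ V]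

/-- An endomorphism of finite order of a three-dimensional space with a fixed vector. -/
structure FixedData (f : Module.End ℚ V) where
  W : Submodule ℚ V
  le : W ≤ W.comap f
  fix : ∀ w ∈ W, f w = w
  finrank : Module.finrank ℚ W = 1

variable {f : Module.End ℚ V}

def FixedData.span {c : V} (hc : c ≠ 0) (hf : f c = c) : FixedData f where
  W := Submodule.span ℚ {c}
  le := by
    rw [Submodule.span_singleton_le_iff_mem]
    change f c ∈ Submodule.span ℚ {c}
    rw [hf]
    exact Submodule.mem_span_singleton_self c
  fix := by
    intro w hw
    obtain ⟨a, rfl⟩ := Submodule.mem_span_singleton.mp hw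
    rw [map_smul, hf]
  finrank := finrank_span_singleton hc

namespace FixedData

variable (D : FixedData f)

/-- The induced endomorphism of the two-dimensional quotient. -/
def bar : Module.End ℚ (V ⧸ D.W) := D.W.mapQ D.W f D.le

theorem bar_mk (v : V) : D.bar (D.W.mkQ v) = D.W.mkQ (f v) := rfl

theorem finrank_quotient (hV : Module.finrank ℚ V = 3) : Module.finrank ℚ (V ⧸ D.W) = 2 := by
  have := Module.finite_of_finrank_eq_succ hV
  have h := D.W.finrank_quotient_add_finrank
  rw [D.finrank, hV] at h
  omega

theorem restrict_eq_one : f.restrict D.le = 1 :=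
  LinearMap.ext fun w => Subtype.ext (D.fix w w.2)

theorem trace_eq (hV : Module.finrank ℚ V = 3) :
    LinearMap.trace ℚ V f = 1 + LinearMap.trace ℚ (V ⧸ D.W) D.bar := by
  have := Module.finite_of_finrank_eq_succ hV
  rw [trace_eq_trace_add_trace D.W f D.le, D.restrict_eq_one, LinearMap.trace_one, D.finrank,
    Nat.cast_one]
  rfl

theorem bar_pow (k : ℕ) (v : V) : (D.bar ^ k) (D.W.mkQ v) = D.W.mkQ ((f ^ k) v) := by
  induction k generalizing v with
  | zero => rfl
  | succ k ih => rw [pow_succ, Module.End.mul_apply, D.bar_mk, ih, pow_succ, Module.End.mul_apply]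

theorem bar_pow_eq_one {k : ℕ} (hfk : f ^ k = 1) : D.bar ^ k = 1 := by
  ext v
  change (D.bar ^ k) (D.W.mkQ v) = D.W.mkQ v
  rw [D.bar_pow, hfk, Module.End.one_apply]

theorem pow_eq_one_of_bar_pow [FiniteDimensional ℚ V] {k n : ℕ} (hk : 0 < k) (hfk : f ^ k = 1)
    (h : D.bar ^ n = 1) : f ^ n = 1 := by
  refine eq_one_of_restrict_of_mapQ (W := D.W) hk (by rw [← pow_mul, mul_comm, pow_mul, hfk, one_pow])
    (fun w hw => ?_) fun v => ?_
  · clear h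
    induction n with
    | zero => rfl
    | succ n ih => rw [pow_succ, Module.End.mul_apply, D.fix w hw, ih]
  · rw [← Submodule.Quotient.mk_eq_zero, Submodule.Quotient.mk_sub, sub_eq_zero]
    change D.W.mkQ ((f ^ n) v) = D.W.mkQ v
    rw [← D.bar_pow, h, Module.End.one_apply]

theorem eq_one_of_bar [FiniteDimensional ℚ V] {k : ℕ} (hk : 0 < k) (hfk : f ^ k = 1)
    (h : D.bar = 1) : f = 1 := by
  have := D.pow_eq_one_of_bar_pow (n := 1) hk hfk (by rw [h, one_pow])
  rwa [pow_one] at this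

end FixedData

theorem exists_trace_eq_of_fixed (hV : Module.finrank ℚ V = 3) (D : FixedData f) {k : ℕ}
    (hk : 0 < k) (hfk : f ^ k = 1) : ∃ m : ℤ, (-1 ≤ m ∧ m ≤ 3) ∧ LinearMap.trace ℚ V f = m := by
  have hb := D.bar_pow_eq_one hfk
  have hQ := D.finrank_quotient hV
  rcases det_of_pow_eq_one hk hb with hd | hd
  · obtain ⟨m, hm, h⟩ := exists_trace_eq_of_pow_eq_one hQ hk hb hd
    rw [abs_le] at hm
    exact ⟨1 + m, by omega, by rw [D.trace_eq hV, h]; push_cast; rfl⟩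
  · refine ⟨1, by norm_num, ?_⟩
    rw [D.trace_eq hV, trace_eq_zero_of_det_eq_neg_one hQ hk hb hd, add_zero, Int.cast_one]

theorem eq_one_of_trace_eq_three (hV : Module.finrank ℚ V = 3) (D : FixedData f) {k : ℕ}
    (hk : 0 < k) (hfk : f ^ k = 1) (h : LinearMap.trace ℚ V f = 3) : f = 1 := by
  have := Module.finite_of_finrank_eq_succ hV
  have hb := D.bar_pow_eq_one hfk
  have hQ := D.finrank_quotient hV
  rw [D.trace_eq hV] at h
  have h2 : LinearMap.trace ℚ _ D.bar = 2 := by linarith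
  rcases det_of_pow_eq_one hk hb with hd | hd
  · exact D.eq_one_of_bar hk hfk (eq_one_of_trace_eq_two hQ hk hb hd h2)
  · rw [trace_eq_zero_of_det_eq_neg_one hQ hk hb hd] at h2
    norm_num at h2

theorem pow_twelve_eq_one_of_fixed (hV : Module.finrank ℚ V = 3) (D : FixedData f) {k : ℕ}
    (hk : 0 < k) (hfk : f ^ k = 1) : f ^ 12 = 1 := by
  have := Module.finite_of_finrank_eq_succ hV
  have hb := D.bar_pow_eq_one hfk
  have hQ := D.finrank_quotient hV
  refine D.pow_eq_one_of_bar_pow hk hfk ?_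
  rcases det_of_pow_eq_one hk hb with hd | hd
  · obtain ⟨m, hm, h⟩ := exists_trace_eq_of_pow_eq_one hQ hk hb hd
    by_cases h2 : m = 2
    · rw [eq_one_of_trace_eq_two hQ hk hb hd (by rw [h, h2]; norm_num), one_pow]
    by_cases h2' : m = -2
    · rw [show 12 = 2 * 6 by norm_num, pow_mul, sq_eq_one_of_trace_eq_neg_two hQ hk hb hd
        (by rw [h, h2']; norm_num), one_pow]
    · refine pow_twelve_eq_one hQ hd (m := m) ?_ h
      rw [abs_le] at hm ⊢
      omega
  · rw [show 12 = 2 * 6 by norm_num, pow_mul, sq_eq_one_of_det_eq_neg_one hQ hk hb hd, one_pow]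

/-- On the quotient plane the trace `m` satisfies `m ^ 3 - 3 m = 2`, so `m` is `2` or `-1`. The
value 2 would make `f` the identity, and the fixed line contributes 1. -/
theorem trace_eq_zero_of_pow_three (hV : Module.finrank ℚ V = 3) (D : FixedData f)
    (hf3 : f ^ 3 = 1) (hf1 : f ≠ 1) : LinearMap.trace ℚ V f = 0 := by
  have := Module.finite_of_finrank_eq_succ hV
  have h3 : 0 < 3 := by norm_num
  have hb := D.bar_pow_eq_one hf3
  have hQ := D.finrank_quotient hV
  have hd : LinearMap.det D.bar = 1 := by
    refine (det_of_pow_eq_one h3 hb).resolve_right fun h => ?_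
    have := congrArg LinearMap.det hb
    rw [map_pow, h, map_one] at this
    norm_num at this
  obtain ⟨m, hm, h⟩ := exists_trace_eq_of_pow_eq_one hQ h3 hb hd
  have ht := trace_pow_add_two hQ hd 1
  have ht2 := trace_pow_add_two hQ hd 0
  simp only [zero_add, pow_one, pow_zero, show 1 + 2 = 3 from rfl, show 1 + 1 = 2 from rfl, hb,
    LinearMap.trace_one, hQ, h] at ht ht2
  rw [ht2] at ht
  have ht3 : (2 : ℤ) = m * (m * m - 2) - m := by exact_mod_cast ht
  have hm2 : m ≠ 2 := fun h2 => hf1 (D.eq_one_of_bar h3 hf3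
    (eq_one_of_trace_eq_two hQ h3 hb hd (by rw [h, h2]; norm_num)))
  obtain ⟨hm1, hm2'⟩ := abs_le.mp hm
  obtain rfl | rfl | rfl | rfl : m = -2 ∨ m = -1 ∨ m = 0 ∨ m = 1 := by omega
  · norm_num at ht3
  · rw [D.trace_eq hV, h]
    norm_num
  · norm_num at ht3
  · norm_num at ht3

/-- If the quotient map has determinant one, its eigenvalue `-1` forces trace `-2` and hence square
1; determinant `-1` gives an involution directly. -/
theorem sq_eq_one_of_neg (hV : Module.finrank ℚ V = 3) (D : FixedData f) {k : ℕ}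
    (hk : 0 < k) (hfk : f ^ k = 1) {d : V} (hd0 : d ≠ 0) (hd : f d = -d) : f ^ 2 = 1 := by
  have := Module.finite_of_finrank_eq_succ hV
  have hb := D.bar_pow_eq_one hfk
  have hQ := D.finrank_quotient hV
  refine D.pow_eq_one_of_bar_pow hk hfk ?_
  rcases det_of_pow_eq_one hk hb with hdet | hdet
  · have hdW : D.W.mkQ d ≠ 0 := by
      intro h
      have h1 := D.fix d ((Submodule.Quotient.mk_eq_zero _).mp h)
      rw [hd] at h1
      have h2 : (2 : ℚ) • d = 0 := by
        rw [two_smul]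
        nth_rewrite 1 [← h1]
        exact neg_add_cancel d
      exact hd0 ((smul_eq_zero.mp h2).resolve_left two_ne_zero)
    have hsq := congrArg (fun g : Module.End ℚ _ => g (D.W.mkQ d)) (sq_eq_of_finrank_two hQ D.bar)
    have h2 : (D.bar ^ 2) (D.W.mkQ d) = D.W.mkQ d := by
      rw [D.bar_pow, pow_two, Module.End.mul_apply, hd, map_neg, hd, neg_neg]
    simp only [h2, hdet, one_smul, LinearMap.sub_apply, LinearMap.smul_apply, Module.End.one_apply,
      D.bar_mk, hd, map_neg, smul_neg] at hsq
    have ht : LinearMap.trace ℚ _ D.bar = -2 := by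
      have h3 : (LinearMap.trace ℚ _ D.bar + 2) • D.W.mkQ d = 0 := by
        rw [add_smul, two_smul]
        nth_rewrite 2 [hsq]
        abel
      have := (smul_eq_zero.mp h3).resolve_right hdW
      linarith
    exact sq_eq_one_of_trace_eq_neg_two hQ hk hb hdet ht
  · exact sq_eq_one_of_det_eq_neg_one hQ hk hb hdet

/-- A fixed vector outside `D.W` would give the quotient map trace 2, whereas total trace zero means
trace `-1`. -/
theorem mem_of_fixed_of_pow_three (hV : Module.finrank ℚ V = 3) (D : FixedData f)
    (hf3 : f ^ 3 = 1) (hf1 : f ≠ 1) {d : V} (hd : f d = d) : d ∈ D.W := by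
  by_contra hdW
  have := Module.finite_of_finrank_eq_succ hV
  have h3 : 0 < 3 := by norm_num
  have hb := D.bar_pow_eq_one hf3
  have hQ := D.finrank_quotient hV
  have htr := trace_eq_zero_of_pow_three hV D hf3 hf1
  rw [D.trace_eq hV] at htr
  have hdet : LinearMap.det D.bar = 1 := by
    refine (det_of_pow_eq_one h3 hb).resolve_right fun h => ?_
    have := congrArg LinearMap.det hb
    rw [map_pow, h, map_one] at this
    norm_num at this
  have hdW' : D.W.mkQ d ≠ 0 := fun h => hdW ((Submodule.Quotient.mk_eq_zero _).mp h)
  have hsq := congrArg (fun g : Module.End ℚ _ => g (D.W.mkQ d)) (sq_eq_of_finrank_two hQ D.bar)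
  have h2 : (D.bar ^ 2) (D.W.mkQ d) = D.W.mkQ d := by
    rw [D.bar_pow, pow_two, Module.End.mul_apply, hd, hd]
  simp only [h2, hdet, one_smul, LinearMap.sub_apply, LinearMap.smul_apply, Module.End.one_apply,
    D.bar_mk, hd] at hsq
  have h4 : (LinearMap.trace ℚ _ D.bar - 2) • D.W.mkQ d = 0 := by
    rw [sub_smul, two_smul]
    nth_rewrite 2 [hsq]
    abel
  have := (smul_eq_zero.mp h4).resolve_right hdW'
  linarith

end Dimension3

/-! ### Metabelian finite groups in dimension three -/

section Reducible

variable {F : Type u} [Group F]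

theorem derivedSeries_two_le_commutator : derivedSeries F 2 ≤ _root_.commutator F := by
  rw [← derivedSeries_one]
  exact derivedSeries_antitone _ (by norm_num)

theorem derivedSeries_two_eq : derivedSeries F 2 = ⁅_root_.commutator F, _root_.commutator F⁆ := by
  rw [derivedSeries_succ, derivedSeries_one]

/-- The second derived subgroup of a periodic group acts trivially on spaces of dimension at most
two. -/
theorem derivedSeries_two_le_ker {V : Type v} [AddCommGroup V] [Module ℚ V]
    (φ : F →* Module.End ℚ V) (hV : Module.finrank ℚ V = 1 ∨ Module.finrank ℚ V = 2)
    (htor : ∀ f : F, IsOfFinOrder f) : derivedSeries F 2 ≤ φ.ker := by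
  have hinv : ∀ x, φ x * φ x⁻¹ = 1 := fun x => by rw [← map_mul, mul_inv_cancel, map_one]
  have hcomm : ∀ x y, φ x * φ y = φ y * φ x → φ ⁅x, y⁆ = 1 := by
    intro x y h
    rw [commutatorElement_def, map_mul, map_mul, map_mul, h, mul_assoc (φ y), hinv, mul_one, hinv]
  rcases hV with hV | hV
  · refine derivedSeries_two_le_commutator.trans ?_
    rw [commutator_def, commutator_le]
    intro x _ y _
    refine hcomm x y ?_
    rw [eq_det_smul_one hV (φ x), smul_mul_assoc, mul_smul_comm, one_mul, mul_one]
  -- The derived group acts in `SL₂(ℚ)`, where elements of finite order commute as soon as their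
  -- commutator has finite order.
  · have hdet : _root_.commutator F ≤ (LinearMap.det.comp φ).ker := by
      rw [commutator_def, commutator_le]
      intro x _ y _
      have h1 : ∀ x, LinearMap.det (φ x) * LinearMap.det (φ x⁻¹) = 1 := fun x => by
        rw [← map_mul, hinv, map_one]
      rw [MonoidHom.mem_ker, MonoidHom.comp_apply, commutatorElement_def]
      simp only [map_mul]
      rw [mul_comm (LinearMap.det (φ x)), mul_assoc (LinearMap.det (φ y)), h1, mul_one, h1]
    rw [derivedSeries_two_eq, commutator_le]
    intro x hx y hy
    refine hcomm x y ?_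
    obtain ⟨k, hk, hk'⟩ := isOfFinOrder_iff_pow_eq_one.mp (htor x)
    obtain ⟨l, hl, hl'⟩ := isOfFinOrder_iff_pow_eq_one.mp (htor (x * y * x⁻¹ * y⁻¹))
    exact commute_of_finite_order hV (hdet hx) (hdet hy) (hinv x) (hinv y) hk
      (by rw [← map_pow, hk', map_one]) hl
      (by rw [← map_mul, ← map_mul, ← map_mul, ← map_pow, hl', map_one])

variable {V : Type v} [AddCommGroup V] [Module ℚ V] (ρ : F →* Module.End ℚ V)

/-- A periodic group which acts faithfully and reducibly on a three-dimensional space is metabelian. -/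
theorem derivedSeries_two_eq_bot_of_reducible (hV : Module.finrank ℚ V = 3)
    (hρ : ∀ f, ρ f = 1 → f = 1) (htor : ∀ f : F, IsOfFinOrder f) (W : Submodule ℚ V)
    (hW : ∀ f, ∀ w ∈ W, ρ f w ∈ W) (hW1 : Module.finrank ℚ W = 1 ∨ Module.finrank ℚ W = 2) :
    derivedSeries F 2 = ⊥ := by
  have := Module.finite_of_finrank_eq_succ hV
  have hle : ∀ f, W ≤ W.comap (ρ f) := fun f w hw => hW f w hw
  let φ : F →* Module.End ℚ W :=
    { toFun := fun f => (ρ f).restrict (hle f)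
      map_one' := LinearMap.ext fun w => Subtype.ext (by
        change ρ 1 w = w
        rw [map_one, Module.End.one_apply])
      map_mul' := fun x y => LinearMap.ext fun w => Subtype.ext (by
        change ρ (x * y) w = ρ x (ρ y w)
        rw [map_mul, Module.End.mul_apply]) }
  let ψ : F →* Module.End ℚ (V ⧸ W) :=
    { toFun := fun f => W.mapQ W (ρ f) (hle f)
      map_one' := Submodule.linearMap_qext _ (LinearMap.ext fun v => by
        change W.mkQ (ρ 1 v) = W.mkQ v
        rw [map_one, Module.End.one_apply])
      map_mul' := fun x y => Submodule.linearMap_qext _ (LinearMap.ext fun v => by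
        change W.mkQ (ρ (x * y) v) = W.mkQ (ρ x (ρ y v))
        rw [map_mul, Module.End.mul_apply]) }
  have hrk := W.finrank_quotient_add_finrank
  rw [hV] at hrk
  have hQ : Module.finrank ℚ (V ⧸ W) = 1 ∨ Module.finrank ℚ (V ⧸ W) = 2 := by omega
  refine eq_bot_iff.mpr fun f hf => mem_bot.mpr (hρ f ?_)
  obtain ⟨k, hk, hk'⟩ := isOfFinOrder_iff_pow_eq_one.mp (htor f)
  refine eq_one_of_restrict_of_mapQ (W := W) hk (by rw [← map_pow, hk', map_one]) (fun w hw => ?_)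
    fun v => ?_
  · have h1 : φ f = 1 := derivedSeries_two_le_ker φ hW1 htor hf
    exact Subtype.ext_iff.mp (congrArg (fun g : Module.End ℚ W => g ⟨w, hw⟩) h1 :)
  · have h1 : ψ f = 1 := derivedSeries_two_le_ker ψ hQ htor hf
    have h2 : W.mkQ (ρ f v) = W.mkQ v :=
      congrArg (fun g : Module.End ℚ (V ⧸ W) => g (W.mkQ v)) h1
    rw [← Submodule.Quotient.mk_eq_zero, Submodule.Quotient.mk_sub, sub_eq_zero]
    exact h2

/-- The fixed subspace of a subgroup. -/
def fixedSubspace (N : Subgroup F) : Submodule ℚ V where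
  carrier := {v | ∀ x ∈ N, ρ x v = v}
  add_mem' := fun ha hb x hx => by rw [map_add, ha x hx, hb x hx]
  zero_mem' := fun x _ => map_zero _
  smul_mem' := fun c v hv x hx => by rw [map_smul, hv x hx]

theorem apply_mem_fixedSubspace {N : Subgroup F} [N.Normal] (f : F) {v : V}
    (hv : v ∈ fixedSubspace ρ N) : ρ f v ∈ fixedSubspace ρ N := by
  intro x hx
  have h1 := hv _ (Normal.conj_mem inferInstance x hx f⁻¹)
  rw [inv_inv] at h1
  have h2 : ρ x * ρ f = ρ f * ρ (f⁻¹ * x * f) := by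
    rw [← map_mul, ← map_mul]
    congr 1
    group
  rw [End.mul_apply_eq h2, Module.End.mul_apply, h1]

theorem commutator_le_of_line (N : Subgroup F) {W : Submodule ℚ V} (hW1 : Module.finrank ℚ W = 1)
    (hW : ∀ f ∈ N, ∀ w ∈ W, ρ f w ∈ W) : W ≤ fixedSubspace ρ ⁅N, N⁆ := by
  obtain ⟨w, hw0, hspan⟩ := finrank_eq_one_iff'.mp hW1
  have hsc : ∀ f ∈ N, ∃ c : ℚ, ∀ v ∈ W, ρ f v = c • v := by
    intro f hf
    obtain ⟨c, hc⟩ := hspan ⟨ρ f w, hW f hf w w.2⟩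
    refine ⟨c, fun v hv => ?_⟩
    obtain ⟨d, hd⟩ := hspan ⟨v, hv⟩
    have hd' : d • (w : V) = v := Subtype.ext_iff.mp hd
    have hc' : c • (w : V) = ρ f w := Subtype.ext_iff.mp hc
    rw [← hd', map_smul, ← hc', smul_comm]
  let L : Subgroup F :=
    { carrier := {f | ∀ v ∈ W, ρ f v = v}
      mul_mem' := fun {a b} ha hb v hv => by
        rw [map_mul, Module.End.mul_apply, hb v hv, ha v hv]
      one_mem' := fun v _ => by rw [map_one, Module.End.one_apply]
      inv_mem' := fun {a} ha v hv => by
        have h1 : ρ a⁻¹ * ρ a = 1 := by rw [← map_mul, inv_mul_cancel, map_one]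
        have h2 := End.mul_apply_eq h1 v
        rwa [ha v hv] at h2 }
  have hL : ⁅N, N⁆ ≤ L := by
    rw [commutator_le]
    intro x hx y hy v hv
    obtain ⟨c, hc⟩ := hsc x hx
    obtain ⟨d, hd⟩ := hsc y hy
    have h1 : ⁅x, y⁆ * (y * x) = x * y := by rw [commutatorElement_def]; group
    have h2 : ∀ v ∈ W, ρ (x * y) v = ρ (y * x) v := by
      intro v hv
      rw [map_mul, map_mul, Module.End.mul_apply, Module.End.mul_apply, hd v hv, hc v hv, map_smul,
        map_smul, hd v hv, hc v hv, smul_comm]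
    have h3 : ∀ v ∈ W, ρ ⁅x, y⁆ (ρ (y * x) v) = ρ (y * x) v := by
      intro v hv
      rw [← Module.End.mul_apply, ← map_mul, h1, h2 v hv]
    have hxy := N.inv_mem (N.mul_mem hy hx)
    have h4 := h3 _ (hW _ hxy v hv)
    have h5 : ρ (y * x) * ρ (y * x)⁻¹ = 1 := by rw [← map_mul, mul_inv_cancel, map_one]
    rwa [End.mul_apply_eq h5, Module.End.one_apply] at h4
  exact fun v hv x hx => hL hx v hv

end Reducible

section Irreducible

variable {F : Type u} [Group F] {V : Type v} [AddCommGroup V] [Module ℚ V] (ρ : F →* Module.End ℚ V)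

theorem finite_of_periodic_of_finrank_three (hV : Module.finrank ℚ V = 3)
    (hρ : ∀ f, ρ f = 1 → f = 1) (htor : ∀ f : F, IsOfFinOrder f)
    (hfix : ∀ f, Nonempty (FixedData (ρ f))) : Finite F := by
  have := Module.finite_of_finrank_eq_succ hV
  refine finite_of_trace ρ (T := (fun m : ℤ => (m : ℚ)) '' Set.Icc (-1) 3)
    ((Set.finite_Icc _ _).image _) (fun f => ?_) fun f hf => hρ f ?_
  · obtain ⟨k, hk, hk'⟩ := isOfFinOrder_iff_pow_eq_one.mp (htor f)
    obtain ⟨D⟩ := hfix f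
    obtain ⟨m, hm, h⟩ := exists_trace_eq_of_fixed hV D hk (by rw [← map_pow, hk', map_one])
    exact ⟨m, hm, h.symm⟩
  · obtain ⟨k, hk, hk'⟩ := isOfFinOrder_iff_pow_eq_one.mp (htor f)
    obtain ⟨D⟩ := hfix f
    exact eq_one_of_trace_eq_three hV D hk (by rw [← map_pow, hk', map_one])
      (by rw [hf, hV]; norm_num)

/-- A finite group acting faithfully on a three-dimensional space in which every nontrivial element has
trace zero has order dividing three. -/
theorem card_dvd_three [Finite F] (hV : Module.finrank ℚ V = 3)
    (htr : ∀ f, f ≠ 1 → LinearMap.trace ℚ V (ρ f) = 0) : Nat.card F ∣ 3 := by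
  classical
  have := Module.finite_of_finrank_eq_succ hV
  have := Fintype.ofFinite F
  have hcard : (Nat.card F : ℚ) ≠ 0 := by exact_mod_cast Nat.card_pos.ne'
  have : Invertible (Nat.card F : ℚ) := invertibleOfNonzero hcard
  -- The character sum is the order of `F` times the dimension of the invariants, and only the
  -- identity contributes to it.
  have h := Representation.card_inv_mul_sum_char_eq_finrank (k := ℚ) (G := F) (V := V) ρ
  have hsum : ∑ g : F, Representation.character (k := ℚ) (G := F) (V := V) ρ g = 3 := by
    have h1 := Finset.sum_eq_single (s := Finset.univ)
      (f := Representation.character (k := ℚ) (G := F) (V := V) ρ) (1 : F)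
      (fun f _ hf => htr f hf) (fun h => absurd (Finset.mem_univ _) h)
    rw [h1, Representation.char_one, hV]
    norm_num
  rw [hsum, inv_mul_eq_iff_eq_mul₀ hcard] at h
  exact ⟨_, by exact_mod_cast h⟩

/-- A finite group of rational `3 × 3` matrices all of whose elements have the eigenvalue one, and in
which no element of order three is conjugate to its inverse, is metabelian. -/
theorem derivedSeries_two_eq_bot [Finite F] (hV : Module.finrank ℚ V = 3)
    (hρ : ∀ f, ρ f = 1 → f = 1) (hfix : ∀ f, Nonempty (FixedData (ρ f)))
    (hS3 : ∀ r t : F, t ^ 3 = 1 → r * t * r⁻¹ = t⁻¹ → t = 1) : derivedSeries F 2 = ⊥ := by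
  have := Module.finite_of_finrank_eq_succ hV
  have htor : ∀ f : F, IsOfFinOrder f := fun f => isOfFinOrder_of_finite f
  have h12 : ∀ f : F, f ^ 12 = 1 := by
    intro f
    obtain ⟨k, hk, hk'⟩ := isOfFinOrder_iff_pow_eq_one.mp (htor f)
    obtain ⟨D⟩ := hfix f
    refine hρ _ ?_
    rw [map_pow, pow_twelve_eq_one_of_fixed hV D hk (by rw [← map_pow, hk', map_one])]
  have hp3 : Fact (Nat.Prime 3) := ⟨Nat.prime_three⟩
  obtain ⟨P⟩ : Nonempty (Sylow 3 F) := inferInstance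
  have hP3 : ∀ x ∈ P, x ^ 3 = 1 := by
    intro x hx
    obtain ⟨k, hk⟩ := P.isPGroup' ⟨x, hx⟩
    have hk' : x ^ 3 ^ k = 1 := Subtype.ext_iff.mp hk
    have h1 : orderOf x ∣ Nat.gcd (3 ^ k) 12 :=
      Nat.dvd_gcd (orderOf_dvd_of_pow_eq_one hk') (orderOf_dvd_of_pow_eq_one (h12 x))
    have h2 : Nat.gcd (3 ^ k) 12 ∣ 3 := by
      have h3 : Nat.Coprime (Nat.gcd (3 ^ k) 12) 4 :=
        Nat.Coprime.coprime_dvd_left (Nat.gcd_dvd_left _ _) (Nat.Coprime.pow_left k (by norm_num))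
      exact h3.dvd_of_dvd_mul_right (n := 4) (by exact Nat.gcd_dvd_right _ _)
    exact orderOf_dvd_iff_pow_eq_one.mp (h1.trans h2)
  -- All elements of `P` satisfy `x ^ 3 = 1`, so the nontrivial ones have trace zero.
  have hcard : Nat.card P ∣ 3 := by
    refine card_dvd_three (ρ.comp (P : Subgroup F).subtype) hV fun f hf => ?_
    obtain ⟨D⟩ := hfix f
    refine trace_eq_zero_of_pow_three hV D
      ((map_pow ρ (f : F) 3).symm.trans (by rw [hP3 f f.2, map_one])) fun h => hf ?_
    exact Subtype.ext (hρ _ h)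
  have hPgen : ∀ x ∈ P, x ≠ 1 → ∀ y ∈ P, y = 1 ∨ y = x ∨ y = x⁻¹ := by
    intro x hx hx1 y hy
    have hc3 : Nat.card P = 3 := by
      refine ((Nat.dvd_prime Nat.prime_three).mp hcard).resolve_left fun h => hx1 ?_
      have := (Nat.card_eq_one_iff_unique.mp h).1
      exact Subtype.ext_iff.mp (Subsingleton.elim (⟨x, hx⟩ : P) 1)
    obtain ⟨n, hn⟩ := mem_powers_of_prime_card hc3 (g := (⟨x, hx⟩ : P)) (g' := ⟨y, hy⟩)
      (fun h => hx1 (Subtype.ext_iff.mp h))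
    have hn' : x ^ n = y := Subtype.ext_iff.mp hn
    rw [pow_eq_pow_mod n (hP3 x hx)] at hn'
    have hlt : n % 3 < 3 := Nat.mod_lt _ (by norm_num)
    interval_cases n % 3
    · exact Or.inl (by rw [← hn', pow_zero])
    · exact Or.inr (Or.inl (by rw [← hn', pow_one]))
    · refine Or.inr (Or.inr ?_)
      rw [← hn', eq_inv_iff_mul_eq_one, ← pow_succ, hP3 x hx]
  -- The only nontrivial automorphism of a group of order three is inversion, excluded by `hS3`.
  -- Burnside's transfer theorem then gives the normal 3-complement `K`, which contains the derived
  -- group.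
  have hN : normalizer (P : Set F) ≤ centralizer (P : Set F) := by
    intro n hn
    refine mem_centralizer_iff.mpr fun x hx => ?_
    by_cases hx1 : x = 1
    · rw [hx1, one_mul, mul_one]
    have hmem : n * x * n⁻¹ ∈ P := (mem_normalizer_iff.mp hn x).mp hx
    rcases hPgen x hx hx1 _ hmem with h | h | h
    · exact absurd (by simpa using h) hx1
    · exact (mul_inv_eq_iff_eq_mul.mp h).symm
    · exact absurd (hS3 n x (hP3 x hx) h) hx1
  obtain ⟨K, hK⟩ : ∃ K, K = (MonoidHom.transferSylow P hN).ker := ⟨_, rfl⟩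
  have hKn : K.Normal := hK ▸ inferInstance
  have hFK : _root_.commutator F ≤ K := by
    rw [hK, _root_.commutator_def, commutator_le]
    intro x _ y _
    rw [MonoidHom.mem_ker, map_commutatorElement]
    refine commutatorElement_eq_one_iff_mul_comm.mpr (Subtype.ext ?_)
    exact hN (le_normalizer (MonoidHom.transferSylow P hN y).2) _ (MonoidHom.transferSylow P hN x).2
  have hK2 : IsPGroup 2 K := by
    rintro ⟨g, hg⟩
    refine ⟨2, Subtype.ext ?_⟩
    change g ^ 2 ^ 2 = 1
    have h3 : (g ^ 4) ^ 3 = 1 := by rw [← pow_mul, h12]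
    have hQ : IsPGroup 3 (zpowers (g ^ 4)) := by
      refine IsPGroup.of_card_dvd_pow (n := 1) ?_
      rw [Nat.card_zpowers, pow_one]
      exact orderOf_dvd_of_pow_eq_one h3
    have hdis := MonoidHom.ker_transferSylow_disjoint P hN _ hQ
    rw [← hK] at hdis
    exact disjoint_def.mp hdis (K.pow_mem hg 4) (mem_zpowers _)
  have hle : derivedSeries F 2 ≤ ⁅K, K⁆ := by
    rw [derivedSeries_two_eq]
    exact commutator_mono hFK hFK
  by_cases hK1 : Subsingleton K
  · have : K = ⊥ := (eq_bot_iff_forall _).mpr fun x hx =>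
      Subtype.ext_iff.mp (Subsingleton.elim (⟨x, hx⟩ : K) 1)
    rw [this, commutator_bot_left] at hle
    exact le_bot_iff.mp hle
  rw [not_subsingleton_iff_nontrivial] at hK1
  have hcen := hK2.center_nontrivial
  obtain ⟨⟨z, hzK⟩, hzc, hz1⟩ := exists_ne_one_of_nontrivial (center K)
  have hz1' : z ≠ 1 := fun h => hz1 (Subtype.ext h)
  have hzcomm : ∀ f ∈ K, ρ f * (ρ z - 1) = (ρ z - 1) * ρ f := by
    intro f hf
    have h1 : f * z = z * f := Subtype.ext_iff.mp (mem_center_iff.mp hzc ⟨f, hf⟩)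
    rw [mul_sub, sub_mul, ← map_mul, ← map_mul, h1, mul_one, one_mul]
  -- For a nontrivial central `z` of `K`, the kernel and the range of `ρ z - 1` are nonzero,
  -- invariant under `K`, and their dimensions add up to 3; one of them is a line.
  obtain ⟨W, hW1, hWK⟩ : ∃ W : Submodule ℚ V, Module.finrank ℚ W = 1 ∧
      ∀ f ∈ K, ∀ w ∈ W, ρ f w ∈ W := by
    have hrk := LinearMap.finrank_range_add_finrank_ker (ρ z - 1)
    rw [hV] at hrk
    obtain ⟨D⟩ := hfix z
    have hle1 : D.W ≤ LinearMap.ker (ρ z - 1) := fun w hw => by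
      rw [LinearMap.mem_ker, LinearMap.sub_apply, D.fix w hw, Module.End.one_apply, sub_self]
    have hpos := Submodule.finrank_mono hle1
    rw [D.finrank] at hpos
    have hrange : Module.finrank ℚ (LinearMap.range (ρ z - 1)) ≠ 0 := by
      intro h
      refine hz1' (hρ z (sub_eq_zero.mp ?_))
      exact LinearMap.range_eq_bot.mp (Submodule.finrank_eq_zero.mp h)
    by_cases h1 : Module.finrank ℚ (LinearMap.ker (ρ z - 1)) = 1
    · refine ⟨_, h1, fun f hf w hw => ?_⟩
      rw [LinearMap.mem_ker] at hw ⊢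
      rw [End.mul_apply_eq (hzcomm f hf).symm, Module.End.mul_apply, hw, map_zero]
    · refine ⟨LinearMap.range (ρ z - 1), by omega, ?_⟩
      rintro f hf _ ⟨v, rfl⟩
      exact ⟨ρ f v, (End.mul_apply_eq (hzcomm f hf).symm v)⟩
  have hfixle := commutator_le_of_line ρ K hW1 hWK
  have hpos := Submodule.finrank_mono hfixle
  rw [hW1] at hpos
  have hle3 := Submodule.finrank_le (fixedSubspace ρ ⁅K, K⁆)
  rw [hV] at hle3
  -- `⁅K, K⁆` fixes that line pointwise. Its fixed space is invariant under `F`, so it is either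
  -- everything, and `⁅K, K⁆` is trivial, or a proper subspace showing that `F` acts reducibly.
  by_cases h3 : Module.finrank ℚ (fixedSubspace ρ ⁅K, K⁆) = 3
  · have htop := Submodule.eq_top_of_finrank_eq (h3.trans hV.symm)
    refine eq_bot_iff.mpr fun f hf => mem_bot.mpr (hρ f ?_)
    ext v
    have hv : v ∈ fixedSubspace ρ ⁅K, K⁆ := htop ▸ Submodule.mem_top
    exact hv f (hle hf)
  · have h12 : Module.finrank ℚ (fixedSubspace ρ ⁅K, K⁆) = 1 ∨
        Module.finrank ℚ (fixedSubspace ρ ⁅K, K⁆) = 2 := by omega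
    exact derivedSeries_two_eq_bot_of_reducible ρ hV hρ htor _
      (fun f w hw => apply_mem_fixedSubspace ρ f hw) h12

end Irreducible

/-! ### The abelian radical of rank three -/

section RankThree

variable {G : Type u} [Group G] {A : Subgroup G} [A.Normal] {V : Type v} [AddCommGroup V] [Module ℚ V]
  (S : RatRep A V)

include S in
/-- In the holonomy of a torsion-free group with a rank three abelian normal subgroup no element of order
three is conjugate to its inverse. -/
theorem RatRep.mem_of_conj_eq_inv (ht : TorsionFree G) (hV : Module.finrank ℚ V = 3)
    (hA : ∀ g, S.ρ g = 1 ↔ g ∈ A) (htor : ∀ g, ∃ k, 0 < k ∧ g ^ k ∈ A)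
    (hfix : ∀ g, Nonempty (FixedData (S.ρ g))) {ν τ : G} (hτ3 : τ ^ 3 ∈ A)
    (hντ : ν * τ * ν⁻¹ * τ ∈ A) : τ ∈ A := by
  by_contra hτA
  have hT1 : S.ρ τ ≠ 1 := fun h => hτA ((hA τ).mp h)
  have hT3 : S.ρ τ ^ 3 = 1 := by rw [← map_pow, (hA _).mpr hτ3]
  have hNT : S.ρ ν * S.ρ τ * S.ρ ν⁻¹ * S.ρ τ = 1 := by
    rw [← map_mul, ← map_mul, ← map_mul, (hA _).mpr hντ]
  have hTNT : S.ρ τ * S.ρ ν * S.ρ τ = S.ρ ν := by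
    have h1 : S.ρ ν * S.ρ τ * S.ρ ν⁻¹ = S.ρ τ⁻¹ := by
      rw [← mul_one (S.ρ ν * S.ρ τ * S.ρ ν⁻¹), ← S.ρ_mul_inv τ, ← mul_assoc, hNT, one_mul]
    have h2 : S.ρ ν * S.ρ τ = S.ρ τ⁻¹ * S.ρ ν := by
      rw [← h1, mul_assoc _ (S.ρ ν⁻¹), S.ρ_inv_mul, mul_one]
    rw [mul_assoc, h2, ← mul_assoc, S.ρ_mul_inv, one_mul]
  obtain ⟨c, hc⟩ : ∃ c, c = S.ι (τ ^ 3) := ⟨_, rfl⟩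
  have hTc : S.ρ τ c = c := by rw [hc, S.ρ_ι_pow hτ3]
  have hc0 : c ≠ 0 := by
    intro h
    refine hτA ?_
    rw [ht.eq_one_of_pow (by norm_num) (S.ι_inj _ hτ3 (hc ▸ h))]
    exact A.one_mem
  -- The fixed space of an action of order three is the line spanned by the vector `c` of `τ ^ 3`.
  have haxis : ∀ d, S.ρ τ d = d → ∃ μ : ℚ, μ • c = d := fun d hd =>
    Submodule.mem_span_singleton.mp
      (mem_of_fixed_of_pow_three hV (FixedData.span hc0 hTc) hT3 hT1 hd)
  obtain ⟨μ, hμ⟩ := haxis (S.ρ ν c) (by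
    have := End.mul_apply_eq hTNT c
    rwa [Module.End.mul_apply, hTc] at this)
  obtain ⟨k, hk, hνk⟩ := htor ν
  have hNk : S.ρ ν ^ k = 1 := by rw [← map_pow, (hA _).mpr hνk]
  have hμk : μ ^ k = 1 := by
    have h1 : ∀ n : ℕ, (S.ρ ν ^ n) c = μ ^ n • c := by
      intro n
      induction n with
      | zero => rw [pow_zero, pow_zero, one_smul, Module.End.one_apply]
      | succ n ih => rw [pow_succ, Module.End.mul_apply, ← hμ, map_smul, ih, smul_smul, pow_succ']
    have h2 := h1 k
    rw [hNk, Module.End.one_apply] at h2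
    have h3 : (μ ^ k - 1) • c = 0 := by rw [sub_smul, ← h2, one_smul, sub_self]
    exact sub_eq_zero.mp ((smul_eq_zero.mp h3).resolve_right hc0)
  have hTTT : ∀ v, S.ρ τ (S.ρ τ (S.ρ τ v)) = v := fun v => by
    have h1 := congrArg (fun f : Module.End ℚ V => f v) hT3
    simpa [pow_succ] using h1
  -- `ν` acts on the axis by `1` or `-1`. In the first case a lift of the action of `τ` turns out to
  -- have cube 1; in the second, `ν` acts as an involution and the computation for dihedral groups
  -- of order six applies.
  rcases eq_one_or_neg_one_of_pow hk hμk with rfl | rfl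
  · rw [one_smul] at hμ
    have hTinv : ∀ v, S.ρ τ⁻¹ v = S.ρ τ (S.ρ τ v) := fun v => by
      have h1 := End.mul_apply_eq (S.ρ_inv_mul τ) (S.ρ τ (S.ρ τ v))
      rwa [hTTT, Module.End.one_apply] at h1
    have hvA : τ * (ν * τ * ν⁻¹) ∈ A := by
      rw [← hA, map_mul, map_mul, map_mul, ← mul_assoc, ← mul_assoc, hTNT, S.ρ_mul_inv]
    obtain ⟨v, hv⟩ : ∃ v, v = τ * (ν * τ * ν⁻¹) := ⟨_, rfl⟩
    rw [← hv] at hvA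
    have h1 := RatRep.conj_inv_mem (A := A) τ hvA
    have h2 := RatRep.conj_inv_mem (A := A) τ h1
    have hτ3' := A.inv_mem hτ3
    -- Here `ν * τ * ν⁻¹ = τ⁻¹ * v`. Expanding its cube, which is the conjugate of `τ ^ 3` with
    -- vector `c`, gives `(1 + T + T²) v = 2 c`.
    have hsum : S.ρ τ (S.ι v) + S.ρ τ (S.ρ τ (S.ι v)) + S.ι v = c + c := by
      have hexp : (τ⁻¹ * v * τ) * (τ⁻¹ * (τ⁻¹ * v * τ) * τ) * ((τ ^ 3)⁻¹ * v) = ν * τ ^ 3 * ν⁻¹ := by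
        rw [hv]
        simp only [pow_succ, pow_zero, one_mul]
        group
      have h3 := congrArg S.ι hexp
      rw [S.ι_mul _ (A.mul_mem h1 h2) _ (A.mul_mem hτ3' hvA), S.ι_mul _ h1 _ h2,
        S.ι_mul _ hτ3' _ hvA, S.ι_conj_inv _ h1, S.ι_conj_inv _ hvA, S.ι_inv hτ3, S.ι_conj _ _ hτ3,
        ← hc, ← hμ, hTinv, hTinv, hTTT] at h3
      calc S.ρ τ (S.ι v) + S.ρ τ (S.ρ τ (S.ι v)) + S.ι v =
            (S.ρ τ (S.ρ τ (S.ι v)) + S.ρ τ (S.ι v) + (-c + S.ι v)) + c := by abel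
        _ = c + c := by rw [h3]
    -- The correction is chosen so that the cube of `τ * w` has vector `c + (1 + T + T²) (v - c) = c
    -- + 2 c - 3 c = 0`.
    obtain ⟨w, hw⟩ : ∃ w, w = v * (τ ^ 3)⁻¹ := ⟨_, rfl⟩
    have hwA : w ∈ A := hw ▸ A.mul_mem hvA hτ3'
    have hιw : S.ι w = S.ι v - c := by
      rw [hw, S.ι_mul _ hvA _ hτ3', S.ι_inv hτ3, ← hc, sub_eq_add_neg]
    have h3 := Normal.conj_mem (inferInstance : A.Normal) w hwA τ
    have h4 := Normal.conj_mem (inferInstance : A.Normal) _ h3 τ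
    have hτw : τ * w = 1 := by
      refine ht.eq_one_of_pow (k := 3) (by norm_num) ?_
      have hexp : (τ * w) ^ 3 = (τ * w * τ⁻¹) * (τ * (τ * w * τ⁻¹) * τ⁻¹) * (τ ^ 3 * w) := by
        simp only [pow_succ, pow_zero, one_mul]
        group
      rw [hexp]
      refine S.ι_inj _ (A.mul_mem (A.mul_mem h3 h4) (A.mul_mem hτ3 hwA)) ?_
      rw [S.ι_mul _ (A.mul_mem h3 h4) _ (A.mul_mem hτ3 hwA), S.ι_mul _ h3 _ h4, S.ι_mul _ hτ3 _ hwA,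
        S.ι_conj _ _ h3, S.ι_conj _ _ hwA, ← hc, hιw, map_sub, map_sub, hTc, hTc]
      calc S.ρ τ (S.ι v) - c + (S.ρ τ (S.ρ τ (S.ι v)) - c) + (c + (S.ι v - c)) =
            (S.ρ τ (S.ι v) + S.ρ τ (S.ρ τ (S.ι v)) + S.ι v) - (c + c) := by abel
        _ = 0 := by rw [hsum, sub_self]
    exact hτA (by rw [eq_inv_of_mul_eq_one_left hτw]; exact A.inv_mem hwA)
  · rw [neg_one_smul] at hμ
    obtain ⟨D⟩ := hfix ν
    have hN2 : S.ρ ν ^ 2 = 1 := sq_eq_one_of_neg hV D hk hNk hc0 hμ.symm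
    have hNN : S.ρ ν * S.ρ ν = 1 := by rw [← pow_two, hN2]
    have hν2 : ν ^ 2 ∈ A := by rw [← hA, map_pow, hN2]
    have hNinv : S.ρ ν⁻¹ = S.ρ ν := by
      rw [← mul_one (S.ρ ν⁻¹), ← hNN, ← mul_assoc, S.ρ_inv_mul, one_mul]
    rw [hNinv] at hNT
    refine S.false_of_reflection_of_order_three hν2 hNN hNT ?_ fun hx => ?_
    · obtain ⟨e, he⟩ : ∃ e, e = S.ι (ν ^ 2) := ⟨_, rfl⟩
      have hNe : S.ρ ν e = e := by rw [he, S.ρ_ι_pow hν2]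
      rw [← he]
      have hNTv : ∀ v, S.ρ ν (S.ρ τ v) = S.ρ τ (S.ρ τ (S.ρ ν v)) := by
        intro v
        have h1 := End.mul_apply_eq hTNT v
        rw [Module.End.mul_apply] at h1
        have h2 := congrArg (fun v => S.ρ τ (S.ρ τ v)) h1
        simp only [hTTT] at h2
        exact h2
      -- The sum over the orbit of `e` is fixed by `τ`, hence lies on the axis, where `ν` acts by
      -- `-1`. It is also fixed by `ν`, so it vanishes.
      obtain ⟨s, hs⟩ : ∃ s, s = e + S.ρ τ e + S.ρ τ (S.ρ τ e) := ⟨_, rfl⟩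
      have hTs : S.ρ τ s = s := by
        rw [hs, map_add, map_add, hTTT]
        abel
      have hNs : S.ρ ν s = s := by
        rw [hs, map_add, map_add, hNTv, hNTv, hNTv, hNe, hTTT]
        abel
      obtain ⟨δ, hδ⟩ := haxis s hTs
      rw [← hs, ← hδ]
      rw [← hδ, map_smul, ← hμ, smul_neg, neg_eq_iff_add_eq_zero, ← two_smul ℚ] at hNs
      exact (smul_eq_zero.mp hNs).resolve_left two_ne_zero
    -- The element would be an involution, hence trivial. Its action being trivial makes `τ` act as
    -- `ν` does, with both square and cube trivial.
    · have h1 := ht.eq_one_of_pow two_pos hx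
      have h2 : S.ρ ν * (S.ρ τ * S.ρ ν * S.ρ τ⁻¹) * S.ρ ν = 1 := by
        simp only [← map_mul, h1, map_one]
      have h3 : S.ρ τ⁻¹ = S.ρ τ * S.ρ τ := by
        rw [← mul_one (S.ρ τ⁻¹), ← hT3, pow_succ', ← mul_assoc, S.ρ_inv_mul, one_mul, pow_two]
      have h4 : S.ρ τ = S.ρ ν := by
        have h5 : S.ρ τ * S.ρ ν * S.ρ τ⁻¹ = 1 := by
          calc S.ρ τ * S.ρ ν * S.ρ τ⁻¹ = (S.ρ ν * S.ρ ν) * (S.ρ τ * S.ρ ν * S.ρ τ⁻¹) *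
                (S.ρ ν * S.ρ ν) := by rw [hNN, one_mul, mul_one]
            _ = S.ρ ν * (S.ρ ν * (S.ρ τ * S.ρ ν * S.ρ τ⁻¹) * S.ρ ν) * S.ρ ν := by
              simp only [mul_assoc]
            _ = 1 := by rw [h2, mul_one, hNN]
        rw [h3, ← mul_assoc, hTNT] at h5
        calc S.ρ τ = S.ρ ν * S.ρ ν * S.ρ τ := by rw [hNN, one_mul]
          _ = S.ρ ν := by rw [mul_assoc, h5, mul_one]
      apply hT1
      rw [h4] at hT3 ⊢
      rw [pow_succ, hN2, one_mul] at hT3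
      exact hT3

/-- A torsion-free group with a self-centralizing abelian normal subgroup of rank three and torsion
quotient: the quotient is finite and metabelian. -/
theorem quotient_of_abelian_rank_three (ht : TorsionFree G)
    (hA : centralizer (A : Set G) ≤ A) (hc : ∀ a ∈ A, ∀ b ∈ A, a * b = b * a) (h3 : HasRank A 3)
    (htor : ∀ g : G, ∃ k, 0 < k ∧ g ^ k ∈ A) :
    Finite (G ⧸ A) ∧ derivedSeries (G ⧸ A) 2 = ⊥ := by
  obtain ⟨V, _, _, _, hV, ⟨S⟩⟩ := exists_ratRep A hc (ht.subgroup A) (n := 3) h3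
  have hcent : ∀ g, S.ρ g = 1 ↔ g ∈ A := fun g => S.ρ_eq_one_iff.trans
    ⟨fun h => hA h, fun h => mem_centralizer_iff.mpr fun a ha => hc a ha g h⟩
  -- For `g ∉ A` the vector of a power of `g` lying in `A` is fixed, and it is nonzero because `G`
  -- is torsion-free.
  have hfix : ∀ g, Nonempty (FixedData (S.ρ g)) := by
    intro g
    by_cases hg : g ∈ A
    · have : Nontrivial V := Module.nontrivial_of_finrank_pos (R := ℚ) (by omega)
      obtain ⟨v, hv⟩ := exists_ne (0 : V)
      exact ⟨FixedData.span hv (by rw [(hcent g).mpr hg, Module.End.one_apply])⟩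
    · obtain ⟨k, hk, hgk⟩ := htor g
      refine ⟨FixedData.span (c := S.ι (g ^ k)) (fun h => hg ?_) (S.ρ_ι_pow hgk)⟩
      rw [ht.eq_one_of_pow hk (S.ι_inj _ hgk h)]
      exact A.one_mem
  let ρ : G ⧸ A →* Module.End ℚ V := QuotientGroup.lift A S.ρ fun g hg => (hcent g).mpr hg
  have hρ : ∀ f, ρ f = 1 → f = 1 := by
    intro f hf
    obtain ⟨g, rfl⟩ := QuotientGroup.mk_surjective f
    exact (QuotientGroup.eq_one_iff g).mpr ((hcent g).mp hf)
  have htorF : ∀ f : G ⧸ A, IsOfFinOrder f := by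
    intro f
    obtain ⟨g, rfl⟩ := QuotientGroup.mk_surjective f
    obtain ⟨k, hk, h⟩ := htor g
    exact isOfFinOrder_iff_pow_eq_one.mpr ⟨k, hk, (QuotientGroup.eq_one_iff _).mpr h⟩
  have hfixF : ∀ f, Nonempty (FixedData (ρ f)) := by
    intro f
    obtain ⟨g, rfl⟩ := QuotientGroup.mk_surjective f
    exact hfix g
  have hfin := finite_of_periodic_of_finrank_three ρ hV hρ htorF hfixF
  refine ⟨hfin, derivedSeries_two_eq_bot ρ hV hρ hfixF fun r t ht3 hrt => ?_⟩
  obtain ⟨ν, rfl⟩ := QuotientGroup.mk_surjective r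
  obtain ⟨τ, rfl⟩ := QuotientGroup.mk_surjective t
  refine (QuotientGroup.eq_one_iff τ).mpr (S.mem_of_conj_eq_inv ht hV hcent htor hfix (ν := ν)
    ((QuotientGroup.eq_one_iff _).mp ht3) ((QuotientGroup.eq_one_iff _).mp ?_))
  exact mul_eq_one_iff_eq_inv.mpr hrt

end RankThree

/-! ### Derived length and conclusion -/

theorem derivedSeries_two_eq_bot_of_comm {F : Type u} [Group F] (h : ∀ x y : F, x * y = y * x) :
    derivedSeries F 2 = ⊥ := by
  refine le_bot_iff.mp (derivedSeries_two_le_commutator.trans ?_)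
  rw [_root_.commutator_def, commutator_le]
  exact fun x _ y _ => mem_bot.mpr (commutatorElement_eq_one_iff_mul_comm.mpr (h x y))

theorem derivedSeries_eq_bot_of_injective {F : Type u} {H : Type v} [Group F] [Group H] (f : F →* H)
    (hf : Function.Injective f) {n : ℕ} (h : derivedSeries H n = ⊥) : derivedSeries F n = ⊥ :=
  (Subgroup.map_eq_bot_iff_of_injective _ hf).mp
    (le_bot_iff.mp (h ▸ map_derivedSeries_le_derivedSeries f n))

theorem derivedSeries_two_dihedralGroup (n : ℕ) : derivedSeries (DihedralGroup n) 2 = ⊥ := by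
  let N : Subgroup (DihedralGroup n) :=
    { carrier := Set.range DihedralGroup.r
      one_mem' := ⟨0, rfl⟩
      mul_mem' := by
        rintro _ _ ⟨i, rfl⟩ ⟨j, rfl⟩
        exact ⟨i + j, (DihedralGroup.r_mul_r i j).symm⟩
      inv_mem' := by
        rintro _ ⟨i, rfl⟩
        exact ⟨-i, (DihedralGroup.inv_r i).symm⟩ }
  have hN : _root_.commutator (DihedralGroup n) ≤ N := by
    rw [_root_.commutator_def, commutator_le]
    rintro (i | i) - (j | j) - <;> rw [commutatorElement_def] <;>
      simp only [DihedralGroup.inv_r, DihedralGroup.inv_sr, DihedralGroup.r_mul_r,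
        DihedralGroup.r_mul_sr, DihedralGroup.sr_mul_r, DihedralGroup.sr_mul_sr] <;>
      exact ⟨_, rfl⟩
  rw [derivedSeries_two_eq, eq_bot_iff, commutator_le]
  intro x hx y hy
  obtain ⟨i, rfl⟩ := hN hx
  obtain ⟨j, rfl⟩ := hN hy
  refine mem_bot.mpr (commutatorElement_eq_one_iff_mul_comm.mpr ?_)
  rw [DihedralGroup.r_mul_r, DihedralGroup.r_mul_r, add_comm]

theorem derivedSeries_three_eq_bot_of_quotient {G : Type u} [Group G] (R : Subgroup G) [R.Normal]
    (hc : ∀ a ∈ R, ∀ b ∈ R, a * b = b * a) (h : derivedSeries (G ⧸ R) 2 = ⊥) :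
    derivedSeries G 3 = ⊥ := by
  have hle : derivedSeries G 2 ≤ R := by
    intro x hx
    have h1 := map_derivedSeries_le_derivedSeries (QuotientGroup.mk' R) 2 (mem_map_of_mem _ hx)
    rw [h] at h1
    exact (QuotientGroup.eq_one_iff x).mp (mem_bot.mp h1)
  rw [derivedSeries_succ, eq_bot_iff, commutator_le]
  exact fun x hx y hy =>
    mem_bot.mpr (commutatorElement_eq_one_iff_mul_comm.mpr (hc x (hle hx) y (hle hy)))

section Structure

variable {G : Type u} [Group G]

theorem fittingSubgroup_comm_of_rank_le_two {n : ℕ} (hG : HasRank G n) (ht : TorsionFree G) {m : ℕ}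
    (hm : HasRank (fittingSubgroup G) m) (hm2 : m ≤ 2) :
    ∀ a ∈ fittingSubgroup G, ∀ b ∈ fittingSubgroup G, a * b = b * a := by
  have := isNilpotent_fittingSubgroup hG ht.noLocFinite
  exact fun a ha b hb => Subtype.ext_iff.mp
    (HasRank.comm_of_le_two hm hm2 (ht.subgroup _) ⟨a, ha⟩ ⟨b, hb⟩)

theorem HasRank.quotient_nat {N : Subgroup G} [N.Normal] {n m k : ℕ} (hG : HasRank G n)
    (hN : HasRank N m) (hk : m + k = n) : HasRank (G ⧸ N) k := by
  obtain ⟨a, b, ha, hb, hab⟩ := hG.split_normal N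
  obtain ⟨a, b, rfl, rfl, hab⟩ := ENat.exists_nat_of_add_eq hab
  have : a = m := by exact_mod_cast ha.unique hN
  obtain rfl : b = k := by omega
  exact hb

theorem structure_of_rank_one (hG : HasRank G 3) (ht : TorsionFree G)
    (h : HasRank (fittingSubgroup G) 1) :
    Nonempty (G ⧸ fittingSubgroup G ≃* Multiplicative (ℤ × ℤ)) :=
  nonempty_quotient_mulEquiv_of_rank_one ht (centralizer_fittingSubgroup_le (n := 3) hG ht.noLocFinite)
    (fittingSubgroup_comm_of_rank_le_two (n := 3) (m := 1) hG ht h (by norm_num)) h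
    (HasRank.quotient_nat (n := 3) (m := 1) (k := 2) hG h rfl) (by simp)

theorem structure_of_rank_two (hG : HasRank G 3) (ht : TorsionFree G)
    (h : HasRank (fittingSubgroup G) 2) :
    Nonempty (G ⧸ fittingSubgroup G ≃* Multiplicative ℤ) ∨
      Nonempty (G ⧸ fittingSubgroup G ≃* DihedralGroup 0) ∨
      Nonempty (G ⧸ fittingSubgroup G ≃* Multiplicative (ℤ × ZMod 2)) :=
  classification_of_rank_two ht (centralizer_fittingSubgroup_le (n := 3) hG ht.noLocFinite)
    (fittingSubgroup_comm_of_rank_le_two (n := 3) (m := 2) hG ht h le_rfl) h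
    (HasRank.quotient_nat (n := 3) (m := 2) (k := 1) hG h rfl) fun _ => le_fittingSubgroup

theorem structure_of_rank_three (hG : HasRank G 3) (ht : TorsionFree G)
    (h : HasRank (fittingSubgroup G) 3) :
    Finite (G ⧸ fittingSubgroup G) ∧ derivedSeries G 3 = ⊥ := by
  have hnil := isNilpotent_fittingSubgroup (n := 3) hG ht.noLocFinite
  have hcent := centralizer_fittingSubgroup_le (n := 3) hG ht.noLocFinite
  have htor := HasRank.exists_pow_mem (n := 3) hG (K := fittingSubgroup G) h
  by_cases hc : ∀ a ∈ fittingSubgroup G, ∀ b ∈ fittingSubgroup G, a * b = b * a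
  · obtain ⟨hfin, hder⟩ := quotient_of_abelian_rank_three ht hcent hc h htor
    exact ⟨hfin, derivedSeries_three_eq_bot_of_quotient _ hc hder⟩
  · push Not at hc
    obtain ⟨a, ha, b, hb, hab⟩ := hc
    obtain ⟨h1, h2, hfin⟩ := quotient_of_nonabelian_rank_three ht hcent
      (fun _ => le_fittingSubgroup) h htor (x₀ := ⟨a, ha⟩) (y₀ := ⟨b, hb⟩)
      (fun h => hab (Subtype.ext_iff.mp h))
    refine ⟨hfin, ?_⟩
    have hle1 : _root_.commutator G ≤ fittingSubgroup G := by
      rw [_root_.commutator_def, commutator_le]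
      exact fun x _ y _ => h1 x y
    -- The derived group lies in the Fitting subgroup, which has class two, so the second derived
    -- group lies in its centre and is abelian.
    have hle2 : derivedSeries G 2 ≤ centralizer (fittingSubgroup G : Set G) := by
      rw [derivedSeries_two_eq, commutator_le]
      exact fun x hx y hy => h2 x (hle1 hx) y (hle1 hy)
    rw [derivedSeries_succ, eq_bot_iff, commutator_le]
    exact fun x hx y hy => mem_bot.mpr (commutatorElement_eq_one_iff_mul_comm.mpr
      (mem_centralizer_iff.mp (hle2 hy) x (hcent (hle2 hx))))

theorem derivedSeries_three_eq_bot (hG : HasRank G 3) (ht : TorsionFree G) :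
    derivedSeries G 3 = ⊥ := by
  obtain ⟨m, hm, hr⟩ := HasRank.exists_nat (n := 3) hG (fittingSubgroup G)
  have hG0 : Nontrivial G := by
    by_contra hs
    rw [not_nontrivial_iff_subsingleton] at hs
    have := hG.eq_zero LocFinite.of_finite
    norm_num at this
  have : Nontrivial (fittingSubgroup G) :=
    (nontrivial_iff_ne_bot _).mpr (fittingSubgroup_ne_bot (n := 3) hG ht.noLocFinite)
  have h1 := hr.one_le (ht.subgroup _).not_locFinite
  norm_cast at h1
  obtain rfl | rfl | rfl : m = 1 ∨ m = 2 ∨ m = 3 := by omega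
  · have hc := fittingSubgroup_comm_of_rank_le_two (n := 3) (m := 1) hG ht hr (by norm_num)
    obtain ⟨e⟩ := structure_of_rank_one hG ht hr
    exact derivedSeries_three_eq_bot_of_quotient _ hc (derivedSeries_eq_bot_of_injective
      e.toMonoidHom e.injective (derivedSeries_two_eq_bot_of_comm mul_comm))
  · have hc := fittingSubgroup_comm_of_rank_le_two (n := 3) (m := 2) hG ht hr le_rfl
    refine derivedSeries_three_eq_bot_of_quotient _ hc ?_
    rcases structure_of_rank_two hG ht hr with ⟨⟨e⟩⟩ | ⟨⟨e⟩⟩ | ⟨⟨e⟩⟩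
    · exact derivedSeries_eq_bot_of_injective e.toMonoidHom e.injective
        (derivedSeries_two_eq_bot_of_comm mul_comm)
    · exact derivedSeries_eq_bot_of_injective e.toMonoidHom e.injective
        (derivedSeries_two_dihedralGroup 0)
    · exact derivedSeries_eq_bot_of_injective e.toMonoidHom e.injective
        (derivedSeries_two_eq_bot_of_comm mul_comm)
  · exact (structure_of_rank_three hG ht hr).2

end Structure

theorem mainTheorem2 (G : Type u) [Group G]
    (htf : ∀ g : G, g ≠ 1 → ¬ IsOfFinOrder g)
    (hEA : IsElementaryAmenable G)
    (hG : HasHirschLength G 3) :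
    (HasHirschLength (hirschPlotkinRadical G) 1 →
      (∀ a ∈ hirschPlotkinRadical G, ∀ b ∈ hirschPlotkinRadical G, a * b = b * a) ∧
      Nonempty (G ⧸ hirschPlotkinRadical G ≃* Multiplicative (ℤ × ℤ))) ∧
    (HasHirschLength (hirschPlotkinRadical G) 2 →
      (∀ a ∈ hirschPlotkinRadical G, ∀ b ∈ hirschPlotkinRadical G, a * b = b * a) ∧
      (Nonempty (G ⧸ hirschPlotkinRadical G ≃* Multiplicative ℤ) ∨
       Nonempty (G ⧸ hirschPlotkinRadical G ≃* DihedralGroup 0) ∨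
       Nonempty (G ⧸ hirschPlotkinRadical G ≃* Multiplicative (ℤ × ZMod 2)))) ∧
    (HasHirschLength (hirschPlotkinRadical G) 3 → Group.IsVirtuallyNilpotent G) ∧
    (Group.IsSolvable G ∧ derivedSeries G 3 = ⊥) := by
  have ht : TorsionFree G := fun g hg => by
    by_contra hne
    exact htf g hne hg
  have hr : HasRank G 3 := hG.hasRank (n := 3) rfl
  have hR := hirschPlotkinRadical_eq_fittingSubgroup (n := 3) hr ht
  -- Stated for a variable `R` with its normality instance, so that the equality of the two radicals
  -- can be substituted even though the quotient types depend on them.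
  have key : ∀ (R : Subgroup G) [R.Normal], R = fittingSubgroup G →
      (HasRank R 1 → (∀ a ∈ R, ∀ b ∈ R, a * b = b * a) ∧ Nonempty (G ⧸ R ≃* Multiplicative (ℤ × ℤ))) ∧
      (HasRank R 2 → (∀ a ∈ R, ∀ b ∈ R, a * b = b * a) ∧ (Nonempty (G ⧸ R ≃* Multiplicative ℤ) ∨
        Nonempty (G ⧸ R ≃* DihedralGroup 0) ∨ Nonempty (G ⧸ R ≃* Multiplicative (ℤ × ZMod 2)))) ∧
      (HasRank R 3 → Group.IsVirtuallyNilpotent G) := by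
    rintro R _ rfl
    refine ⟨fun h => ⟨?_, structure_of_rank_one hr ht h⟩, fun h => ⟨?_, structure_of_rank_two hr ht h⟩,
      fun h => ⟨fittingSubgroup G, isNilpotent_fittingSubgroup (n := 3) hr ht.noLocFinite, ?_⟩⟩
    · exact fittingSubgroup_comm_of_rank_le_two (n := 3) (m := 1) hr ht h (by norm_num)
    · exact fittingSubgroup_comm_of_rank_le_two (n := 3) (m := 2) hr ht h le_rfl
    · have := (structure_of_rank_three hr ht h).1
      exact Subgroup.finiteIndex_of_finite_quotient
  obtain ⟨k1, k2, k3⟩ := key _ hR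
  have hder := derivedSeries_three_eq_bot hr ht
  exact ⟨fun h => k1 (h.hasRank (n := 1) rfl), fun h => k2 (h.hasRank (n := 2) rfl),
    fun h => k3 (h.hasRank (n := 3) rfl), ⟨⟨3, hder⟩⟩, hder⟩
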